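/- Consider the fourth Painlevé equation $$y''=\frac{(y')^2}{2y}+\frac32y^3+4xy^2+2\Bigl(x^2-2\alpha+\frac{\beta}{2}\Bigr)y-\frac{\beta^2}{2y}\qquad(\mathrm{P4}).$$ A meromorphic solution $y\not\equiv0$ on $\mathbb C$ is called classical if it is obtained from a solution of a Riccati equation $y'=\sigma(y^2+2xy)+q$, $\sigma^2=1$ (which solves P4 for $2\alpha-\frac{\beta}{2}=-\sigma(\frac q2+1)$, $\beta^2=q^2$), by finitely many of the Bäcklund transformations (all functions involved being $\not\equiv 0$, and all denominators $\not\equiv0$) $$R_0^{+}:\ y\mapsto y+\frac{2(1+2\alpha)y}{y'-y^2-2xy-\beta},\quad(\alpha,\beta)\mapsto(-\alpha-1,\beta-2\alpha-1),$$ $$R_0^{-}:\ y\mapsto y+\frac{2(1-2\alpha)y}{y'+y^2+2xy+\beta},\quad(\alpha,\beta)\mapsto(-\alpha+1,\beta-2\alpha+1),$$ $$R_\infty^{\pm}:\ y\mapsto \pm\frac{y'}{2y}-\frac y2-x+\frac{\beta}{2y},\quad(\alpha,\beta)\mapsto(-\alpha,\beta-2\alpha\mp1).$$ All asymptotic relations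 are for $x\to\infty$, uniformly in closed subsectors of the sector indicated; $\arg x\in(-\frac\pi4,\frac{7\pi}4)$ and $x^p=e^{p(\ln|x|+i\arg x)}$. $\Theta(t)=0,\frac12,1$ for $t<0$, $t=0$, $t>0$. For $A\in\{\frac\beta2,-\frac\beta2\}$, a background with leading term $\frac Ax$ of the open quadrant $\frac{k\pi}2<\arg x<\frac{(k+1)\pi}2$ is a meromorphic solution of P4 with $y=\frac Ax(1+O(x^{-2}))$ in that whole open quadrant. A formula $$y=\frac Ax\bigl(1+O(x^{-2})\bigr)+\mu\,x^pe^{\mp x^2}\bigl(1+O(x^{-2})\bigr)$$ in a sector $|\arg x-\frac{k\pi}2|<\frac\pi4$ means that $y=\frac Ax(1+O(x^{-2}))$ and that $y-B=\mu\,x^pe^{\mp x^2}(1+O(x^{-2}))$, where $B$ is the background of the quadrant containing $x$; on the ray $\arg x=\frac{k\pi}2$, $B$ is the half-sum of the backgrounds of the two adjacent quadrants and the right-hand side is read as $x^pe^{\mp x^2}(\mu+O(x^{-2}))$. **Theorem.** Let $\beta=-2n$ with an integer $n\ge1$, and let $\alpha\in\mathbb C$ with $\alpha+\frac12\notin\mathbb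 Z$. Then there exist, for each quadrant, backgrounds with leading terms $\frac{\beta}{2x}$ and $-\frac{\beta}{2x}$ as they are used below (independent of $c$), and a family of pairwise different classical solutions $y_c$, $c\in\mathbb C\cup\{\infty\}$, of P4 with parameters $\alpha,\beta$ such that $y=y_c$ behaves as follows. i) $\arg x\in(-\frac\pi4,\frac\pi4)$: if $c\in\mathbb C$, then $$y=\frac{\beta}{2x}\bigl(1+O(x^{-2})\bigr)+\mu_1x^{-1+4n+2\alpha}e^{-x^2}\bigl(1+O(x^{-2})\bigr),\quad \mu_1=-2\bigl(c+i\sqrt\pi\,\Theta(\arg x)\bigr)\frac{2^{-\frac12+2n+\alpha}}{(n-1)!\,\Gamma(\alpha+n+\frac12)};$$ if $c=\infty$, then $y=-\frac{\beta}{2x}(1+O(x^{-2}))$. ii) $\arg x\in(\frac\pi4,\frac{3\pi}4)$: if $c+i\sqrt\pi\ne0$, then $$y=-\frac{\beta}{2x}\bigl(1+O(x^{-2})\bigr)+\mu_2x^{2n-1-2\alpha}e^{x^2}\bigl(1+O(x^{-2})\bigr),$$ $$\mu_2=-2i\sqrt\pi\Bigl(\frac{i\sqrt\pi}{(c+i\sqrt\pi)(e^{2i\pi\alpha}+1)}-\Theta(\arg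 x-\tfrac\pi2)\Bigr)\frac{(-1)^n2^{n-\frac12-\alpha}e^{i\pi\alpha}}{(n-1)!\,\Gamma(-\alpha+\frac12)};$$ if $c+i\sqrt\pi=0$, then $y=\frac{\beta}{2x}(1+O(x^{-2}))$. iii) $\arg x\in(\frac{3\pi}4,\frac{5\pi}4)$: if $c(e^{-2i\pi\alpha}+1)+i\sqrt\pi\ne0$, then $$y=\frac{\beta}{2x}\bigl(1+O(x^{-2})\bigr)+\mu_3x^{4n-1+2\alpha}e^{-x^2}\bigl(1+O(x^{-2})\bigr),$$ $$\mu_3=2i\sqrt\pi\Bigl(\frac{c+i\sqrt\pi}{c(e^{-2i\pi\alpha}+1)+i\sqrt\pi}-\Theta(\arg x-\pi)\Bigr)\frac{2^{2n-\frac12+\alpha}e^{-2i\pi\alpha}}{(n-1)!\,\Gamma(\alpha+n+\frac12)};$$ if $c(e^{-2i\pi\alpha}+1)+i\sqrt\pi=0$, then $y=-\frac{\beta}{2x}(1+O(x^{-2}))$. iv) $\arg x\in(\frac{5\pi}4,\frac{7\pi}4)$: if $c\ne0$, then $$y=-\frac{\beta}{2x}\bigl(1+O(x^{-2})\bigr)+\mu_4x^{2n-1-2\alpha}e^{x^2}\bigl(1+O(x^{-2})\bigr),$$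 $$\mu_4=-2i\sqrt\pi\Bigl(\frac{i\sqrt\pi}{c(e^{-2i\pi\alpha}+1)}+1-\Theta(\arg x-\tfrac{3\pi}2)\Bigr)\frac{(-1)^n2^{n-\frac12-\alpha}e^{3\pi i\alpha}}{(n-1)!\,\Gamma(-\alpha+\frac12)};$$ if $c=0$, then $y=\frac{\beta}{2x}(1+O(x^{-2}))$. In ii)–iv) the value $c=\infty$ is included in the first alternative, with the limiting values of the fractions containing $c$: $0$ in $\mu_2$ and $\mu_4$, and $\frac{1}{e^{-2i\pi\alpha}+1}$ in $\mu_3$. -/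

import Mathlib

open Filter Set

noncomputable section

namespace PIV

/-- `y` is (the normal form of) a meromorphic function on `ℂ` that does not vanish identically:
away from a closed discrete set it has no zeros. -/
def IsNonzeroMeromorphic (y : ℂ → ℂ) : Prop :=
  MeromorphicNFOn y univ ∧ ∀ᶠ x in codiscrete ℂ, y x ≠ 0

/-- `y` is a meromorphic solution of the fourth Painlevé equation
`y'' = y'² / (2y) + (3/2) y³ + 4 x y² + 2 (x² - 2α + β/2) y - β² / (2y)`. -/
def IsP4Solution (α β : ℂ) (y : ℂ → ℂ) : Prop :=
  IsNonzeroMeromorphic y ∧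
    ∀ᶠ x in codiscrete ℂ,
      deriv (deriv y) x = (deriv y x) ^ 2 / (2 * y x) + 3 / 2 * (y x) ^ 3 + 4 * x * (y x) ^ 2
        + 2 * (x ^ 2 - 2 * α + β / 2) * y x - β ^ 2 / (2 * y x)

/-- Classical solutions of the fourth Painlevé equation with parameters `α`, `β`: the functions
obtained from the solutions of the Riccati equations `y' = σ (y² + 2xy) + q`, `σ² = 1`, by finitely
many of the Bäcklund transformations `R₀⁺`, `R₀⁻`, `R∞⁺`, `R∞⁻`. -/
inductive IsClassical : ℂ → ℂ → (ℂ → ℂ) → Prop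
  | riccati (α β σ q : ℂ) (y : ℂ → ℂ) (hσ : σ ^ 2 = 1)
      (ha : 2 * α - β / 2 = -σ * (q / 2 + 1)) (hb : β ^ 2 = q ^ 2)
      (hy : IsNonzeroMeromorphic y)
      (hric : ∀ᶠ x in codiscrete ℂ, deriv y x = σ * ((y x) ^ 2 + 2 * x * y x) + q) :
      IsClassical α β y
  | zeroPlus (α β : ℂ) (y w : ℂ → ℂ) (h : IsClassical α β y) (hw : IsNonzeroMeromorphic w)
      (hR : ∀ᶠ x in codiscrete ℂ, deriv y x - (y x) ^ 2 - 2 * x * y x - β ≠ 0 ∧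
        w x = y x + 2 * (1 + 2 * α) * y x / (deriv y x - (y x) ^ 2 - 2 * x * y x - β)) :
      IsClassical (-α - 1) (β - 2 * α - 1) w
  | zeroMinus (α β : ℂ) (y w : ℂ → ℂ) (h : IsClassical α β y) (hw : IsNonzeroMeromorphic w)
      (hR : ∀ᶠ x in codiscrete ℂ, deriv y x + (y x) ^ 2 + 2 * x * y x + β ≠ 0 ∧
        w x = y x + 2 * (1 - 2 * α) * y x / (deriv y x + (y x) ^ 2 + 2 * x * y x + β)) :
      IsClassical (-α + 1) (β - 2 * α + 1) w
  | inftyPlus (α β : ℂ) (y w : ℂ → ℂ) (h : IsClassical α β y) (hw : IsNonzeroMeromorphic w)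
      (hR : ∀ᶠ x in codiscrete ℂ,
        w x = deriv y x / (2 * y x) - y x / 2 - x + β / (2 * y x)) :
      IsClassical (-α) (β - 2 * α - 1) w
  | inftyMinus (α β : ℂ) (y w : ℂ → ℂ) (h : IsClassical α β y) (hw : IsNonzeroMeromorphic w)
      (hR : ∀ᶠ x in codiscrete ℂ,
        w x = -(deriv y x) / (2 * y x) - y x / 2 - x + β / (2 * y x)) :
      IsClassical (-α) (β - 2 * α + 1) w

/-- The point `x = r e^{iθ}`. -/
def polar (r θ : ℝ) : ℂ := (r : ℂ) * Complex.exp (Complex.I * (θ : ℂ))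

/-- The step function: `0` for `t < 0`, `1/2` for `t = 0`, `1` for `t > 0`. -/
def step (t : ℝ) : ℂ := if t < 0 then 0 else if t = 0 then 1 / 2 else 1

/-- `y = (A / x) (1 + O(x⁻²))` as `x → ∞`, `θ₁ < arg x < θ₂`, uniformly in closed subsectors. -/
def HasLeading (y : ℂ → ℂ) (A : ℂ) (θ₁ θ₂ : ℝ) : Prop :=
  ∀ δ : ℝ, 0 < δ → ∃ C R : ℝ, 0 < R ∧ ∀ r θ : ℝ, R ≤ r → θ₁ + δ ≤ θ → θ ≤ θ₂ - δ →
    ‖y (polar r θ) - A / polar r θ‖ ≤ C * r⁻¹ ^ 2 * ‖A / polar r θ‖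

/-- `B` is the algebraic background `(A / x) (1 + O(x⁻²))` (with no exponentially small term) of
the `k`-th quadrant `kπ/2 < arg x < (k+1)π/2`: a solution of the equation with this behaviour in
the whole open quadrant. -/
def IsBackground (α β A : ℂ) (k : ℤ) (B : ℂ → ℂ) : Prop :=
  IsP4Solution α β B ∧
    HasLeading B A ((k : ℝ) * (Real.pi / 2)) (((k : ℝ) + 1) * (Real.pi / 2))

/-- The function `x^p e^{s x²}` at `x = r e^{iθ}`, the branch of the power being
`x^p = exp (p (log r + iθ))`. -/
def expTerm (p s : ℂ) (r θ : ℝ) : ℂ :=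
  Complex.exp (p * ((Real.log r : ℂ) + Complex.I * (θ : ℂ))) *
    Complex.exp (s * (polar r θ) ^ 2)

/-- In the sector `θ₀ - π/4 < arg x < θ₀ + π/4`, as `x → ∞`, uniformly in closed subsectors,
`y = (A / x) (1 + O(x⁻²)) + μ(arg x) x^p e^{s x²} (1 + O(x⁻²))`,
where the first summand is the background `Bm` for `arg x < θ₀`, the background `Bp` for
`arg x > θ₀`, and their half-sum on the Stokes ray `arg x = θ₀`. On the Stokes ray the second
summand is read as `x^p e^{s x²} (μ + O(x⁻²))`, which is the same thing unless `μ = 0` there. -/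
def HasExpansion (y Bm Bp : ℂ → ℂ) (A : ℂ) (μ : ℝ → ℂ) (p s : ℂ) (θ₀ : ℝ) : Prop :=
  HasLeading y A (θ₀ - Real.pi / 4) (θ₀ + Real.pi / 4) ∧
  ∀ δ : ℝ, 0 < δ → ∃ C R : ℝ, 0 < R ∧ ∀ r θ : ℝ, R ≤ r →
    θ₀ - Real.pi / 4 + δ ≤ θ → θ ≤ θ₀ + Real.pi / 4 - δ →
    (θ < θ₀ → ‖y (polar r θ) - Bm (polar r θ) - μ θ * expTerm p s r θ‖
        ≤ C * r⁻¹ ^ 2 * ‖μ θ * expTerm p s r θ‖) ∧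
    (θ₀ < θ → ‖y (polar r θ) - Bp (polar r θ) - μ θ * expTerm p s r θ‖
        ≤ C * r⁻¹ ^ 2 * ‖μ θ * expTerm p s r θ‖) ∧
    (θ = θ₀ → ‖y (polar r θ) - (Bm (polar r θ) + Bp (polar r θ)) / 2 - μ θ * expTerm p s r θ‖
        ≤ C * r⁻¹ ^ 2 * ‖expTerm p s r θ‖)

/-- The constant `i √π`. -/
def iSqrtPi : ℂ := Complex.I * (Real.sqrt Real.pi : ℂ)

/-- `μ₁ = -2 (c + i√π Θ(arg x)) 2^{-1/2+2n+α} / ((n-1)! Γ(α+n+1/2))`. -/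
def mu₁ (α : ℂ) (n : ℕ) (c : ℂ) (θ : ℝ) : ℂ :=
  -2 * (c + iSqrtPi * step θ) *
    ((2 : ℂ) ^ (-1 / 2 + 2 * (n : ℂ) + α) /
      (((n - 1).factorial : ℂ) * Complex.Gamma (α + n + 1 / 2)))

/-- `μ₂ = -2i√π (ρ - Θ(arg x - π/2)) (-1)ⁿ 2^{n-1/2-α} e^{iπα} / ((n-1)! Γ(-α+1/2))`. -/
def mu₂ (α : ℂ) (n : ℕ) (ρ : ℂ) (θ : ℝ) : ℂ :=
  -2 * iSqrtPi * (ρ - step (θ - Real.pi / 2)) *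
    ((-1) ^ n * (2 : ℂ) ^ ((n : ℂ) - 1 / 2 - α) * Complex.exp (Complex.I * Real.pi * α) /
      (((n - 1).factorial : ℂ) * Complex.Gamma (-α + 1 / 2)))

/-- `μ₃ = 2i√π (ρ - Θ(arg x - π)) 2^{2n-1/2+α} e^{-2iπα} / ((n-1)! Γ(α+n+1/2))`. -/
def mu₃ (α : ℂ) (n : ℕ) (ρ : ℂ) (θ : ℝ) : ℂ :=
  2 * iSqrtPi * (ρ - step (θ - Real.pi)) *
    ((2 : ℂ) ^ (2 * (n : ℂ) - 1 / 2 + α) * Complex.exp (-2 * Complex.I * Real.pi * α) /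
      (((n - 1).factorial : ℂ) * Complex.Gamma (α + n + 1 / 2)))

/-- `μ₄ = -2i√π (ρ + 1 - Θ(arg x - 3π/2)) (-1)ⁿ 2^{n-1/2-α} e^{3πiα} / ((n-1)! Γ(-α+1/2))`. -/
def mu₄ (α : ℂ) (n : ℕ) (ρ : ℂ) (θ : ℝ) : ℂ :=
  -2 * iSqrtPi * (ρ + 1 - step (θ - 3 * Real.pi / 2)) *
    ((-1) ^ n * (2 : ℂ) ^ ((n : ℂ) - 1 / 2 - α) * Complex.exp (3 * Real.pi * Complex.I * α) /
      (((n - 1).factorial : ℂ) * Complex.Gamma (-α + 1 / 2)))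

end PIV

end

/-!
The solutions come from Weber's equation `w'' + 2 x w' + 2 a w = 0` with `a = α + 1/2`. If `w` is a
solution, then `g₁ = w'/w` satisfies a Riccati equation, and the Bäcklund transformation `R∞⁺` takes
the simple form `g_{k+2} = g_k + g_{k+1}'/g_{k+1}` (with `g₀ = 0`), because the chain obeys the
Volterra lattice `g_k' = g_k (g_{k+1} - g_{k-1})` with the first integral
`g_k (g_{k+1} + g_k + g_{k-1} + 2x) = b_k`, `b_{2j} = -2j` (`chain_integral`). Hence `g_{2n}` is a
classical solution with parameters `α` and `β = -2n` (`isP4Solution_chainNF`,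
`isClassical_chainNF`), and it does not change when `w` is multiplied by a constant.

In the variable `ζ = log x` sectors become strips, and relative errors `O(x⁻²)` survive
differentiation by Cauchy's estimate (`Small.deriv`). So a relation
`F = K x^q e^{s x²} (1 + O(x⁻²))` (`IsAsymp`) can be carried along the chain. There are two cases:
`w ~ x^{-a}` leads to `g_{2n} ~ -n/x = β/(2x)` and `w ~ x^{a-1} e^{-x²}` leads to `g_{2n} ~ n/x`
(`chain_leading_of_pow`, `chain_leading_of_exp`). For two solutions `w`, `v` of the same type, the
difference of the first members of the chains is the Wronskian divided by `w v`, an exact multiple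
of `e^{-x²}/(w v)`; linearizing the recursion multiplies it by explicit factors (`chain_sub_of_pow`,
`chain_sub_of_exp`). In each of the four sectors of opening `π/2` about the half-axes one writes `w`
as a dominant plus `t` times a recessive Weber function; the exponentially small term of `g_{2n}`,
measured against the background with parameter `t'`, is then proportional to `t - t'`
(`IsSectorPair.hasExpansion_of_pow`, `IsSectorPair.hasExpansion_of_exp`).

What remains is the Stokes phenomenon of Weber's equation. The functions recessive on the four
half-axes are rotations of Hermite functions of complex index, constructed from a Laplace integral
with rotated path and the downward recurrence (`exists_isHermite`). Their values at `0` give the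
Wronskians, and these give the linear relation between three of the functions
(`connection_formula`). Continuing the family `weberDown + c m weberRight` around the origin by this
relation turns `c` into the fractions in the coefficients.
-/

namespace PIV

open Topology Asymptotics Metric

/-! ### Asymptotic relations in the logarithmic variable -/

/-- With `x = exp ζ`, the sets `{ζ | L ≤ Re ζ, θ₁ + δ ≤ Im ζ ≤ θ₂ - δ}` are the truncated closed
subsectors of the sector `θ₁ < arg x < θ₂`; this is the filter they generate as `L → ∞`. -/
def strip (θ₁ θ₂ δ : ℝ) : Filter ℂ :=
  comap Complex.re atTop ⊓ 𝓟 {ζ | θ₁ + δ ≤ ζ.im ∧ ζ.im ≤ θ₂ - δ}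

/-- The filter of those sets that contain a truncation of every closed subsector of the sector
`θ₁ < arg x < θ₂`, in the variable `ζ = log x`. -/
def sector (θ₁ θ₂ : ℝ) : Filter ℂ := ⨆ δ ∈ Ioi (0 : ℝ), strip θ₁ θ₂ δ

variable {θ₁ θ₂ : ℝ}

theorem strip_le_sector {δ : ℝ} (hδ : 0 < δ) : strip θ₁ θ₂ δ ≤ sector θ₁ θ₂ :=
  le_iSup₂_of_le δ hδ le_rfl

theorem eventually_sector {P : ℂ → Prop} :
    (∀ᶠ ζ in sector θ₁ θ₂, P ζ) ↔ ∀ δ > 0, ∀ᶠ ζ in strip θ₁ θ₂ δ, P ζ := by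
  simp [sector, eventually_iSup]

theorem eventually_strip {P : ℂ → Prop} {δ : ℝ} :
    (∀ᶠ ζ in strip θ₁ θ₂ δ, P ζ) ↔
      ∃ L : ℝ, ∀ ζ : ℂ, L ≤ ζ.re → θ₁ + δ ≤ ζ.im → ζ.im ≤ θ₂ - δ → P ζ := by
  rw [strip, eventually_inf_principal, eventually_comap, eventually_atTop]
  constructor
  · rintro ⟨L, h⟩
    exact ⟨L, fun ζ h1 h2 h3 => h _ h1 ζ rfl ⟨h2, h3⟩⟩
  · rintro ⟨L, h⟩
    exact ⟨L, fun b hb ζ hζ h2 => h ζ (hζ ▸ hb) h2.1 h2.2⟩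

theorem sector_mono {θ₁' θ₂' : ℝ} (h₁ : θ₁ ≤ θ₁') (h₂ : θ₂' ≤ θ₂) :
    sector θ₁' θ₂' ≤ sector θ₁ θ₂ := by
  intro s hs
  have := eventually_sector.1 (show ∀ᶠ ζ in sector θ₁ θ₂, ζ ∈ s from hs)
  refine eventually_sector.2 fun δ hδ => ?_
  obtain ⟨L, hL⟩ := eventually_strip.1 (this δ hδ)
  exact eventually_strip.2 ⟨L, fun ζ a b c => hL ζ a (by linarith) (by linarith)⟩

theorem sector_neBot (h : θ₁ < θ₂) : (sector θ₁ θ₂).NeBot := by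
  refine neBot_of_le (f := strip θ₁ θ₂ ((θ₂ - θ₁) / 2)) (hf := ?_)
    (strip_le_sector (by linarith))
  rw [neBot_iff]
  intro hb
  obtain ⟨L, hL⟩ := eventually_strip.1
    (show ∀ᶠ ζ in strip θ₁ θ₂ ((θ₂ - θ₁) / 2), False by rw [hb]; trivial)
  exact hL ⟨L, (θ₁ + θ₂) / 2⟩ le_rfl (by simp; linarith) (by simp; linarith)

/-- Closed discs of a fixed small radius about the points of a subsector lie in a slightly larger
subsector: a relation that holds in the sector also holds on such discs. -/
theorem eventually_closedBall {P : ℂ → Prop} {δ : ℝ}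
    (h : ∀ᶠ ζ in strip θ₁ θ₂ (δ / 2), P ζ) :
    ∀ᶠ ζ in strip θ₁ θ₂ δ, ∀ z ∈ closedBall ζ (min 1 (δ / 2)), P z := by
  obtain ⟨L, hL⟩ := eventually_strip.1 h
  refine eventually_strip.2 ⟨L + 1, fun ζ h1 h2 h3 z hz => ?_⟩
  have hz' : ‖z - ζ‖ ≤ min 1 (δ / 2) := by simpa [dist_eq_norm] using hz
  have hr := (Complex.abs_re_le_norm (z - ζ)).trans hz'
  have hi := (Complex.abs_im_le_norm (z - ζ)).trans hz'
  have m1 := min_le_left 1 (δ / 2)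
  have m2 := min_le_right 1 (δ / 2)
  rw [Complex.sub_re, abs_le] at hr
  rw [Complex.sub_im, abs_le] at hi
  exact hL z (by linarith [hr.1]) (by linarith [hi.1]) (by linarith [hi.2])

theorem eventually_sector_nhds {P : ℂ → Prop} (h : ∀ᶠ ζ in sector θ₁ θ₂, P ζ) :
    ∀ᶠ ζ in sector θ₁ θ₂, ∀ᶠ z in 𝓝 ζ, P z := by
  rw [eventually_sector] at h ⊢
  intro δ hδ
  filter_upwards [eventually_closedBall (h (δ / 2) (by positivity))] with ζ hζ
  exact mem_of_superset (closedBall_mem_nhds ζ (by positivity)) hζ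

/-- `g` is `O(x⁻²)`, `x = exp ζ`, uniformly in closed subsectors, and analytic there. -/
def Small (θ₁ θ₂ : ℝ) (g : ℂ → ℂ) : Prop :=
  (∀ᶠ ζ in sector θ₁ θ₂, AnalyticAt ℂ g ζ) ∧
    ∀ δ > 0, g =O[strip θ₁ θ₂ δ] fun ζ => Real.exp (-2 * ζ.re)

namespace Small

variable {f g : ℂ → ℂ}

theorem mono {θ₁' θ₂' : ℝ} (hg : Small θ₁ θ₂ g) (h₁ : θ₁ ≤ θ₁') (h₂ : θ₂' ≤ θ₂) :
    Small θ₁' θ₂' g := by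
  refine ⟨sector_mono h₁ h₂ hg.1, fun δ hδ => (hg.2 δ hδ).mono ?_⟩
  exact inf_le_inf_left _ (principal_mono.2 fun ζ hζ =>
    ⟨by linarith [hζ.1], by linarith [hζ.2]⟩)

theorem zero : Small θ₁ θ₂ (fun _ => 0) :=
  ⟨Eventually.of_forall fun _ => analyticAt_const, fun _ _ => isBigO_zero _ _⟩

theorem add (hf : Small θ₁ θ₂ f) (hg : Small θ₁ θ₂ g) : Small θ₁ θ₂ (fun ζ => f ζ + g ζ) :=
  ⟨by filter_upwards [hf.1, hg.1] with ζ h1 h2 using h1.add h2,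
    fun δ hδ => (hf.2 δ hδ).add (hg.2 δ hδ)⟩

theorem tendsto_strip (hg : Small θ₁ θ₂ g) {δ : ℝ} (hδ : 0 < δ) :
    Tendsto g (strip θ₁ θ₂ δ) (𝓝 0) := by
  refine (hg.2 δ hδ).trans_tendsto ?_
  have h : Tendsto (fun t : ℝ => Real.exp (-2 * t)) atTop (𝓝 0) :=
    Real.tendsto_exp_atBot.comp (tendsto_id.const_mul_atTop_of_neg (by norm_num))
  exact (h.comp tendsto_comap).mono_left inf_le_left

theorem tendsto (hg : Small θ₁ θ₂ g) : Tendsto g (sector θ₁ θ₂) (𝓝 0) :=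
  tendsto_iSup.2 fun _ => tendsto_iSup.2 fun hδ => hg.tendsto_strip hδ

theorem mul_of_isBigO_one (hf : Small θ₁ θ₂ f) (hg : ∀ᶠ ζ in sector θ₁ θ₂, AnalyticAt ℂ g ζ)
    (hb : ∀ δ > 0, g =O[strip θ₁ θ₂ δ] fun _ => (1 : ℝ)) : Small θ₁ θ₂ (fun ζ => f ζ * g ζ) :=
  ⟨by filter_upwards [hf.1, hg] with ζ h1 h2 using h1.mul h2,
    fun δ hδ => by simpa using (hf.2 δ hδ).mul (hb δ hδ)⟩

theorem mul (hf : Small θ₁ θ₂ f) (hg : Small θ₁ θ₂ g) : Small θ₁ θ₂ (fun ζ => f ζ * g ζ) :=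
  hf.mul_of_isBigO_one hg.1 fun _ hδ => (hg.tendsto_strip hδ).isBigO_one ℝ

theorem const_mul (hf : Small θ₁ θ₂ f) (c : ℂ) : Small θ₁ θ₂ (fun ζ => c * f ζ) :=
  ⟨by filter_upwards [hf.1] with ζ h1 using analyticAt_const.mul h1,
    fun δ hδ => (hf.2 δ hδ).const_mul_left c⟩

theorem congr (hf : Small θ₁ θ₂ f) (h : ∀ᶠ ζ in sector θ₁ θ₂, g ζ = f ζ) : Small θ₁ θ₂ g := by
  refine ⟨?_, fun δ hδ => (hf.2 δ hδ).congr' ?_ EventuallyEq.rfl⟩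
  · filter_upwards [hf.1, eventually_sector_nhds h] with ζ h1 h2
    exact h1.congr (h2.mono fun _ h => h.symm)
  · exact (eventually_sector.1 h δ hδ).mono fun _ h => h.symm

theorem one_add_ne_zero (hf : Small θ₁ θ₂ f) : ∀ᶠ ζ in sector θ₁ θ₂, 1 + f ζ ≠ 0 := by
  have : Tendsto (fun ζ => 1 + f ζ) (sector θ₁ θ₂) (𝓝 (1 + 0)) := hf.tendsto.const_add 1
  exact this.eventually_ne (by simp)

theorem one_add_mul (hf : Small θ₁ θ₂ f) (hg : Small θ₁ θ₂ g) :
    ∃ h, Small θ₁ θ₂ h ∧ ∀ ζ, (1 + f ζ) * (1 + g ζ) = 1 + h ζ :=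
  ⟨_, (hf.add hg).add (hf.mul hg), fun ζ => by ring⟩

theorem one_add_inv (hf : Small θ₁ θ₂ f) :
    ∃ h, Small θ₁ θ₂ h ∧ ∀ᶠ ζ in sector θ₁ θ₂, (1 + f ζ)⁻¹ = 1 + h ζ := by
  refine ⟨fun ζ => (-1 * f ζ) * (1 + f ζ)⁻¹, ?_, ?_⟩
  · refine (hf.const_mul (-1)).mul_of_isBigO_one ?_ fun δ hδ => ?_
    · filter_upwards [hf.1, hf.one_add_ne_zero] with ζ h1 h2
        using (analyticAt_const.add h1).inv h2
    · have : Tendsto (fun ζ => (1 + f ζ)⁻¹) (strip θ₁ θ₂ δ) (𝓝 (1 + 0)⁻¹) :=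
        ((hf.tendsto_strip hδ).const_add 1).inv₀ (by simp)
      exact this.isBigO_one ℝ
  · filter_upwards [hf.one_add_ne_zero] with ζ h
    field_simp
    ring

/-- The Cauchy estimate on discs of fixed radius in the variable `ζ`. -/
theorem deriv (hf : Small θ₁ θ₂ f) : Small θ₁ θ₂ (deriv f) := by
  refine ⟨hf.1.mono fun _ h => h.deriv, fun δ hδ => ?_⟩
  obtain ⟨C, hC⟩ := (hf.2 (δ / 2) (by positivity)).bound
  have hρ : 0 < min 1 (δ / 2) := by positivity
  refine IsBigO.of_bound (|C| * Real.exp 2 / min 1 (δ / 2)) ?_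
  filter_upwards [eventually_closedBall hC,
    eventually_closedBall (eventually_sector.1 hf.1 (δ / 2) (by positivity))] with ζ h1 h2
  have hd : DiffContOnCl ℂ f (ball ζ (min 1 (δ / 2))) := by
    refine DifferentiableOn.diffContOnCl fun z hz => ?_
    rw [closure_ball _ hρ.ne'] at hz
    exact (h2 z hz).differentiableAt.differentiableWithinAt
  have := Complex.norm_deriv_le_of_forall_mem_sphere_norm_le hρ hd
    (C := |C| * Real.exp 2 * Real.exp (-2 * ζ.re)) fun z hz => by
      refine (h1 z (sphere_subset_closedBall hz)).trans ?_
      have hz' : ‖z - ζ‖ = min 1 (δ / 2) := by simpa [dist_eq_norm] using hz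
      have hr := (Complex.abs_re_le_norm (z - ζ)).trans (hz'.le.trans (min_le_left _ _))
      rw [Complex.sub_re, abs_le] at hr
      rw [mul_assoc, ← Real.exp_add, Real.norm_of_nonneg (Real.exp_pos _).le]
      exact mul_le_mul (le_abs_self C) (Real.exp_le_exp.2 (by linarith [hr.1]))
        (Real.exp_pos _).le (abs_nonneg C)
  rw [Real.norm_of_nonneg (Real.exp_pos _).le]
  refine this.trans (le_of_eq ?_)
  ring

end Small

/-- The function `K x^q exp (s x²)` in the variable `ζ = log x`. -/
noncomputable def powExp (K q s ζ : ℂ) : ℂ := K * Complex.exp (q * ζ + s * Complex.exp (2 * ζ))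

/-- `F = K x^q exp (s x²) (1 + O(x⁻²))` as `x = exp ζ → ∞`, uniformly in closed subsectors, the
relative error being analytic. For `K = 0` this says that `F` vanishes for large `x`. -/
def IsAsymp (θ₁ θ₂ : ℝ) (F : ℂ → ℂ) (K q s : ℂ) : Prop :=
  ∃ g, Small θ₁ θ₂ g ∧ ∀ᶠ ζ in sector θ₁ θ₂, F ζ = powExp K q s ζ * (1 + g ζ)

theorem powExp_ne_zero {K : ℂ} (hK : K ≠ 0) (q s ζ : ℂ) : powExp K q s ζ ≠ 0 :=
  mul_ne_zero hK (Complex.exp_ne_zero _)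

theorem powExp_mul (K q s K' q' s' ζ : ℂ) :
    powExp K q s ζ * powExp K' q' s' ζ = powExp (K * K') (q + q') (s + s') ζ := by
  simp only [powExp]
  rw [show (q + q') * ζ + (s + s') * Complex.exp (2 * ζ) =
    (q * ζ + s * Complex.exp (2 * ζ)) + (q' * ζ + s' * Complex.exp (2 * ζ)) by ring,
    Complex.exp_add (q * ζ + s * Complex.exp (2 * ζ))]
  ring

theorem powExp_inv (K q s ζ : ℂ) : (powExp K q s ζ)⁻¹ = powExp K⁻¹ (-q) (-s) ζ := by
  simp only [powExp]
  rw [mul_inv, ← Complex.exp_neg]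
  congr 2
  ring

theorem hasDerivAt_powExp (K q s ζ : ℂ) :
    HasDerivAt (powExp K q s) (powExp K q s ζ * (q + 2 * s * Complex.exp (2 * ζ))) ζ := by
  have h1 : HasDerivAt (fun ζ : ℂ => Complex.exp (2 * ζ)) (Complex.exp (2 * ζ) * 2) ζ := by
    simpa using ((hasDerivAt_id ζ).const_mul 2).cexp
  have h2 := ((((hasDerivAt_id ζ).const_mul q).add (h1.const_mul s)).cexp).const_mul K
  refine h2.congr_deriv ?_
  simp [powExp]
  ring

theorem analyticAt_powExp (K q s ζ : ℂ) : AnalyticAt ℂ (powExp K q s) ζ :=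
  Differentiable.analyticAt (fun z => (hasDerivAt_powExp K q s z).differentiableAt) ζ

theorem norm_powExp (K q s ζ : ℂ) : ‖powExp K q s ζ‖ =
    ‖K‖ * Real.exp (q.re * ζ.re - q.im * ζ.im + (s * Complex.exp (2 * ζ)).re) := by
  simp [powExp, Complex.norm_exp]

/-- A power `x^q` with `Re q ≤ -2` is `O(x⁻²)`. -/
theorem small_powExp_zero (K : ℂ) {q : ℂ} (hq : q.re ≤ -2) : Small θ₁ θ₂ (powExp K q 0) := by
  refine ⟨Eventually.of_forall fun ζ => analyticAt_powExp K q 0 ζ, fun δ _ => ?_⟩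
  refine IsBigO.of_bound (‖K‖ * Real.exp (|q.im| * (|θ₁ + δ| + |θ₂ - δ|)))
    (eventually_strip.2 ⟨0, fun ζ h0 h1 h2 => ?_⟩)
  rw [norm_powExp, mul_assoc, Real.norm_of_nonneg (Real.exp_pos _).le, ← Real.exp_add]
  refine mul_le_mul_of_nonneg_left (Real.exp_le_exp.2 ?_) (norm_nonneg K)
  have : |ζ.im| ≤ |θ₁ + δ| + |θ₂ - δ| := by
    rw [abs_le]
    constructor
    · linarith [neg_abs_le (θ₁ + δ), abs_nonneg (θ₂ - δ)]
    · linarith [le_abs_self (θ₂ - δ), abs_nonneg (θ₁ + δ)]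
  have h3 : -(q.im * ζ.im) ≤ |q.im| * (|θ₁ + δ| + |θ₂ - δ|) :=
    (neg_le_abs _).trans (by rw [abs_mul]; gcongr)
  have h4 : q.re * ζ.re ≤ -2 * ζ.re := by gcongr
  rw [zero_mul, Complex.zero_re]
  linarith

/-- `x^q exp (s x²)` is `O(x⁻²)` in a sector where `Re (s x²) < 0`. -/
theorem small_powExp_of_neg (K q s : ℂ)
    (hs : ∀ δ > 0, ∃ η > 0, ∀ ζ : ℂ, θ₁ + δ ≤ ζ.im → ζ.im ≤ θ₂ - δ →
      (s * Complex.exp (2 * ζ)).re ≤ -η * Real.exp (2 * ζ.re)) :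
    Small θ₁ θ₂ (powExp K q s) := by
  refine ⟨Eventually.of_forall fun ζ => analyticAt_powExp K q s ζ, fun δ hδ => ?_⟩
  obtain ⟨η, hη, h⟩ := hs δ hδ
  have hlim : ∀ᶠ t : ℝ in atTop, (q.re + 2) * t ≤ η * Real.exp (2 * t) := by
    have h1 : Tendsto (fun t : ℝ => t ^ 1 * Real.exp (-t)) atTop (𝓝 0) :=
      Real.tendsto_pow_mul_exp_neg_atTop_nhds_zero 1
    have h2 := h1.const_mul (|q.re| + 2)
    rw [mul_zero] at h2
    filter_upwards [h2.eventually (gt_mem_nhds hη), eventually_ge_atTop 0] with t ht ht0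
    have h3 : (|q.re| + 2) * t ≤ η * Real.exp t := by
      rw [pow_one, ← mul_assoc, Real.exp_neg, ← div_eq_mul_inv, div_lt_iff₀ (Real.exp_pos t)] at ht
      exact ht.le
    have h4 : Real.exp t ≤ Real.exp (2 * t) := Real.exp_le_exp.2 (by linarith)
    calc (q.re + 2) * t ≤ (|q.re| + 2) * t := by gcongr; exact le_abs_self _
      _ ≤ η * Real.exp t := h3
      _ ≤ η * Real.exp (2 * t) := by gcongr
  obtain ⟨L, hL⟩ := eventually_atTop.1 hlim
  refine IsBigO.of_bound (‖K‖ * Real.exp (|q.im| * (|θ₁ + δ| + |θ₂ - δ|)))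
    (eventually_strip.2 ⟨L, fun ζ h0 h1 h2 => ?_⟩)
  rw [norm_powExp, mul_assoc, Real.norm_of_nonneg (Real.exp_pos _).le, ← Real.exp_add]
  refine mul_le_mul_of_nonneg_left (Real.exp_le_exp.2 ?_) (norm_nonneg K)
  have : |ζ.im| ≤ |θ₁ + δ| + |θ₂ - δ| := by
    rw [abs_le]
    constructor
    · linarith [neg_abs_le (θ₁ + δ), abs_nonneg (θ₂ - δ)]
    · linarith [le_abs_self (θ₂ - δ), abs_nonneg (θ₁ + δ)]
  have h3 : -(q.im * ζ.im) ≤ |q.im| * (|θ₁ + δ| + |θ₂ - δ|) :=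
    (neg_le_abs _).trans (by rw [abs_mul]; gcongr)
  have h4 := hL _ h0
  have h5 := h ζ h1 h2
  linarith

namespace IsAsymp

variable {F G : ℂ → ℂ} {K q s K' q' s' : ℂ}

theorem congr (hF : IsAsymp θ₁ θ₂ F K q s) (h : ∀ᶠ ζ in sector θ₁ θ₂, G ζ = F ζ) :
    IsAsymp θ₁ θ₂ G K q s := by
  obtain ⟨g, hg, h1⟩ := hF
  exact ⟨g, hg, by filter_upwards [h, h1] with ζ a b using a.trans b⟩

theorem mono {θ₁' θ₂' : ℝ} (hF : IsAsymp θ₁ θ₂ F K q s) (h₁ : θ₁ ≤ θ₁') (h₂ : θ₂' ≤ θ₂) :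
    IsAsymp θ₁' θ₂' F K q s := by
  obtain ⟨g, hg, h⟩ := hF
  exact ⟨g, hg.mono h₁ h₂, sector_mono h₁ h₂ h⟩

theorem of_powExp (K q s : ℂ) : IsAsymp θ₁ θ₂ (powExp K q s) K q s :=
  ⟨_, Small.zero, Eventually.of_forall fun ζ => by simp⟩

theorem analyticAt (hF : IsAsymp θ₁ θ₂ F K q s) : ∀ᶠ ζ in sector θ₁ θ₂, AnalyticAt ℂ F ζ := by
  obtain ⟨g, hg, h⟩ := hF
  filter_upwards [hg.1, eventually_sector_nhds h] with ζ h1 h2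
  exact ((analyticAt_powExp K q s ζ).mul (analyticAt_const.add h1)).congr
    (h2.mono fun _ h => h.symm)

theorem ne_zero (hF : IsAsymp θ₁ θ₂ F K q s) (hK : K ≠ 0) : ∀ᶠ ζ in sector θ₁ θ₂, F ζ ≠ 0 := by
  obtain ⟨g, hg, h⟩ := hF
  filter_upwards [h, hg.one_add_ne_zero] with ζ h1 h2
  rw [h1]
  exact mul_ne_zero (powExp_ne_zero hK _ _ _) h2

theorem mul (hF : IsAsymp θ₁ θ₂ F K q s) (hG : IsAsymp θ₁ θ₂ G K' q' s') :
    IsAsymp θ₁ θ₂ (fun ζ => F ζ * G ζ) (K * K') (q + q') (s + s') := by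
  obtain ⟨f, hf, h1⟩ := hF
  obtain ⟨g, hg, h2⟩ := hG
  obtain ⟨k, hk, h3⟩ := hf.one_add_mul hg
  refine ⟨k, hk, ?_⟩
  filter_upwards [h1, h2] with ζ a b
  rw [a, b, ← powExp_mul, ← h3]
  ring

theorem inv (hF : IsAsymp θ₁ θ₂ F K q s) :
    IsAsymp θ₁ θ₂ (fun ζ => (F ζ)⁻¹) K⁻¹ (-q) (-s) := by
  obtain ⟨f, hf, h1⟩ := hF
  obtain ⟨k, hk, h3⟩ := hf.one_add_inv
  refine ⟨k, hk, ?_⟩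
  filter_upwards [h1, h3] with ζ a b
  rw [a, mul_inv, powExp_inv, b]

theorem div (hF : IsAsymp θ₁ θ₂ F K q s) (hG : IsAsymp θ₁ θ₂ G K' q' s') :
    IsAsymp θ₁ θ₂ (fun ζ => F ζ / G ζ) (K / K') (q - q') (s - s') := by
  simpa only [div_eq_mul_inv, sub_eq_add_neg] using hF.mul hG.inv

theorem const_mul (hF : IsAsymp θ₁ θ₂ F K q s) (c : ℂ) :
    IsAsymp θ₁ θ₂ (fun ζ => c * F ζ) (c * K) q s := by
  obtain ⟨f, hf, h1⟩ := hF
  refine ⟨f, hf, ?_⟩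
  filter_upwards [h1] with ζ a
  rw [a, powExp, powExp]
  ring

/-- A summand of smaller order does not change the leading term. -/
theorem add_of_small (hF : IsAsymp θ₁ θ₂ F K q s) (hG : IsAsymp θ₁ θ₂ G K' q' s') (hK : K ≠ 0)
    (h : Small θ₁ θ₂ (powExp (K' / K) (q' - q) (s' - s))) :
    IsAsymp θ₁ θ₂ (fun ζ => F ζ + G ζ) K q s := by
  obtain ⟨f, hf, h1⟩ := hF
  obtain ⟨g, hg, h2⟩ := hG
  refine ⟨_, hf.add (h.add (h.mul hg)), ?_⟩
  filter_upwards [h1, h2] with ζ a b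
  have : powExp K' q' s' ζ = powExp K q s ζ * powExp (K' / K) (q' - q) (s' - s) ζ := by
    rw [powExp_mul, mul_div_cancel₀ _ hK]
    congr 1 <;> ring
  rw [a, b, this]
  ring

/-- The sum of two functions of the same order whose leading terms do not cancel. -/
theorem add (hF : IsAsymp θ₁ θ₂ F K q s) (hG : IsAsymp θ₁ θ₂ G K' q s) (h : K + K' ≠ 0) :
    IsAsymp θ₁ θ₂ (fun ζ => F ζ + G ζ) (K + K') q s := by
  obtain ⟨f, hf, h1⟩ := hF
  obtain ⟨g, hg, h2⟩ := hG
  refine ⟨_, (hf.const_mul (K / (K + K'))).add (hg.const_mul (K' / (K + K'))), ?_⟩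
  filter_upwards [h1, h2] with ζ a b
  rw [a, b, powExp, powExp, powExp]
  field_simp
  ring

/-- The logarithmic derivative of `K x^q exp (s x²) (1 + O(x⁻²))` with respect to `ζ = log x`. -/
theorem logDeriv_eq (hF : IsAsymp θ₁ θ₂ F K q s) (hK : K ≠ 0) :
    ∃ g, Small θ₁ θ₂ g ∧ ∀ᶠ ζ in sector θ₁ θ₂,
      logDeriv F ζ = q + 2 * s * Complex.exp (2 * ζ) + g ζ := by
  obtain ⟨f, hf, h⟩ := hF
  obtain ⟨k, hk, h3⟩ := hf.one_add_inv
  refine ⟨_, hf.deriv.add (hf.deriv.mul hk), ?_⟩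
  filter_upwards [eventually_sector_nhds h, hf.1, hf.one_add_ne_zero, h3] with ζ h1 h2 h4 h5
  have e1 : logDeriv F ζ = logDeriv (fun z => powExp K q s z * (1 + f z)) ζ :=
    (logDeriv_congr_nhds h1).eq_of_nhds
  rw [e1, logDeriv_mul ζ (powExp_ne_zero hK _ _ _) h4
    (hasDerivAt_powExp K q s ζ).differentiableAt (h2.differentiableAt.const_add 1),
    logDeriv_apply, logDeriv_apply, (hasDerivAt_powExp K q s ζ).deriv,
    mul_div_cancel_left₀ _ (powExp_ne_zero hK _ _ _), deriv_const_add, div_eq_mul_inv, h5]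
  ring

/-- If the logarithmic derivative of `F` has the leading term `2 s x² ≠ 0`. -/
theorem logDeriv_of_exp (hF : IsAsymp θ₁ θ₂ F K q s) (hK : K ≠ 0) (hs : s ≠ 0) :
    IsAsymp θ₁ θ₂ (logDeriv F) (2 * s) 2 0 := by
  obtain ⟨g, hg, h⟩ := hF.logDeriv_eq hK
  have h2 : Small θ₁ θ₂ (powExp (2 * s)⁻¹ (-2) 0) := small_powExp_zero _ (by simp)
  refine ⟨_, (h2.const_mul q).add (h2.mul hg), ?_⟩
  filter_upwards [h] with ζ hζ
  have e : powExp (2 * s) 2 0 ζ * powExp (2 * s)⁻¹ (-2) 0 ζ = 1 := by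
    rw [powExp_mul, mul_inv_cancel₀ (by simpa using hs)]
    simp [powExp]
  have e' : powExp (2 * s) 2 0 ζ = 2 * s * Complex.exp (2 * ζ) := by simp [powExp]
  rw [hζ, ← e']
  linear_combination -(q + g ζ) * e

/-- If the logarithmic derivative of `F` has the constant leading term `q ≠ 0`. -/
theorem logDeriv_of_pow (hF : IsAsymp θ₁ θ₂ F K q 0) (hK : K ≠ 0) (hq : q ≠ 0) :
    IsAsymp θ₁ θ₂ (logDeriv F) q 0 0 := by
  obtain ⟨g, hg, h⟩ := hF.logDeriv_eq hK
  refine ⟨_, hg.const_mul q⁻¹, ?_⟩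
  filter_upwards [h] with ζ hζ
  rw [hζ]
  simp only [powExp]
  field_simp
  simp

/-- Multiplication by `x⁻¹`. -/
theorem exp_neg_mul (hF : IsAsymp θ₁ θ₂ F K q s) :
    IsAsymp θ₁ θ₂ (fun ζ => Complex.exp (-ζ) * F ζ) K (q - 1) s := by
  have := (of_powExp (θ₁ := θ₁) (θ₂ := θ₂) 1 (-1) 0).mul hF
  rw [one_mul, zero_add, show (-1 : ℂ) + q = q - 1 by ring] at this
  exact this.congr (Eventually.of_forall fun ζ => by simp [powExp])

end IsAsymp

/-! ### The chain of solutions and its asymptotics -/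

/-- The chain `g₀ = 0`, `g₁ = w'/w`, `g_{k+2} = g_k + g_{k+1}'/g_{k+1}`, that is, the solution of
the Volterra lattice `g_k' = g_k (g_{k+1} - g_{k-1})` generated by `w`. -/
noncomputable def chain (w : ℂ → ℂ) : ℕ → ℂ → ℂ
  | 0 => fun _ => 0
  | 1 => logDeriv w
  | k + 2 => fun x => chain w k x + logDeriv (chain w (k + 1)) x

theorem analyticAt_of_comp_exp {f : ℂ → ℂ} {ζ : ℂ}
    (h : AnalyticAt ℂ (fun z => f (Complex.exp z)) ζ) : AnalyticAt ℂ f (Complex.exp ζ) :=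
  (analyticAt_comp_iff_of_deriv_ne_zero (Complex.differentiable_exp.analyticAt ζ)
    (by simp [Complex.exp_ne_zero])).1 h

theorem logDeriv_exp_eq {f : ℂ → ℂ} {ζ : ℂ}
    (h : AnalyticAt ℂ (fun z => f (Complex.exp z)) ζ) :
    logDeriv f (Complex.exp ζ) =
      Complex.exp (-ζ) * logDeriv (fun z => f (Complex.exp z)) ζ := by
  have := logDeriv_comp (analyticAt_of_comp_exp h).differentiableAt
    (Complex.differentiable_exp ζ)
  rw [show (fun z => f (Complex.exp z)) = f ∘ Complex.exp from rfl, this, Complex.deriv_exp,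
    mul_comm, mul_assoc, ← Complex.exp_add, add_neg_cancel, Complex.exp_zero, mul_one]

theorem eventually_chain_one {w : ℂ → ℂ} {K q s : ℂ}
    (hw : IsAsymp θ₁ θ₂ (fun ζ => w (Complex.exp ζ)) K q s) :
    ∀ᶠ ζ in sector θ₁ θ₂, chain w 1 (Complex.exp ζ) =
      Complex.exp (-ζ) * logDeriv (fun z => w (Complex.exp z)) ζ :=
  hw.analyticAt.mono fun _ h => logDeriv_exp_eq h

theorem eventually_chain_add_two {w : ℂ → ℂ} {k : ℕ} {K q s : ℂ}
    (hw : IsAsymp θ₁ θ₂ (fun ζ => chain w (k + 1) (Complex.exp ζ)) K q s) :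
    ∀ᶠ ζ in sector θ₁ θ₂, chain w (k + 2) (Complex.exp ζ) = chain w k (Complex.exp ζ) +
      Complex.exp (-ζ) * logDeriv (fun z => chain w (k + 1) (Complex.exp z)) ζ :=
  hw.analyticAt.mono fun ζ h => by rw [← logDeriv_exp_eq h]; rfl

theorem IsAsymp.exp_neg_mul_logDeriv {F : ℂ → ℂ} {K q : ℂ} (hF : IsAsymp θ₁ θ₂ F K q 0)
    (hK : K ≠ 0) (hq : q ≠ 0) :
    IsAsymp θ₁ θ₂ (fun ζ => Complex.exp (-ζ) * logDeriv F ζ) q (-1) 0 := by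
  simpa using (hF.logDeriv_of_pow hK hq).exp_neg_mul

theorem IsAsymp.chain_two {w : ℂ → ℂ} {K q : ℂ}
    (hw : IsAsymp θ₁ θ₂ (fun ζ => chain w 1 (Complex.exp ζ)) K q 0) (hK : K ≠ 0) (hq : q ≠ 0) :
    IsAsymp θ₁ θ₂ (fun ζ => chain w 2 (Complex.exp ζ)) q (-1) 0 := by
  refine (hw.exp_neg_mul_logDeriv hK hq).congr ?_
  filter_upwards [eventually_chain_add_two (k := 0) hw] with ζ h
  rw [h]
  simp [chain]

/-- If `w` behaves like `x^{-a}`, all members of the chain are of order `x⁻¹`: each step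
contributes the logarithmic derivative `-1/x` of `x⁻¹`. -/
theorem chain_leading_of_pow {w : ℂ → ℂ} {K a : ℂ}
    (hw : IsAsymp θ₁ θ₂ (fun ζ => w (Complex.exp ζ)) K (-a) 0) (hK : K ≠ 0)
    (ha : ∀ m : ℕ, a + m ≠ 0) (j : ℕ) :
    IsAsymp θ₁ θ₂ (fun ζ => chain w (2 * j + 1) (Complex.exp ζ)) (-(a + j)) (-1) 0 ∧
      IsAsymp θ₁ θ₂ (fun ζ => chain w (2 * j + 2) (Complex.exp ζ)) (-((j : ℂ) + 1)) (-1) 0 := by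
  have hj : ∀ j : ℕ, -((j : ℂ) + 1) ≠ 0 := fun j => neg_ne_zero.2 (Nat.cast_add_one_ne_zero j)
  induction j with
  | zero =>
    have ha0 : -a ≠ 0 := by simpa using ha 0
    have h1 : IsAsymp θ₁ θ₂ (fun ζ => chain w 1 (Complex.exp ζ)) (-a) (-1) 0 :=
      (hw.exp_neg_mul_logDeriv hK ha0).congr (eventually_chain_one hw)
    simpa using And.intro h1 (h1.chain_two ha0 (by simp))
  | succ j ih =>
    obtain ⟨h1, h2⟩ := ih
    have h3 : IsAsymp θ₁ θ₂ (fun ζ => chain w (2 * j + 3) (Complex.exp ζ))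
        (-(a + (j + 1 : ℕ))) (-1) 0 := by
      have e : -(a + (j + 1 : ℕ)) = -(a + j) + -1 := by push_cast; ring
      rw [e]
      refine (h1.add (h2.exp_neg_mul_logDeriv (hj j) (by simp)) ?_).congr
        (eventually_chain_add_two h2)
      rw [← e]
      exact neg_ne_zero.2 (ha _)
    refine ⟨h3, ?_⟩
    have e : -(((j + 1 : ℕ) : ℂ) + 1) = -((j : ℂ) + 1) + -1 := by push_cast; ring
    rw [e]
    refine (h2.add (h3.exp_neg_mul_logDeriv (neg_ne_zero.2 (ha _)) (by simp)) ?_).congr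
      (eventually_chain_add_two h3)
    rw [← e]
    exact hj _

/-- If `w` behaves like `x^q exp (-x²)`, the members of the chain are alternately close to `-2x`
and of order `x⁻¹`. -/
theorem chain_leading_of_exp {w : ℂ → ℂ} {K q : ℂ}
    (hw : IsAsymp θ₁ θ₂ (fun ζ => w (Complex.exp ζ)) K q (-1)) (hK : K ≠ 0) (j : ℕ) :
    IsAsymp θ₁ θ₂ (fun ζ => chain w (2 * j + 1) (Complex.exp ζ)) (-2) 1 0 ∧
      IsAsymp θ₁ θ₂ (fun ζ => chain w (2 * j + 2) (Complex.exp ζ)) ((j : ℂ) + 1) (-1) 0 := by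
  have hj : ∀ j : ℕ, (j : ℂ) + 1 ≠ 0 := fun j => Nat.cast_add_one_ne_zero j
  induction j with
  | zero =>
    have h1 : IsAsymp θ₁ θ₂ (fun ζ => chain w 1 (Complex.exp ζ)) (-2) 1 0 := by
      refine IsAsymp.congr ?_ (eventually_chain_one hw)
      have := (hw.logDeriv_of_exp hK (by simp)).exp_neg_mul
      norm_num at this
      exact this
    simpa using And.intro h1 (h1.chain_two (by simp) (by simp))
  | succ j ih =>
    obtain ⟨h1, h2⟩ := ih
    have h3 : IsAsymp θ₁ θ₂ (fun ζ => chain w (2 * j + 3) (Complex.exp ζ)) (-2) 1 0 :=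
      (h1.add_of_small (h2.exp_neg_mul_logDeriv (hj j) (by simp)) (by simp)
        (by rw [sub_zero]; exact small_powExp_zero _ (by norm_num))).congr
        (eventually_chain_add_two h2)
    refine ⟨h3, ?_⟩
    have e : ((j + 1 : ℕ) : ℂ) + 1 = (j : ℂ) + 1 + 1 := by push_cast; ring
    rw [e]
    refine (h2.add (h3.exp_neg_mul_logDeriv (by simp) (by simp)) ?_).congr
      (eventually_chain_add_two h3)
    rw [← e]
    exact hj _

/-- The exponentially small difference `D` of two functions with the leading term `A x^e` gives the
difference `(D/G)' (1 + O(x⁻²))` of their logarithmic derivatives, and `d/dx` acts on the leading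
term of `D/G` as multiplication by `2 s x`. -/
theorem IsAsymp.exp_neg_mul_logDeriv_sub {F G : ℂ → ℂ} {A e κ p s : ℂ}
    (hF : IsAsymp θ₁ θ₂ F A e 0) (hG : IsAsymp θ₁ θ₂ G A e 0)
    (hD : IsAsymp θ₁ θ₂ (fun ζ => F ζ - G ζ) κ p s) (hA : A ≠ 0) (hκ : κ ≠ 0) (hs : s ≠ 0)
    (hneg : ∀ K q, Small θ₁ θ₂ (powExp K q s)) :
    IsAsymp θ₁ θ₂ (fun ζ => Complex.exp (-ζ) * logDeriv F ζ - Complex.exp (-ζ) * logDeriv G ζ)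
      (2 * s * κ / A) (p + 1 - e) s := by
  have hu := hD.div hG
  rw [sub_zero] at hu
  set u : ℂ → ℂ := fun ζ => (F ζ - G ζ) / G ζ with hu'
  have hus : Small θ₁ θ₂ u := by
    obtain ⟨g, hg, h⟩ := hu
    refine ((hneg (κ / A) (p - e)).add ((hneg (κ / A) (p - e)).mul hg)).congr ?_
    filter_upwards [h] with ζ h
    rw [h]
    ring
  obtain ⟨k, hk, hinv⟩ := hus.one_add_inv
  have hl := (hu.logDeriv_of_exp (div_ne_zero hκ hA) hs).mul hu
  have hfin := (hl.mul (K' := 1) (q' := 0) (s' := 0) (G := fun ζ => (1 + u ζ)⁻¹)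
    ⟨k, hk, by filter_upwards [hinv] with ζ h; rw [h]; simp [powExp]⟩).exp_neg_mul
  rw [show 2 * s * (κ / A) * 1 = 2 * s * κ / A by ring,
    show 2 + (p - e) + 0 - 1 = p + 1 - e by ring, zero_add, add_zero] at hfin
  refine hfin.congr ?_
  filter_upwards [eventually_sector_nhds (hG.ne_zero hA), hF.ne_zero hA, hF.analyticAt,
    hG.analyticAt, hu.analyticAt, hu.ne_zero (div_ne_zero hκ hA)] with ζ h1 h2 h3 h4 h5 h6
  have e1 := logDeriv_div ζ h2 h1.self_of_nhds h3.differentiableAt h4.differentiableAt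
  have e2 : logDeriv (fun z => F z / G z) ζ = logDeriv (fun z => 1 + u z) ζ := by
    refine (logDeriv_congr_nhds ?_).eq_of_nhds
    filter_upwards [h1] with z hz
    rw [hu']
    field_simp
    ring
  have e3 : logDeriv (fun z => 1 + u z) ζ = logDeriv u ζ * u ζ * (1 + u ζ)⁻¹ := by
    rw [logDeriv_apply, logDeriv_apply, deriv_const_add, div_mul_cancel₀ _ h6, div_eq_mul_inv]
  rw [← mul_sub, ← e1, e2, e3]

theorem IsAsymp.chain_sub_add_two {w v : ℂ → ℂ} {k : ℕ} {A e κ κ' p p' s : ℂ}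
    (hF : IsAsymp θ₁ θ₂ (fun ζ => chain w (k + 1) (Complex.exp ζ)) A e 0)
    (hG : IsAsymp θ₁ θ₂ (fun ζ => chain v (k + 1) (Complex.exp ζ)) A e 0)
    (hD : IsAsymp θ₁ θ₂
      (fun ζ => chain w (k + 1) (Complex.exp ζ) - chain v (k + 1) (Complex.exp ζ)) κ p s)
    (hD' : IsAsymp θ₁ θ₂
      (fun ζ => chain w k (Complex.exp ζ) - chain v k (Complex.exp ζ)) κ' p' s)
    (hA : A ≠ 0) (hκ : κ ≠ 0) (hs : s ≠ 0) (hneg : ∀ K q, Small θ₁ θ₂ (powExp K q s))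
    (hp : (p' - (p + 1 - e)).re ≤ -2) :
    IsAsymp θ₁ θ₂
      (fun ζ => chain w (k + 2) (Complex.exp ζ) - chain v (k + 2) (Complex.exp ζ))
      (2 * s * κ / A) (p + 1 - e) s := by
  refine ((hF.exp_neg_mul_logDeriv_sub hG hD hA hκ hs hneg).add_of_small hD'
    (div_ne_zero (mul_ne_zero (mul_ne_zero two_ne_zero hs) hκ) hA)
    (by rw [sub_self]; exact small_powExp_zero _ hp)).congr ?_
  filter_upwards [eventually_chain_add_two hF, eventually_chain_add_two hG] with ζ h1 h2
  rw [h1, h2]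
  ring

theorem isAsymp_chain_zero_sub (w v : ℂ → ℂ) (p s : ℂ) : IsAsymp θ₁ θ₂
    (fun ζ => chain w 0 (Complex.exp ζ) - chain v 0 (Complex.exp ζ)) 0 p s :=
  ⟨_, Small.zero, Eventually.of_forall fun ζ => by simp [chain, powExp]⟩

/-- Differences along two chains generated by functions that behave like `x^{-a}`. -/
theorem chain_sub_of_pow {w v : ℂ → ℂ} {K K' a κ : ℂ}
    (hw : IsAsymp θ₁ θ₂ (fun ζ => w (Complex.exp ζ)) K (-a) 0) (hK : K ≠ 0)
    (hv : IsAsymp θ₁ θ₂ (fun ζ => v (Complex.exp ζ)) K' (-a) 0) (hK' : K' ≠ 0)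
    (ha : ∀ m : ℕ, a + m ≠ 0)
    (hD : IsAsymp θ₁ θ₂
      (fun ζ => chain w 1 (Complex.exp ζ) - chain v 1 (Complex.exp ζ)) κ (2 * a) (-1))
    (hκ : κ ≠ 0) (hneg : ∀ K q, Small θ₁ θ₂ (powExp K q (-1))) (j : ℕ) :
    IsAsymp θ₁ θ₂
      (fun ζ => chain w (2 * j + 1) (Complex.exp ζ) - chain v (2 * j + 1) (Complex.exp ζ))
      (κ * (4 ^ j * Complex.Gamma a / (Complex.Gamma (a + j) * (j.factorial : ℂ))))
      (2 * a + 4 * j) (-1) ∧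
    IsAsymp θ₁ θ₂
      (fun ζ => chain w (2 * j + 2) (Complex.exp ζ) - chain v (2 * j + 2) (Complex.exp ζ))
      (κ * (2 * 4 ^ j * Complex.Gamma a / (Complex.Gamma (a + (j + 1)) * (j.factorial : ℂ))))
      (2 * a + 4 * j + 2) (-1) := by
  have hG : ∀ j : ℕ, Complex.Gamma (a + j) ≠ 0 := fun j =>
    Complex.Gamma_ne_zero fun m h => ha (j + m) (by push_cast; linear_combination h)
  have hG0 : Complex.Gamma a ≠ 0 := by simpa using hG 0
  have hfac : ∀ j : ℕ, (j.factorial : ℂ) ≠ 0 := fun j => by exact_mod_cast j.factorial_ne_zero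
  have hGs : ∀ j : ℕ, Complex.Gamma (a + (j + 1)) = (a + j) * Complex.Gamma (a + j) := fun j => by
    rw [← add_assoc, Complex.Gamma_add_one _ (ha j)]
  have hw' := chain_leading_of_pow hw hK ha
  have hv' := chain_leading_of_pow hv hK' ha
  have hκ1 : ∀ j : ℕ,
      κ * (4 ^ j * Complex.Gamma a / (Complex.Gamma (a + j) * (j.factorial : ℂ))) ≠ 0 := fun j =>
    mul_ne_zero hκ (div_ne_zero (mul_ne_zero (by simp) hG0) (mul_ne_zero (hG j) (hfac j)))
  have step : ∀ {j : ℕ} {κ' : ℂ}, IsAsymp θ₁ θ₂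
      (fun ζ => chain w (2 * j + 1) (Complex.exp ζ) - chain v (2 * j + 1) (Complex.exp ζ))
      (κ * (4 ^ j * Complex.Gamma a / (Complex.Gamma (a + j) * (j.factorial : ℂ))))
      (2 * a + 4 * j) (-1) →
      IsAsymp θ₁ θ₂
      (fun ζ => chain w (2 * j) (Complex.exp ζ) - chain v (2 * j) (Complex.exp ζ)) κ'
      (2 * a + 4 * j - 2) (-1) →
      IsAsymp θ₁ θ₂
      (fun ζ => chain w (2 * j + 2) (Complex.exp ζ) - chain v (2 * j + 2) (Complex.exp ζ))
      (κ * (2 * 4 ^ j * Complex.Gamma a / (Complex.Gamma (a + (j + 1)) * (j.factorial : ℂ))))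
      (2 * a + 4 * j + 2) (-1) := by
    intro j κ' h1 h0
    have := (hw' j).1.chain_sub_add_two (hv' j).1 h1 h0 (neg_ne_zero.2 (ha j)) (hκ1 j)
      (by simp) hneg (by
        rw [show 2 * a + 4 * (j : ℂ) - 2 - (2 * a + 4 * j + 1 - -1) = -4 by ring]; norm_num)
    rw [show 2 * a + 4 * (j : ℂ) + 1 - -1 = 2 * a + 4 * j + 2 by ring] at this
    convert this using 1
    rw [hGs]
    have := ha j
    have := hG j
    have := hfac j
    field_simp
  induction j with
  | zero =>
    have h1 : IsAsymp θ₁ θ₂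
        (fun ζ => chain w (2 * 0 + 1) (Complex.exp ζ) - chain v (2 * 0 + 1) (Complex.exp ζ))
        (κ * (4 ^ 0 * Complex.Gamma a / (Complex.Gamma (a + (0 : ℕ)) * (Nat.factorial 0 : ℂ))))
        (2 * a + 4 * (0 : ℕ)) (-1) := by
      simpa [hG0] using hD
    exact ⟨h1, step h1 (isAsymp_chain_zero_sub w v _ _)⟩
  | succ j ih =>
    obtain ⟨h1, h2⟩ := ih
    have h3 := (hw' j).2.chain_sub_add_two (hv' j).2 h2 h1
      (neg_ne_zero.2 (Nat.cast_add_one_ne_zero j)) (mul_ne_zero hκ (div_ne_zero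
        (mul_ne_zero (by simp) hG0) (mul_ne_zero (by exact_mod_cast hG (j + 1)) (hfac j))))
      (by simp) hneg (by
        rw [show 2 * a + 4 * (j : ℂ) - (2 * a + 4 * j + 2 + 1 - -1) = -4 by ring]; norm_num)
    have h4 : IsAsymp θ₁ θ₂
        (fun ζ => chain w (2 * (j + 1) + 1) (Complex.exp ζ) -
          chain v (2 * (j + 1) + 1) (Complex.exp ζ))
        (κ * (4 ^ (j + 1) * Complex.Gamma a /
          (Complex.Gamma (a + (j + 1 : ℕ)) * ((j + 1).factorial : ℂ))))
        (2 * a + 4 * (j + 1 : ℕ)) (-1) := by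
      rw [show 2 * a + 4 * (j : ℂ) + 2 + 1 - -1 = 2 * a + 4 * (j + 1 : ℕ) by push_cast; ring] at h3
      convert h3 using 1
      · rfl
      have e1 := hG (j + 1)
      push_cast at e1 ⊢
      rw [Nat.factorial_succ]
      have e2 := hfac j
      have e3 : (j : ℂ) + 1 ≠ 0 := Nat.cast_add_one_ne_zero j
      push_cast
      field_simp
      ring
    rw [show 2 * a + 4 * j + 2 = 2 * a + 4 * ((j + 1 : ℕ) : ℂ) - 2 by push_cast; ring] at h2
    exact ⟨h4, step h4 h2⟩

/-- Differences along two chains generated by functions that behave like `x^q exp (-x²)`. -/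
theorem chain_sub_of_exp {w v : ℂ → ℂ} {K K' q p κ : ℂ}
    (hw : IsAsymp θ₁ θ₂ (fun ζ => w (Complex.exp ζ)) K q (-1)) (hK : K ≠ 0)
    (hv : IsAsymp θ₁ θ₂ (fun ζ => v (Complex.exp ζ)) K' q (-1)) (hK' : K' ≠ 0)
    (hD : IsAsymp θ₁ θ₂
      (fun ζ => chain w 1 (Complex.exp ζ) - chain v 1 (Complex.exp ζ)) κ p 1)
    (hκ : κ ≠ 0) (hneg : ∀ K q, Small θ₁ θ₂ (powExp K q 1)) (j : ℕ) :
    IsAsymp θ₁ θ₂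
      (fun ζ => chain w (2 * j + 1) (Complex.exp ζ) - chain v (2 * j + 1) (Complex.exp ζ))
      (κ * ((-2) ^ j / (j.factorial : ℂ))) (p + 2 * j) 1 ∧
    IsAsymp θ₁ θ₂
      (fun ζ => chain w (2 * j + 2) (Complex.exp ζ) - chain v (2 * j + 2) (Complex.exp ζ))
      (-(κ * ((-2) ^ j / (j.factorial : ℂ)))) (p + 2 * j) 1 := by
  have hfac : ∀ j : ℕ, (j.factorial : ℂ) ≠ 0 := fun j => by exact_mod_cast j.factorial_ne_zero
  have hw' := chain_leading_of_exp hw hK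
  have hv' := chain_leading_of_exp hv hK'
  have hκ1 : ∀ j : ℕ, κ * ((-2) ^ j / (j.factorial : ℂ)) ≠ 0 := fun j =>
    mul_ne_zero hκ (div_ne_zero (by simp) (hfac j))
  have step : ∀ {j : ℕ} {κ' : ℂ}, IsAsymp θ₁ θ₂
      (fun ζ => chain w (2 * j + 1) (Complex.exp ζ) - chain v (2 * j + 1) (Complex.exp ζ))
      (κ * ((-2) ^ j / (j.factorial : ℂ))) (p + 2 * j) 1 →
      IsAsymp θ₁ θ₂
      (fun ζ => chain w (2 * j) (Complex.exp ζ) - chain v (2 * j) (Complex.exp ζ)) κ'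
      (p + 2 * j - 2) 1 →
      IsAsymp θ₁ θ₂
      (fun ζ => chain w (2 * j + 2) (Complex.exp ζ) - chain v (2 * j + 2) (Complex.exp ζ))
      (-(κ * ((-2) ^ j / (j.factorial : ℂ)))) (p + 2 * j) 1 := by
    intro j κ' h1 h0
    have := (hw' j).1.chain_sub_add_two (hv' j).1 h1 h0 (by simp) (hκ1 j)
      (by simp) hneg (by
        rw [show p + 2 * (j : ℂ) - 2 - (p + 2 * j + 1 - 1) = -2 by ring]; norm_num)
    rw [show p + 2 * (j : ℂ) + 1 - 1 = p + 2 * j by ring] at this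
    convert this using 1
    ring
  induction j with
  | zero =>
    have h1 : IsAsymp θ₁ θ₂
        (fun ζ => chain w (2 * 0 + 1) (Complex.exp ζ) - chain v (2 * 0 + 1) (Complex.exp ζ))
        (κ * ((-2) ^ 0 / (Nat.factorial 0 : ℂ))) (p + 2 * (0 : ℕ)) 1 := by
      simpa using hD
    exact ⟨h1, step h1 (isAsymp_chain_zero_sub w v _ _)⟩
  | succ j ih =>
    obtain ⟨h1, h2⟩ := ih
    have h3 := (hw' j).2.chain_sub_add_two (hv' j).2 h2 h1
      (Nat.cast_add_one_ne_zero j) (neg_ne_zero.2 (hκ1 j))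
      (by simp) hneg (by
        rw [show p + 2 * (j : ℂ) - (p + 2 * j + 1 - -1) = -2 by ring]; norm_num)
    have h4 : IsAsymp θ₁ θ₂
        (fun ζ => chain w (2 * (j + 1) + 1) (Complex.exp ζ) -
          chain v (2 * (j + 1) + 1) (Complex.exp ζ))
        (κ * ((-2) ^ (j + 1) / ((j + 1).factorial : ℂ))) (p + 2 * (j + 1 : ℕ)) 1 := by
      rw [show p + 2 * (j : ℂ) + 1 - -1 = p + 2 * (j + 1 : ℕ) by push_cast; ring] at h3
      convert h3 using 1
      · rfl
      rw [Nat.factorial_succ]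
      have e2 := hfac j
      have e3 : (j : ℂ) + 1 ≠ 0 := Nat.cast_add_one_ne_zero j
      push_cast
      field_simp
      ring
    rw [show p + 2 * j = p + 2 * ((j + 1 : ℕ) : ℂ) - 2 by push_cast; ring] at h2
    exact ⟨h4, step h4 h2⟩

/-- Two solutions of the linear equation whose Wronskian is `-M exp (-x²)`. -/
theorem chain_one_sub {w v : ℂ → ℂ} {K K' q s M : ℂ}
    (hw : IsAsymp θ₁ θ₂ (fun ζ => w (Complex.exp ζ)) K q s) (hK : K ≠ 0)
    (hv : IsAsymp θ₁ θ₂ (fun ζ => v (Complex.exp ζ)) K' q s) (hK' : K' ≠ 0)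
    (hM : ∀ x, deriv w x * v x - w x * deriv v x = M * Complex.exp (-x ^ 2)) :
    IsAsymp θ₁ θ₂ (fun ζ => chain w 1 (Complex.exp ζ) - chain v 1 (Complex.exp ζ))
      (M / (K * K')) (-(q + q)) (-1 - (s + s)) := by
  have h := (IsAsymp.of_powExp (θ₁ := θ₁) (θ₂ := θ₂) M 0 (-1)).div (hw.mul hv)
  rw [zero_sub] at h
  refine h.congr ?_
  filter_upwards [hw.ne_zero hK, hv.ne_zero hK'] with ζ h1 h2
  have e : powExp M 0 (-1) ζ = M * Complex.exp (-Complex.exp ζ ^ 2) := by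
    rw [powExp, ← Complex.exp_nat_mul]
    simp
  rw [e, ← hM]
  simp only [chain, logDeriv_apply]
  field_simp

/-! ### Meromorphy, the differential equation and the Bäcklund transformation -/

theorem eventually_codiscrete_nhds {P : ℂ → Prop} (h : ∀ᶠ x in codiscrete ℂ, P x) :
    ∀ᶠ x in codiscrete ℂ, ∀ᶠ z in 𝓝 x, P z := by
  have ho : IsOpen {x | P x} := (mem_codiscrete'.1 h).1
  exact h.mono fun x hx => ho.mem_nhds hx

theorem eventually_codiscrete_analyticAt {f : ℂ → ℂ} (hf : Meromorphic f) :
    ∀ᶠ x in codiscrete ℂ, AnalyticAt ℂ f x :=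
  (meromorphicOn_univ.2 hf).analyticAt_mem_codiscreteWithin

/-- A meromorphic function with a nonzero leading term in some sector does not vanish
identically. -/
theorem eventually_codiscrete_ne_zero {f : ℂ → ℂ} (hf : Meromorphic f) {θ₁ θ₂ : ℝ} {K q s : ℂ}
    (h : IsAsymp θ₁ θ₂ (fun ζ => f (Complex.exp ζ)) K q s) (hK : K ≠ 0) (hθ : θ₁ < θ₂) :
    ∀ᶠ x in codiscrete ℂ, f x ≠ 0 := by
  have := sector_neBot hθ
  obtain ⟨ζ, h1, h2⟩ := (h.analyticAt.and (h.ne_zero hK)).exists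
  have h3 := (analyticAt_of_comp_exp h1).continuousAt.eventually_ne h2
  have h4 : meromorphicOrderAt f (Complex.exp ζ) ≠ ⊤ :=
    (meromorphicOrderAt_ne_top_iff_eventually_ne_zero (hf _)).2 (h3.filter_mono nhdsWithin_le_nhds)
  exact (meromorphicOn_univ.2 hf).eventually_codiscreteWithin_apply_ne_zero fun y hy =>
    (meromorphicOn_univ.2 hf).meromorphicOrderAt_ne_top_of_isPreconnected isPreconnected_univ
      (mem_univ _) hy h4

/-- The entire solutions of the Weber equation `w'' + 2 x w' + 2 a w = 0`. -/
structure IsWeber (a : ℂ) (w : ℂ → ℂ) : Prop where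
  differentiable : Differentiable ℂ w
  eq : ∀ x, deriv (deriv w) x + 2 * x * deriv w x + 2 * a * w x = 0

theorem IsWeber.meromorphic {a : ℂ} {w : ℂ → ℂ} (hw : IsWeber a w) : Meromorphic w :=
  fun x => (hw.differentiable.analyticAt x).meromorphicAt

theorem meromorphic_chain {w : ℂ → ℂ} (hw : Meromorphic w) (k : ℕ) : Meromorphic (chain w k) := by
  have key : ∀ k, Meromorphic (chain w k) ∧ Meromorphic (chain w (k + 1)) := by
    intro k
    induction k with
    | zero => exact ⟨Meromorphic.const 0, hw.logDeriv⟩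
    | succ k ih => exact ⟨ih.2, ih.1.add ih.2.logDeriv⟩
  exact (key k).1

/-- The parameters `β` along the chain: `-2j` at `2j` and `-2(a + j)` at `2j + 1`. -/
def chainParam (a : ℂ) : ℕ → ℂ
  | 0 => 0
  | 1 => -2 * a
  | k + 2 => chainParam a k - 2

theorem chainParam_add_two (a : ℂ) (k : ℕ) :
    chainParam a (k + 2) = chainParam a (k + 1) - 2 * ((-1) ^ k * (1 / 2 - a)) - 1 := by
  have key : ∀ k, chainParam a (k + 2) = chainParam a (k + 1) - 2 * ((-1) ^ k * (1 / 2 - a)) - 1 ∧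
      chainParam a (k + 3) = chainParam a (k + 2) - 2 * ((-1) ^ (k + 1) * (1 / 2 - a)) - 1 := by
    intro k
    induction k with
    | zero => constructor <;> simp only [chainParam] <;> ring
    | succ k ih =>
      refine ⟨ih.2, ?_⟩
      rw [chainParam, ih.1, show chainParam a (k + 1 + 2) = chainParam a (k + 1) - 2 from rfl]
      ring
  exact (key k).1

theorem chainParam_even (a : ℂ) (j : ℕ) : chainParam a (2 * j) = -2 * j := by
  induction j with
  | zero => simp [chainParam]
  | succ j ih =>
    rw [show 2 * (j + 1) = 2 * j + 2 by ring, chainParam, ih]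
    push_cast
    ring

section chain

variable {a : ℂ} {w : ℂ → ℂ}

theorem deriv_chain_succ {k : ℕ} (hne : ∀ᶠ x in codiscrete ℂ, chain w (k + 1) x ≠ 0) :
    ∀ᶠ x in codiscrete ℂ, deriv (chain w (k + 1)) x =
      chain w (k + 1) x * (chain w (k + 2) x - chain w k x) := by
  filter_upwards [hne] with x hx
  simp only [chain, logDeriv_apply, add_sub_cancel_left]
  field_simp

/-- Differentiation of `g_{k+1} (g_{k+2} + g_{k+1} + g_k + 2x) = b` along the lattice. -/
theorem chain_integral_step (hw : Meromorphic w)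
    (hne : ∀ k, ∀ᶠ x in codiscrete ℂ, chain w (k + 1) x ≠ 0) {k : ℕ} {b : ℂ}
    (h : ∀ᶠ x in codiscrete ℂ, chain w (k + 1) x *
      (chain w (k + 2) x + chain w (k + 1) x + chain w k x + 2 * x) = b) :
    ∀ᶠ x in codiscrete ℂ, chain w (k + 2) x *
      (chain w (k + 3) x + chain w (k + 2) x + chain w (k + 1) x + 2 * x) =
      chain w k x * (chain w k x + 2 * chain w (k + 1) x + 2 * x) - deriv (chain w k) x - 2 := by
  have han := fun k => eventually_codiscrete_analyticAt (meromorphic_chain hw k)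
  filter_upwards [eventually_codiscrete_nhds h, hne k, deriv_chain_succ (hne k),
    deriv_chain_succ (hne (k + 1)), han k, han (k + 1), han (k + 2)] with x h0 h1 d1 d2 a0 a1 a2
  have e0 := a0.differentiableAt.hasDerivAt
  have e1 := a1.differentiableAt.hasDerivAt
  have e2 := a2.differentiableAt.hasDerivAt
  have e3 := e1.mul (((e2.add e1).add e0).add ((hasDerivAt_id x).const_mul (2 : ℂ)))
  have e4 : HasDerivAt (fun z => chain w (k + 1) z *
      (chain w (k + 2) z + chain w (k + 1) z + chain w k z + 2 * z)) 0 x :=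
    (hasDerivAt_const x b).congr_of_eventuallyEq h0
  have e5 := e3.unique e4
  simp only [Pi.add_apply, id, mul_one] at e5
  rw [d1, d2, show k + 1 + 2 = k + 3 from rfl, show k + 1 + 1 = k + 2 from rfl] at e5
  apply mul_left_cancel₀ h1
  linear_combination e5

/-- The first integral of the chain of a Weber function; it is propagated two steps at a time,
since differentiating it at `k + 1` gives the value at `k + 2` in terms of the one at `k`. -/
theorem chain_integral (hw : IsWeber a w)
    (hne : ∀ k, ∀ᶠ x in codiscrete ℂ, chain w (k + 1) x ≠ 0) (k : ℕ) :
    ∀ᶠ x in codiscrete ℂ, chain w (k + 1) x *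
      (chain w (k + 2) x + chain w (k + 1) x + chain w k x + 2 * x) = chainParam a (k + 1) := by
  have hm := hw.meromorphic
  have key : ∀ k, (∀ᶠ x in codiscrete ℂ, chain w (k + 1) x *
      (chain w (k + 2) x + chain w (k + 1) x + chain w k x + 2 * x) = chainParam a (k + 1)) ∧
      ∀ᶠ x in codiscrete ℂ, chain w (k + 2) x *
      (chain w (k + 3) x + chain w (k + 2) x + chain w (k + 1) x + 2 * x) =
        chainParam a (k + 2) := by
    intro k
    induction k with
    | zero =>
      have h0 : ∀ᶠ x in codiscrete ℂ, chain w (0 + 1) x *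
          (chain w (0 + 2) x + chain w (0 + 1) x + chain w 0 x + 2 * x) =
            chainParam a (0 + 1) := by
        filter_upwards [hne 0] with x hx
        have hx0 : w x ≠ 0 := by
          intro h
          exact hx (by simp [chain, logDeriv_apply, h])
        have h1 : HasDerivAt (logDeriv w)
            ((deriv (deriv w) x * w x - deriv w x * deriv w x) / w x ^ 2) x :=
          HasDerivAt.div (hw.differentiable.deriv x).hasDerivAt
            (hw.differentiable x).hasDerivAt hx0
        have hx' : deriv w x / w x ≠ 0 := hx
        have hd : deriv w x ≠ 0 := fun h => hx' (by simp [h])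
        have := hw.eq x
        simp only [zero_add, chain, chainParam]
        rw [logDeriv_apply (logDeriv w), h1.deriv, logDeriv_apply]
        field_simp
        linear_combination w x * this
      refine ⟨h0, ?_⟩
      filter_upwards [chain_integral_step hm hne h0] with x hx
      have : deriv (chain w 0) x = 0 := by
        rw [show chain w 0 = fun _ => 0 from rfl, deriv_const]
      rw [zero_add] at hx ⊢
      rw [hx, this]
      simp [chain, chainParam]
    | succ k ih =>
      refine ⟨ih.2, ?_⟩
      filter_upwards [chain_integral_step hm hne ih.2, ih.1, deriv_chain_succ (hne k)]
        with x hx h1 h2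
      rw [show k + 1 + 2 = k + 3 from rfl] at hx ⊢
      rw [show k + 1 + 3 = k + 4 from rfl] at hx ⊢
      rw [show k + 1 + 1 = k + 2 from rfl] at hx ⊢
      rw [hx, h2, show chainParam a (k + 3) = chainParam a (k + 1) - 2 from rfl, ← h1]
      ring
  exact (key k).1

/-- The Hamiltonian system for the pair `(g_{k+1}, g_{k+2})`. -/
theorem chain_hamiltonian (hw : IsWeber a w)
    (hne : ∀ k, ∀ᶠ x in codiscrete ℂ, chain w (k + 1) x ≠ 0) (k : ℕ) :
    ∀ᶠ x in codiscrete ℂ,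
      deriv (chain w (k + 1)) x = chain w (k + 1) x *
        (chain w (k + 1) x + 2 * x + 2 * chain w (k + 2) x) - chainParam a (k + 1) ∧
      deriv (chain w (k + 2)) x = -chain w (k + 2) x *
        (chain w (k + 2) x + 2 * x + 2 * chain w (k + 1) x) + chainParam a (k + 2) := by
  filter_upwards [chain_integral hw hne k, chain_integral hw hne (k + 1),
    deriv_chain_succ (hne k), deriv_chain_succ (hne (k + 1))] with x h1 h2 d1 d2
  rw [show k + 1 + 2 = k + 3 from rfl, show k + 1 + 1 = k + 2 from rfl] at h2 d2
  rw [d1, d2]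
  constructor
  · linear_combination -h1
  · linear_combination h2

/-- The `k`-th member of the chain, in normal form. -/
noncomputable def chainNF (w : ℂ → ℂ) (k : ℕ) : ℂ → ℂ := toMeromorphicNFOn (chain w k) univ

theorem chainNF_eventuallyEq (hw : IsWeber a w) (k : ℕ) :
    ∀ᶠ x in codiscrete ℂ, chainNF w k =ᶠ[𝓝 x] chain w k := by
  have hm := hw.meromorphic
  have := toMeromorphicNFOn_eqOn_codiscrete (meromorphicOn_univ.2 (meromorphic_chain hm k))
  exact (eventually_codiscrete_nhds this).mono fun x hx => hx.mono fun z hz => hz.symm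

theorem chainNF_eq (hw : IsWeber a w) {k : ℕ} {x : ℂ} (h : AnalyticAt ℂ (chain w k) x) :
    chainNF w k x = chain w k x := by
  have hm := hw.meromorphic
  rw [chainNF, toMeromorphicNFOn_eq_toMeromorphicNFAt
    (meromorphicOn_univ.2 (meromorphic_chain hm k)) (mem_univ x),
    toMeromorphicNFAt_eq_self.2 h.meromorphicNFAt]

theorem isNonzeroMeromorphic_chainNF (hw : IsWeber a w) {k : ℕ}
    (hne : ∀ᶠ x in codiscrete ℂ, chain w k x ≠ 0) : IsNonzeroMeromorphic (chainNF w k) := by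
  refine ⟨meromorphicNFOn_toMeromorphicNFOn _ _, ?_⟩
  filter_upwards [hne, chainNF_eventuallyEq hw k] with x h1 h2
  rwa [h2.eq_of_nhds]

/-- Each `g_{k+1}` solves the fourth Painlevé equation: eliminate `g_{k+2}` from the Hamiltonian
system satisfied by `(g_{k+1}, g_{k+2})`. -/
theorem isP4Solution_chainNF (hw : IsWeber a w)
    (hne : ∀ k, ∀ᶠ x in codiscrete ℂ, chain w (k + 1) x ≠ 0) (k : ℕ) :
    IsP4Solution ((-1) ^ k * (1 / 2 - a)) (chainParam a (k + 1)) (chainNF w (k + 1)) := by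
  have hm := hw.meromorphic
  have han := fun k => eventually_codiscrete_analyticAt (meromorphic_chain hm k)
  refine ⟨isNonzeroMeromorphic_chainNF hw (hne k), ?_⟩
  filter_upwards [eventually_codiscrete_nhds (chain_hamiltonian hw hne k), hne k,
    chainNF_eventuallyEq hw (k + 1), han (k + 1), han (k + 2)] with x h h0 hy a1 a2
  rw [hy.deriv.deriv_eq, hy.deriv_eq, hy.eq_of_nhds]
  have e1 := a1.differentiableAt.hasDerivAt
  have e2 := a2.differentiableAt.hasDerivAt
  have e3 := ((e1.mul ((e1.add ((hasDerivAt_id x).const_mul (2 : ℂ))).add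
    (e2.const_mul (2 : ℂ)))).sub_const (chainParam a (k + 1))).deriv
  have e4 : deriv (deriv (chain w (k + 1))) x = _ :=
    (EventuallyEq.deriv_eq (h.mono fun z hz => hz.1)).trans e3
  simp only [Pi.add_apply, id, mul_one] at e4
  rw [e4, h.self_of_nhds.1, h.self_of_nhds.2, chainParam_add_two a k]
  field_simp
  ring

/-- `g₁` solves a Riccati equation, and by the first integral `g_{k+2}` is the image of `g_{k+1}`
under `R∞⁺`. -/
theorem isClassical_chainNF (hw : IsWeber a w)
    (hne : ∀ k, ∀ᶠ x in codiscrete ℂ, chain w (k + 1) x ≠ 0) (k : ℕ) :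
    IsClassical ((-1) ^ k * (1 / 2 - a)) (chainParam a (k + 1)) (chainNF w (k + 1)) := by
  induction k with
  | zero =>
    refine .riccati _ _ (-1) (-2 * a) _ (by norm_num) ?_ ?_
      (isNonzeroMeromorphic_chainNF hw (hne 0)) ?_
    · simp only [chainParam]
      ring
    · simp [chainParam]
    · filter_upwards [chain_hamiltonian hw hne 0, chain_integral hw hne 0, hne 0,
        chainNF_eventuallyEq hw 1] with x h1 h2 h0 hy
      rw [hy.deriv_eq, hy.eq_of_nhds]
      simp only [zero_add] at h1 h2
      rw [h1.1]
      have : chain w 0 x = 0 := rfl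
      rw [this] at h2
      simp only [chainParam] at h2 ⊢
      linear_combination 2 * h2
  | succ k ih =>
    have e1 : (-1) ^ (k + 1) * (1 / 2 - a) = -((-1) ^ k * (1 / 2 - a)) := by ring
    rw [e1, chainParam_add_two a k]
    refine .inftyPlus _ _ _ _ ih (isNonzeroMeromorphic_chainNF hw (hne (k + 1))) ?_
    filter_upwards [chain_hamiltonian hw hne k, hne k, chainNF_eventuallyEq hw (k + 1),
      chainNF_eventuallyEq hw (k + 2)] with x h h0 hy hz
    rw [hy.deriv_eq, hy.eq_of_nhds, hz.eq_of_nhds, h.1]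
    field_simp
    ring

end chain

/-! ### Laplace integrals -/

section Laplace

open MeasureTheory

/-- The integral `∫₀^∞ s^{a-1} exp (-(A s² + B s)) ds`. -/
noncomputable def laplace (a A B : ℂ) : ℂ :=
  ∫ s : ℝ in Ioi 0, (s : ℂ) ^ (a - 1) * Complex.exp (-(A * s ^ 2 + B * s))

/-- The exponent `A s² + B s` grows at least linearly on `[0, ∞)`. -/
def Growing (ε C : ℝ) (A B : ℂ) : Prop :=
  ∀ s : ℝ, 0 ≤ s → ε * s - C ≤ (A * (s : ℂ) ^ 2 + B * s).re

theorem growing_of_re_pos {ε M : ℝ} (hε : 0 < ε) {A B : ℂ} (hA : ε ≤ A.re) (hB : -M ≤ B.re) :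
    Growing 1 ((M + 1) ^ 2 / (4 * ε)) A B := by
  intro s hs
  have h1 : (A * (s : ℂ) ^ 2 + B * s).re = A.re * s ^ 2 + B.re * s := by
    rw [← Complex.ofReal_pow, Complex.add_re, Complex.re_mul_ofReal, Complex.re_mul_ofReal]
  rw [h1]
  have h2 : ε * s ^ 2 - M * s ≤ A.re * s ^ 2 + B.re * s := by nlinarith [sq_nonneg s]
  refine le_trans ?_ h2
  rw [sub_le_iff_le_add]
  have h3 : ε * s ^ 2 - (M + 1) * s + (M + 1) ^ 2 / (4 * ε) =
      (2 * ε * s - (M + 1)) ^ 2 / (4 * ε) := by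
    field_simp
    ring
  have h4 : 0 ≤ (2 * ε * s - (M + 1)) ^ 2 / (4 * ε) := by positivity
  linarith

theorem growing_zero {ε : ℝ} {B : ℂ} (hB : ε ≤ B.re) : Growing ε 0 0 B := by
  intro s hs
  have : (0 * (s : ℂ) ^ 2 + B * s).re = B.re * s := by simp
  rw [this, sub_zero]
  gcongr

section

variable {a A B : ℂ} {ε C : ℝ}

theorem integrableOn_rpow_mul_exp_neg (hε : 0 < ε) {p : ℝ} (hp : -1 < p) :
    IntegrableOn (fun s : ℝ => s ^ p * Real.exp (-ε * s)) (Ioi 0) := by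
  simpa using integrableOn_rpow_mul_exp_neg_mul_rpow hp one_pos hε

theorem norm_laplace_integrand_le (h : Growing ε C A B) {s : ℝ} (hs : 0 < s) :
    ‖(s : ℂ) ^ (a - 1) * Complex.exp (-(A * s ^ 2 + B * s))‖ ≤
      Real.exp C * (s ^ (a.re - 1) * Real.exp (-ε * s)) := by
  rw [norm_mul, Complex.norm_cpow_eq_rpow_re_of_pos hs, Complex.norm_exp, Complex.sub_re,
    Complex.one_re, mul_left_comm, ← Real.exp_add]
  gcongr
  have := h s hs.le
  rw [Complex.neg_re]
  linarith

theorem aestronglyMeasurable_laplace_integrand (a A B : ℂ) :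
    AEStronglyMeasurable (fun s : ℝ => (s : ℂ) ^ (a - 1) * Complex.exp (-(A * s ^ 2 + B * s)))
      (volume.restrict (Ioi 0)) := by
  refine ContinuousOn.aestronglyMeasurable (fun s hs => ?_) measurableSet_Ioi
  refine ContinuousAt.continuousWithinAt (ContinuousAt.mul
    (Complex.continuousAt_ofReal_cpow_const _ _ (Or.inr (ne_of_gt hs))) ?_)
  fun_prop

theorem integrableOn_laplace (hε : 0 < ε) (ha : 0 < a.re) (h : Growing ε C A B) :
    IntegrableOn (fun s : ℝ => (s : ℂ) ^ (a - 1) * Complex.exp (-(A * s ^ 2 + B * s)))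
      (Ioi 0) := by
  refine Integrable.mono' ((integrableOn_rpow_mul_exp_neg (p := a.re - 1) hε
    (by linarith)).const_mul (Real.exp C)) (aestronglyMeasurable_laplace_integrand a A B) ?_
  filter_upwards [ae_restrict_mem measurableSet_Ioi] with s hs
    using norm_laplace_integrand_le h hs

theorem cpow_mul_self_of_pos {s : ℝ} (hs : 0 < s) (a : ℂ) :
    (s : ℂ) ^ (a - 1) * s = (s : ℂ) ^ (a + 1 - 1) := by
  have : (s : ℂ) ≠ 0 := Complex.ofReal_ne_zero.2 hs.ne'
  rw [add_sub_cancel_right, Complex.cpow_sub _ _ this, Complex.cpow_one, div_mul_cancel₀ _ this]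

theorem hasDerivAt_laplace {A B A' B' : ℂ → ℂ} {z₀ : ℂ} {M : ℝ} (hε : 0 < ε) (ha : 0 < a.re)
    (h : ∀ᶠ z in 𝓝 z₀, HasDerivAt A (A' z) z ∧ HasDerivAt B (B' z) z ∧ ‖A' z‖ ≤ M ∧
      ‖B' z‖ ≤ M ∧ Growing ε C (A z) (B z)) :
    HasDerivAt (fun z => laplace a (A z) (B z))
      (-(A' z₀ * laplace (a + 2) (A z₀) (B z₀) + B' z₀ * laplace (a + 1) (A z₀) (B z₀))) z₀ := by
  have h0 := h.self_of_nhds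
  have ha1 : 0 < (a + 1).re := by simp; linarith
  have ha2 : 0 < (a + 2).re := by simp; linarith
  have i1 := integrableOn_laplace hε ha1 h0.2.2.2.2
  have i2 := integrableOn_laplace hε ha2 h0.2.2.2.2
  have e : ∀ z, EqOn (fun s : ℝ => (s : ℂ) ^ (a - 1) *
      (Complex.exp (-(A z * s ^ 2 + B z * s)) * -(A' z * s ^ 2 + B' z * s)))
      (fun s : ℝ => -(A' z * ((s : ℂ) ^ (a + 2 - 1) * Complex.exp (-(A z * s ^ 2 + B z * s))) +
        B' z * ((s : ℂ) ^ (a + 1 - 1) * Complex.exp (-(A z * s ^ 2 + B z * s))))) (Ioi 0) := by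
    intro z s hs
    have hs : 0 < s := hs
    simp only []
    rw [show a + 2 - 1 = a + 1 + 1 - 1 by ring, ← cpow_mul_self_of_pos hs (a + 1),
      ← cpow_mul_self_of_pos hs a]
    ring
  have key := hasDerivAt_integral_of_dominated_loc_of_deriv_le
    (μ := volume.restrict (Ioi (0 : ℝ)))
    (F := fun z (s : ℝ) => (s : ℂ) ^ (a - 1) * Complex.exp (-(A z * s ^ 2 + B z * s)))
    (F' := fun z (s : ℝ) => (s : ℂ) ^ (a - 1) *
      (Complex.exp (-(A z * s ^ 2 + B z * s)) * -(A' z * s ^ 2 + B' z * s)))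
    (bound := fun s => M * (Real.exp C * (s ^ ((a + 2).re - 1) * Real.exp (-ε * s))) +
      M * (Real.exp C * (s ^ ((a + 1).re - 1) * Real.exp (-ε * s))))
    h (Eventually.of_forall fun z => aestronglyMeasurable_laplace_integrand a (A z) (B z))
    (integrableOn_laplace hε ha h0.2.2.2.2) ?_ ?_ ?_ ?_
  · refine key.2.congr_deriv ?_
    rw [setIntegral_congr_fun measurableSet_Ioi (e z₀), integral_neg,
      integral_add (i2.const_mul _) (i1.const_mul _), integral_const_mul, integral_const_mul]
    rfl
  · exact (IntegrableOn.congr_fun ((i2.const_mul (A' z₀)).add (i1.const_mul (B' z₀))).neg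
      (fun s hs => (e z₀ hs).symm) measurableSet_Ioi).aestronglyMeasurable
  · filter_upwards [ae_restrict_mem measurableSet_Ioi] with s hs z hz
    have := e z hs
    simp only [] at this
    rw [this, norm_neg]
    refine (norm_add_le _ _).trans ?_
    rw [norm_mul (A' z), norm_mul (B' z)]
    have hM : 0 ≤ M := (norm_nonneg _).trans hz.2.2.1
    exact add_le_add
      (mul_le_mul hz.2.2.1 (norm_laplace_integrand_le hz.2.2.2.2 hs) (norm_nonneg _) hM)
      (mul_le_mul hz.2.2.2.1 (norm_laplace_integrand_le hz.2.2.2.2 hs) (norm_nonneg _) hM)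
  · exact (((integrableOn_rpow_mul_exp_neg hε (by linarith)).const_mul _).const_mul _).add
      (((integrableOn_rpow_mul_exp_neg hε (by linarith)).const_mul _).const_mul _)
  · refine Eventually.of_forall fun s z hz => ?_
    exact ((((hz.1.mul_const _).add (hz.2.1.mul_const _)).neg).cexp).const_mul _

/-- Integration by parts. -/
theorem laplace_recurrence (hε : 0 < ε) (ha : 0 < a.re) (h : Growing ε C A B) :
    a * laplace a A B = 2 * A * laplace (a + 2) A B + B * laplace (a + 1) A B := by
  have ha0 : a ≠ 0 := fun h => by simp [h] at ha
  have ha1 : 0 < (a + 1).re := by simp; linarith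
  have ha2 : 0 < (a + 2).re := by simp; linarith
  have i0 := integrableOn_laplace hε ha h
  have i1 := integrableOn_laplace hε ha1 h
  have i2 := integrableOn_laplace hε ha2 h
  set G : ℝ → ℂ := fun s => (s : ℂ) ^ a * Complex.exp (-(A * s ^ 2 + B * s)) with hG
  set G' : ℝ → ℂ := fun s => a * ((s : ℂ) ^ (a - 1) * Complex.exp (-(A * s ^ 2 + B * s))) -
    (2 * A * ((s : ℂ) ^ (a + 2 - 1) * Complex.exp (-(A * s ^ 2 + B * s))) +
      B * ((s : ℂ) ^ (a + 1 - 1) * Complex.exp (-(A * s ^ 2 + B * s)))) with hG'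
  have iG' : IntegrableOn G' (Ioi 0) :=
    (i0.const_mul a).sub ((i2.const_mul (2 * A)).add (i1.const_mul B))
  have hder : ∀ s ∈ Ioi (0 : ℝ), HasDerivAt G (G' s) s := by
    intro s hs
    have hs : 0 < s := hs
    have d1 := hasDerivAt_ofReal_cpow_const (x := s) (r := a) hs.ne' ha0
    have d2 : HasDerivAt (fun s : ℝ => Complex.exp (-(A * (s : ℂ) ^ 2 + B * s)))
        (Complex.exp (-(A * (s : ℂ) ^ 2 + B * s)) * -(A * (2 * s) + B)) s := by
      refine HasDerivAt.comp_ofReal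
        (e := fun z : ℂ => Complex.exp (-(A * z ^ 2 + B * z))) ?_
      have := ((((hasDerivAt_pow 2 (s : ℂ)).const_mul A).add
        ((hasDerivAt_id (s : ℂ)).const_mul B)).neg).cexp
      simpa using this
    refine (d1.mul d2).congr_deriv ?_
    rw [hG']
    simp only []
    rw [show a + 2 - 1 = a + 1 + 1 - 1 by ring, ← cpow_mul_self_of_pos hs (a + 1),
      show (s : ℂ) ^ a = (s : ℂ) ^ (a + 1 - 1) by rw [add_sub_cancel_right],
      ← cpow_mul_self_of_pos hs a]
    ring
  have hlim : Tendsto G atTop (𝓝 0) := by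
    refine tendsto_zero_of_hasDerivAt_of_integrableOn_Ioi hder iG' ?_
    simpa [hG] using i1
  have hcont : ContinuousWithinAt G (Ici 0) 0 := by
    refine ContinuousAt.continuousWithinAt (ContinuousAt.mul
      (Complex.continuousAt_ofReal_cpow_const _ _ (Or.inl ha)) ?_)
    fun_prop
  have h1 := integral_Ioi_of_hasDerivAt_of_tendsto hcont hder iG' hlim
  have h2 : ∫ s in Ioi 0, G' s =
      a * laplace a A B - (2 * A * laplace (a + 2) A B + B * laplace (a + 1) A B) := by
    refine (integral_sub (i0.const_mul a) ((i2.const_mul (2 * A)).add (i1.const_mul B))).trans ?_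
    rw [integral_const_mul]
    congr 1
    refine (integral_add (i2.const_mul (2 * A)) (i1.const_mul B)).trans ?_
    rw [integral_const_mul, integral_const_mul]
    rfl
  have h0 : G 0 = 0 := by simp [hG, Complex.zero_cpow ha0]
  rw [h2, h0, sub_zero] at h1
  exact sub_eq_zero.1 h1

theorem eventually_growing {A B : ℂ → ℂ} {z₀ : ℂ} (hA : ContinuousAt A z₀)
    (hB : ContinuousAt B z₀) (h : 0 < (A z₀).re ∨ (∀ z, A z = 0) ∧ 0 < (B z₀).re) :
    ∃ ε > 0, ∃ C, ∀ᶠ z in 𝓝 z₀, Growing ε C (A z) (B z) := by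
  have hA' := Complex.continuous_re.continuousAt.comp hA
  have hB' := Complex.continuous_re.continuousAt.comp hB
  rcases h with h | ⟨h0, h⟩
  · refine ⟨1, one_pos, (|(B z₀).re| + 1 + 1) ^ 2 / (4 * ((A z₀).re / 2)), ?_⟩
    filter_upwards [hA'.eventually_const_le (half_lt_self h),
      hB'.eventually_const_le (u := -(|(B z₀).re| + 1))
        (by simp only [Function.comp]; linarith [neg_abs_le (B z₀).re])] with z h1 h2
    exact growing_of_re_pos (half_pos h) h1 h2
  · refine ⟨(B z₀).re / 2, half_pos h, 0, ?_⟩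
    filter_upwards [hB'.eventually_const_le (half_lt_self h)] with z h1
    rw [h0 z]
    exact growing_zero h1

theorem hasDerivAt_laplace_of_differentiable {A B A' B' : ℂ → ℂ} {z₀ : ℂ} (ha : 0 < a.re)
    (hA : ∀ z, HasDerivAt A (A' z) z) (hB : ∀ z, HasDerivAt B (B' z) z)
    (hA' : Continuous A') (hB' : Continuous B')
    (h : 0 < (A z₀).re ∨ (∀ z, A z = 0) ∧ 0 < (B z₀).re) :
    HasDerivAt (fun z => laplace a (A z) (B z))
      (-(A' z₀ * laplace (a + 2) (A z₀) (B z₀) + B' z₀ * laplace (a + 1) (A z₀) (B z₀))) z₀ := by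
  obtain ⟨ε, hε, C, hC⟩ := eventually_growing (hA z₀).continuousAt (hB z₀).continuousAt h
  refine hasDerivAt_laplace (M := max (‖A' z₀‖ + 1) (‖B' z₀‖ + 1)) (C := C) hε ha ?_
  filter_upwards [hC, hA'.norm.continuousAt.eventually_le_const (lt_add_one ‖A' z₀‖),
    hB'.norm.continuousAt.eventually_le_const (lt_add_one ‖B' z₀‖)] with z h1 h2 h3
  exact ⟨hA z, hB z, h2.trans (le_max_left _ _), h3.trans (le_max_right _ _), h1⟩

/-- Rotation of the ray of integration: the integral over the ray `s = e^ζ t`, `t > 0`, does not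
depend on `ζ` as long as it converges, because its derivative with respect to `ζ` is the integral of
a derivative. -/
theorem laplace_rotate {α x ζ : ℂ} (ha : 0 < a.re)
    (h : ∀ t ∈ Icc (0 : ℝ) 1, 0 < (α * Complex.exp (2 * (t * ζ))).re ∨
      α = 0 ∧ 0 < (x * Complex.exp (t * ζ)).re) :
    Complex.exp (a * ζ) * laplace a (α * Complex.exp (2 * ζ)) (x * Complex.exp ζ) =
      laplace a α x := by
  have dA : ∀ z : ℂ, HasDerivAt (fun z => α * Complex.exp (2 * (z * ζ)))
      (2 * ζ * (α * Complex.exp (2 * (z * ζ)))) z := fun z => by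
    refine (((((hasDerivAt_id z).mul_const ζ).const_mul 2).cexp).const_mul α).congr_deriv ?_
    simp only [id]
    ring
  have dB : ∀ z : ℂ, HasDerivAt (fun z => x * Complex.exp (z * ζ))
      (ζ * (x * Complex.exp (z * ζ))) z := fun z => by
    refine (((((hasDerivAt_id z).mul_const ζ)).cexp).const_mul x).congr_deriv ?_
    simp only [id]
    ring
  have key : ∀ t ∈ Icc (0 : ℝ) 1, HasDerivAt (fun t : ℝ => Complex.exp (a * (t * ζ)) *
      laplace a (α * Complex.exp (2 * (t * ζ))) (x * Complex.exp (t * ζ))) 0 t := by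
    intro t ht
    refine HasDerivAt.comp_ofReal (e := fun z : ℂ => Complex.exp (a * (z * ζ)) *
      laplace a (α * Complex.exp (2 * (z * ζ))) (x * Complex.exp (z * ζ))) ?_
    have hadm : 0 < (α * Complex.exp (2 * ((t : ℂ) * ζ))).re ∨
        (∀ z, α * Complex.exp (2 * (z * ζ)) = 0) ∧ 0 < (x * Complex.exp ((t : ℂ) * ζ)).re :=
      (h t ht).imp_right fun h => ⟨fun z => by rw [h.1, zero_mul], h.2⟩
    obtain ⟨ε, hε, C, hC⟩ := eventually_growing (dA t).continuousAt (dB t).continuousAt hadm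
    have hrec := laplace_recurrence hε ha hC.self_of_nhds
    have d := hasDerivAt_laplace_of_differentiable ha dA dB (by fun_prop) (by fun_prop) hadm
    have d0 : HasDerivAt (fun z : ℂ => Complex.exp (a * (z * ζ)))
        (Complex.exp (a * (t * ζ)) * (a * ζ)) t := by
      simpa using (((hasDerivAt_id (t : ℂ)).mul_const ζ).const_mul a).cexp
    refine (d0.mul d).congr_deriv ?_
    linear_combination Complex.exp (a * (t * ζ)) * ζ * hrec
  have := constant_of_has_deriv_right_zero (fun t ht => (key t ht).continuousAt.continuousWithinAt)
    (fun t ht => (key t (Ico_subset_Icc_self ht)).hasDerivWithinAt) 1 (right_mem_Icc.2 zero_le_one)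
  simpa using this

theorem laplace_zero_exp {L : ℂ} (ha : 0 < a.re) (hL : |L.im| < Real.pi / 2) :
    laplace a 0 (Complex.exp L) = Complex.Gamma a * Complex.exp (-a * L) := by
  have h := laplace_rotate (a := a) (α := 0) (x := Complex.exp L.re) (ζ := L.im * Complex.I) ha
    fun t ht => Or.inr ⟨rfl, by
      rw [← Complex.ofReal_exp, Complex.re_ofReal_mul, ← mul_assoc, ← Complex.ofReal_mul,
        Complex.exp_ofReal_mul_I_re]
      refine mul_pos (Real.exp_pos _) (Real.cos_pos_of_mem_Ioo ?_)
      have : |t * L.im| < Real.pi / 2 := by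
        rw [abs_mul, abs_of_nonneg ht.1]
        exact (mul_le_of_le_one_left (abs_nonneg _) ht.2).trans_lt hL
      exact abs_lt.1 this⟩
  rw [zero_mul, ← Complex.exp_add, Complex.re_add_im] at h
  have h2 : laplace a 0 (Complex.exp L.re) = Complex.exp (-a * L.re) * Complex.Gamma a := by
    have := Complex.integral_cpow_mul_exp_neg_mul_Ioi ha (Real.exp_pos L.re)
    rw [laplace]
    simp only [zero_mul, zero_add]
    rw [← Complex.ofReal_exp, this, one_div, Complex.ofReal_exp, ← Complex.exp_neg,
      ← Complex.ofReal_neg, ← Complex.ofReal_exp, Complex.cpow_def_of_ne_zero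
      (Complex.ofReal_ne_zero.2 (Real.exp_pos _).ne'), ← Complex.ofReal_log (Real.exp_pos _).le,
      Real.log_exp]
    congr 2
    push_cast
    ring
  rw [h2] at h
  have h3 : Complex.exp (-a * L.re) =
      Complex.exp (a * (L.im * Complex.I)) * Complex.exp (-a * L) := by
    rw [← Complex.exp_add]
    congr 1
    linear_combination -a * Complex.re_add_im L
  rw [h3, mul_assoc] at h
  rw [mul_left_cancel₀ (Complex.exp_ne_zero _) h]
  ring

theorem norm_exp_sub_one_le_norm {z : ℂ} (hz : z.re ≤ 0) : ‖Complex.exp z - 1‖ ≤ ‖z‖ := by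
  have := (convex_halfSpace_re_le 0).norm_image_sub_le_of_norm_hasDerivWithin_le
    (f := Complex.exp) (f' := Complex.exp) (C := 1) (x := 0) (y := z)
    (fun x _ => (Complex.hasDerivAt_exp x).hasDerivWithinAt)
    (fun x hx => by
      rw [Complex.norm_exp]
      exact Real.exp_le_one_iff.2 hx) (by simp) hz
  simpa using this

theorem norm_laplace_sub_le (ha : 0 < a.re) (hA : 0 ≤ A.re) (hA' : ‖A‖ ≤ 1) (hB : 0 < B.re) :
    ‖laplace a A B - laplace a 0 B‖ ≤ (1 / B.re) ^ (a.re + 2) * Real.Gamma (a.re + 2) := by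
  have g1 : Growing B.re 0 A B := by
    intro s hs
    rw [← Complex.ofReal_pow, Complex.add_re, Complex.re_mul_ofReal, Complex.re_mul_ofReal]
    nlinarith [sq_nonneg s]
  have g0 : Growing B.re 0 0 B := growing_zero le_rfl
  rw [laplace, laplace, ← integral_sub (integrableOn_laplace hB ha g1)
    (integrableOn_laplace hB ha g0),
    ← Real.integral_rpow_mul_exp_neg_mul_Ioi (by linarith) hB]
  refine norm_integral_le_of_norm_le ?_ ?_
  · have := integrableOn_rpow_mul_exp_neg (p := a.re + 2 - 1) hB (by linarith)
    simp only [neg_mul] at this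
    exact this
  · filter_upwards [ae_restrict_mem measurableSet_Ioi] with s hs
    have hs : 0 < s := hs
    have e : (s : ℂ) ^ (a - 1) * Complex.exp (-(A * s ^ 2 + B * s)) -
        (s : ℂ) ^ (a - 1) * Complex.exp (-(0 * s ^ 2 + B * s)) =
        (s : ℂ) ^ (a - 1) * (Complex.exp (-(B * s)) * (Complex.exp (-(A * s ^ 2)) - 1)) := by
      rw [mul_sub (Complex.exp _), ← Complex.exp_add, ← mul_sub]
      ring_nf
    have h1 : ‖Complex.exp (-(A * (s : ℂ) ^ 2)) - 1‖ ≤ s ^ 2 := by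
      refine (norm_exp_sub_one_le_norm ?_).trans ?_
      · rw [← Complex.ofReal_pow, Complex.neg_re, Complex.re_mul_ofReal]
        nlinarith [sq_nonneg s, mul_nonneg hA (sq_nonneg s)]
      · rw [norm_neg, norm_mul, norm_pow, Complex.norm_real, Real.norm_of_nonneg hs.le]
        exact mul_le_of_le_one_left (sq_nonneg s) hA'
    rw [e, norm_mul, norm_mul, Complex.norm_cpow_eq_rpow_re_of_pos hs, Complex.norm_exp,
      Complex.neg_re, Complex.re_mul_ofReal, Complex.sub_re, Complex.one_re,
      show a.re + 2 - 1 = a.re - 1 + 2 by ring, Real.rpow_add hs, Real.rpow_two, mul_assoc,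
      mul_comm (s ^ 2)]
    gcongr

/-- The expansion of the Laplace integral in the sector `|arg x| < 3π/4`: for `arg x = θ`, the ray
of integration is rotated to `arg s = -θ/3`. -/
theorem isAsymp_laplace (ha : 0 < a.re) :
    IsAsymp (-(3 * Real.pi / 4)) (3 * Real.pi / 4)
      (fun ζ => laplace a (1 / 4) (Complex.exp ζ)) (Complex.Gamma a) (-a) 0 := by
  have hΓ : Complex.Gamma a ≠ 0 := Complex.Gamma_ne_zero_of_re_pos ha
  refine ⟨fun ζ => powExp (Complex.Gamma a)⁻¹ a 0 ζ *
    (laplace a (1 / 4) (Complex.exp ζ) - powExp (Complex.Gamma a) (-a) 0 ζ), ⟨?_, ?_⟩, ?_⟩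
  · refine Eventually.of_forall fun ζ => (analyticAt_powExp _ _ _ ζ).mul
      (AnalyticAt.sub ?_ (analyticAt_powExp _ _ _ ζ))
    refine Differentiable.analyticAt (fun z => ?_) ζ
    exact (hasDerivAt_laplace_of_differentiable (A := fun _ => 1 / 4) (A' := fun _ => 0)
      (B := Complex.exp) (B' := Complex.exp) ha (fun z => hasDerivAt_const z _)
      Complex.hasDerivAt_exp (by fun_prop) (by fun_prop) (Or.inl (by norm_num))).differentiableAt
  · intro δ hδ
    refine IsBigO.of_bound (‖(Complex.Gamma a)⁻¹‖ * Real.exp (|a.im| * (2 * Real.pi)) *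
      ((1 / Real.sin (2 * δ / 3)) ^ (a.re + 2) * Real.Gamma (a.re + 2)))
      (eventually_strip.2 ⟨0, fun ζ _ h1 h2 => ?_⟩)
    have hπ := Real.pi_pos
    have hδ' : δ ≤ 3 * Real.pi / 4 := by linarith
    have him : |ζ.im| ≤ 3 * Real.pi / 4 - δ := abs_le.2 ⟨by linarith, h2⟩
    have hsin : 0 < Real.sin (2 * δ / 3) := Real.sin_pos_of_pos_of_lt_pi (by linarith) (by linarith)
    set φ : ℝ := ζ.im / 3 with hφ
    have hφ' : |φ| < Real.pi / 4 := by
      rw [hφ, abs_div, abs_of_pos (by norm_num : (0 : ℝ) < 3)]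
      linarith
    have hrot := laplace_rotate (a := a) (α := 1 / 4) (x := Complex.exp ζ)
      (ζ := (-φ : ℝ) * Complex.I) ha fun t ht => Or.inl (by
        rw [show 2 * ((t : ℂ) * ((-φ : ℝ) * Complex.I)) = (2 * (t * -φ) : ℝ) * Complex.I by
          push_cast; ring, show (1 / 4 : ℂ) = (1 / 4 : ℝ) by norm_num, Complex.re_ofReal_mul,
          Complex.exp_ofReal_mul_I_re]
        refine mul_pos (by norm_num) (Real.cos_pos_of_mem_Ioo ?_)
        have : |2 * (t * -φ)| < Real.pi / 2 := by
          rw [abs_mul, abs_mul, abs_neg, abs_of_nonneg ht.1, abs_two]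
          have := mul_le_of_le_one_left (abs_nonneg φ) ht.2
          linarith
        exact abs_lt.1 this)
    have hre : (Complex.exp ζ * Complex.exp ((-φ : ℝ) * Complex.I)).re =
        Real.exp ζ.re * Real.cos (2 * ζ.im / 3) := by
      rw [← Complex.exp_add, Complex.exp_re]
      simp only [Complex.add_re, Complex.add_im, Complex.re_ofReal_mul, Complex.im_ofReal_mul,
        Complex.I_re, Complex.I_im, mul_zero, mul_one, add_zero]
      congr 2
      rw [hφ]
      ring
    have hcos : Real.sin (2 * δ / 3) ≤ Real.cos (2 * ζ.im / 3) := by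
      rw [← Real.cos_pi_div_two_sub, ← Real.cos_abs (2 * ζ.im / 3)]
      refine Real.cos_le_cos_of_nonneg_of_le_pi (abs_nonneg _) (by linarith) ?_
      rw [abs_div, abs_mul, abs_two, abs_of_pos (by norm_num : (0 : ℝ) < 3)]
      linarith
    have hpos : 0 < (Complex.exp ζ * Complex.exp ((-φ : ℝ) * Complex.I)).re := by
      rw [hre]
      exact mul_pos (Real.exp_pos _) (hsin.trans_le hcos)
    have hA : ∀ ψ : ℝ, (1 / 4 : ℂ) * Complex.exp (2 * (ψ * Complex.I)) =
        (1 / 4 : ℝ) * Complex.exp ((2 * ψ : ℝ) * Complex.I) := fun ψ => by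
      push_cast
      congr 2
      ring
    have hdiff := norm_laplace_sub_le (a := a) (A := 1 / 4 * Complex.exp (2 * ((-φ : ℝ) *
      Complex.I))) ha (by
        rw [hA, Complex.re_ofReal_mul, Complex.exp_ofReal_mul_I_re]
        refine mul_nonneg (by norm_num) (Real.cos_nonneg_of_mem_Icc ?_)
        obtain ⟨h3, h4⟩ := abs_lt.1 hφ'
        constructor <;> linarith) (by
        rw [hA, norm_mul, Complex.norm_exp_ofReal_mul_I]
        norm_num) hpos
    have hmain : laplace a 0 (Complex.exp ζ * Complex.exp ((-φ : ℝ) * Complex.I)) =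
        Complex.Gamma a * Complex.exp (-a * (ζ + (-φ : ℝ) * Complex.I)) := by
      rw [← Complex.exp_add]
      refine laplace_zero_exp ha ?_
      have : (ζ + ((-φ : ℝ) : ℂ) * Complex.I).im = 2 * ζ.im / 3 := by
        simp [hφ]
        ring
      rw [this, abs_div, abs_mul, abs_two, abs_of_pos (by norm_num : (0 : ℝ) < 3)]
      linarith
    have hp : powExp (Complex.Gamma a) (-a) 0 ζ = Complex.exp (a * ((-φ : ℝ) * Complex.I)) *
        laplace a 0 (Complex.exp ζ * Complex.exp ((-φ : ℝ) * Complex.I)) := by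
      rw [hmain, powExp, mul_left_comm, ← Complex.exp_add]
      congr 2
      ring
    rw [← hrot, hp, ← mul_sub, norm_mul, norm_mul, norm_powExp, Complex.norm_exp,
      Real.norm_of_nonneg (Real.exp_pos _).le]
    rw [hre] at hdiff
    have hb : (1 / (Real.exp ζ.re * Real.cos (2 * ζ.im / 3))) ^ (a.re + 2) ≤
        Real.exp (-(a.re + 2) * ζ.re) * (1 / Real.sin (2 * δ / 3)) ^ (a.re + 2) := by
      have : Real.exp (-(a.re + 2) * ζ.re) = (1 / Real.exp ζ.re) ^ (a.re + 2) := by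
        rw [one_div, ← Real.exp_neg, ← Real.exp_mul]
        congr 1
        ring
      have hc : 0 < Real.cos (2 * ζ.im / 3) := hsin.trans_le hcos
      rw [this, ← Real.mul_rpow (by positivity) (one_div_nonneg.2 hsin.le)]
      refine Real.rpow_le_rpow (one_div_nonneg.2 (by positivity)) ?_ (by linarith)
      rw [one_div_mul_one_div]
      exact one_div_le_one_div_of_le (mul_pos (Real.exp_pos _) hsin) (by gcongr)
    have hG2 : 0 ≤ Real.Gamma (a.re + 2) := (Real.Gamma_pos_of_pos (by linarith)).le
    have hexp : (a * (((-φ : ℝ) : ℂ) * Complex.I)).re = a.im * φ := by simp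
    have hi : a.im * φ - a.im * ζ.im ≤ |a.im| * (2 * Real.pi) := by
      rw [← mul_sub]
      refine (le_abs_self _).trans ?_
      rw [abs_mul]
      refine mul_le_mul_of_nonneg_left ?_ (abs_nonneg _)
      have := abs_sub φ ζ.im
      linarith
    rw [zero_mul, Complex.zero_re, add_zero, hexp]
    calc _ ≤ ‖(Complex.Gamma a)⁻¹‖ * Real.exp (a.re * ζ.re - a.im * ζ.im) *
          (Real.exp (a.im * φ) * (Real.exp (-(a.re + 2) * ζ.re) *
            (1 / Real.sin (2 * δ / 3)) ^ (a.re + 2) * Real.Gamma (a.re + 2))) := by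
          gcongr
          exact hdiff.trans (mul_le_mul_of_nonneg_right hb hG2)
      _ = ‖(Complex.Gamma a)⁻¹‖ * Real.exp (a.im * φ - a.im * ζ.im) *
          ((1 / Real.sin (2 * δ / 3)) ^ (a.re + 2) * Real.Gamma (a.re + 2)) *
            Real.exp (-2 * ζ.re) := by
          have : Real.exp (a.re * ζ.re - a.im * ζ.im) * Real.exp (a.im * φ) *
              Real.exp (-(a.re + 2) * ζ.re) =
              Real.exp (a.im * φ - a.im * ζ.im) * Real.exp (-2 * ζ.re) := by
            rw [← Real.exp_add, ← Real.exp_add, ← Real.exp_add]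
            congr 1
            ring
          linear_combination ‖(Complex.Gamma a)⁻¹‖ * (1 / Real.sin (2 * δ / 3)) ^ (a.re + 2) *
            Real.Gamma (a.re + 2) * this
      _ ≤ _ := by
          have : 0 ≤ (1 / Real.sin (2 * δ / 3)) ^ (a.re + 2) :=
            Real.rpow_nonneg (one_div_nonneg.2 hsin.le) _
          gcongr
  · refine Eventually.of_forall fun ζ => ?_
    have : powExp (Complex.Gamma a) (-a) 0 ζ * powExp (Complex.Gamma a)⁻¹ a 0 ζ = 1 := by
      rw [powExp_mul, mul_inv_cancel₀ hΓ]
      simp [powExp]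
    linear_combination (powExp (Complex.Gamma a) (-a) 0 ζ -
      laplace a (1 / 4) (Complex.exp ζ)) * this

/-! ### Hermite functions of arbitrary index -/

/-- `h₀` and `h₁` are the entire functions `H_a` and `H_{a+1}`, where
`H_a(x) = Γ(a)⁻¹ ∫₀^∞ t^{a-1} exp (-t²/4 - x t) dt` for `Re a > 0`: the solution
of `H'' - 2 x H' - 2 a H = 0` which behaves like `x^{-a}` in the sector `|arg x| < 3π/4`. -/
structure IsHermite (a : ℂ) (h₀ h₁ : ℂ → ℂ) : Prop where
  hasDerivAt_fst : ∀ x, HasDerivAt h₀ (-a * h₁ x) x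
  hasDerivAt_snd : ∀ x, HasDerivAt h₁ (2 * x * h₁ x - 2 * h₀ x) x
  isAsymp_fst : IsAsymp (-(3 * Real.pi / 4)) (3 * Real.pi / 4)
    (fun ζ => h₀ (Complex.exp ζ)) 1 (-a) 0
  isAsymp_snd : IsAsymp (-(3 * Real.pi / 4)) (3 * Real.pi / 4)
    (fun ζ => h₁ (Complex.exp ζ)) 1 (-(a + 1)) 0
  zero_fst : h₀ 0 = Real.sqrt Real.pi * (Complex.Gamma ((a + 1) / 2))⁻¹
  zero_snd : h₁ 0 = Real.sqrt Real.pi * (Complex.Gamma ((a + 2) / 2))⁻¹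

theorem laplace_at_zero (ha : 0 < a.re) :
    (Complex.Gamma a)⁻¹ * laplace a (1 / 4) 0 =
      Real.sqrt Real.pi * (Complex.Gamma ((a + 1) / 2))⁻¹ := by
  have h1 : laplace a (1 / 4) 0 = 2⁻¹ * ((2 : ℂ) ^ a * Complex.Gamma (a / 2)) := by
    have h2 := mellin_comp_rpow (fun t : ℝ => Complex.exp (-((1 / 4 : ℝ) * t))) a 2
    have h3 : mellin (fun t : ℝ => Complex.exp (-((1 / 4 : ℝ) * t))) (a / (2 : ℝ)) =
        (2 : ℂ) ^ a * Complex.Gamma (a / 2) := by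
      have := Complex.integral_cpow_mul_exp_neg_mul_Ioi (a := a / 2) (r := 1 / 4)
        (by simpa using ha) (by norm_num)
      simp only [mellin, smul_eq_mul]
      rw [show ((2 : ℝ) : ℂ) = 2 by norm_num, this]
      congr 1
      rw [show (1 / ((1 / 4 : ℝ) : ℂ)) = ((2 : ℝ) : ℂ) * ((2 : ℝ) : ℂ) by push_cast; norm_num,
        Complex.mul_cpow_ofReal_nonneg zero_le_two zero_le_two,
        ← Complex.cpow_add _ _ (by norm_num), add_halves]
      norm_num
    have h4 : laplace a (1 / 4) 0 =
        mellin (fun t : ℝ => Complex.exp (-((1 / 4 : ℝ) * (t ^ (2 : ℝ) : ℝ)))) a := by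
      simp only [laplace, mellin, smul_eq_mul]
      congr 1
      funext t
      rw [Real.rpow_two]
      push_cast
      rw [zero_mul, add_zero]
    rw [h4, h2, h3, Complex.real_smul, abs_two]
    push_cast
    ring
  have hd := Complex.Gamma_mul_Gamma_add_half (a / 2)
  rw [mul_div_cancel₀ _ (two_ne_zero' ℂ), ← add_div] at hd
  have hΓ : Complex.Gamma a ≠ 0 := Complex.Gamma_ne_zero_of_re_pos ha
  have hΓ' : Complex.Gamma ((a + 1) / 2) ≠ 0 :=
    Complex.Gamma_ne_zero_of_re_pos (by simp; linarith)
  have h2 : (2 : ℂ) ^ a * (2 : ℂ) ^ (1 - a) = 2 := by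
    rw [← Complex.cpow_add _ _ two_ne_zero, add_sub_cancel, Complex.cpow_one]
  rw [h1]
  field_simp
  linear_combination (2 : ℂ) ^ a * hd + Complex.Gamma a * Real.sqrt Real.pi * h2

theorem isHermite_laplace (ha : 0 < a.re) :
    IsHermite a (fun x => (Complex.Gamma a)⁻¹ * laplace a (1 / 4) x)
      (fun x => (Complex.Gamma (a + 1))⁻¹ * laplace (a + 1) (1 / 4) x) := by
  have ha1 : 0 < (a + 1).re := by simp; linarith
  have ha0 : a ≠ 0 := fun h => by simp [h] at ha
  have ha10 : a + 1 ≠ 0 := fun h => by simp [h] at ha1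
  have hΓ : Complex.Gamma a ≠ 0 := Complex.Gamma_ne_zero_of_re_pos ha
  have hd : ∀ {b : ℂ}, 0 < b.re → ∀ x,
      HasDerivAt (laplace b (1 / 4)) (-laplace (b + 1) (1 / 4) x) x := fun {b} hb x => by
    have := hasDerivAt_laplace_of_differentiable (a := b) (A := fun _ => 1 / 4) (A' := fun _ => 0)
      (B := fun z => z) (B' := fun _ => 1) (z₀ := x) hb (fun z => hasDerivAt_const z _)
      (fun z => hasDerivAt_id z) (by fun_prop) (by fun_prop) (Or.inl (by norm_num))
    simpa using this
  have hrec : ∀ x, a * laplace a (1 / 4) x =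
      1 / 2 * laplace (a + 2) (1 / 4) x + x * laplace (a + 1) (1 / 4) x := fun x => by
    have := laplace_recurrence (B := x) one_pos ha
      (growing_of_re_pos (ε := 1 / 4) (A := 1 / 4) (by norm_num) (by norm_num)
        (neg_abs_le x.re))
    rw [this]
    ring
  have e1 : Complex.Gamma (a + 1) = a * Complex.Gamma a := Complex.Gamma_add_one _ ha0
  refine ⟨fun x => ?_, fun x => ?_, ?_, ?_, laplace_at_zero ha, ?_⟩
  · refine ((hd ha x).const_mul _).congr_deriv ?_
    rw [e1]
    field_simp
  · refine ((hd ha1 x).const_mul _).congr_deriv ?_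
    have := hrec x
    rw [show a + 1 + 1 = a + 2 by ring, e1]
    field_simp
    linear_combination 2 * this
  · simpa [hΓ] using (isAsymp_laplace ha).const_mul (Complex.Gamma a)⁻¹
  · have := (isAsymp_laplace ha1).const_mul (Complex.Gamma (a + 1))⁻¹
    rwa [inv_mul_cancel₀ (Complex.Gamma_ne_zero_of_re_pos ha1)] at this
  · rw [laplace_at_zero ha1, show a + 1 + 1 = a + 2 by ring]

/-- The recurrence `H_a = x H_{a+1} + (a + 1)/2 H_{a+2}` continues the functions to the left. -/
theorem IsHermite.pred {h₁ h₂ : ℂ → ℂ} (h : IsHermite (a + 1) h₁ h₂) :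
    IsHermite a (fun x => x * h₁ x + (a + 1) / 2 * h₂ x) h₁ := by
  refine ⟨fun x => ?_, fun x => ?_, ?_, h.isAsymp_fst, ?_, ?_⟩
  · refine (((hasDerivAt_id x).mul (h.hasDerivAt_fst x)).add
      ((h.hasDerivAt_snd x).const_mul ((a + 1) / 2))).congr_deriv ?_
    simp only [id]
    ring
  · refine (h.hasDerivAt_fst x).congr_deriv ?_
    ring
  · have h1 := (IsAsymp.of_powExp (θ₁ := -(3 * Real.pi / 4)) (θ₂ := 3 * Real.pi / 4) 1 1 0).mul
      h.isAsymp_fst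
    have h2 := h1.add_of_small (h.isAsymp_snd.const_mul ((a + 1) / 2)) (by simp)
      (by
        rw [show -(a + 1 + 1) - (1 + -(a + 1)) = -2 by ring, add_zero, sub_zero]
        exact small_powExp_zero _ (by simp))
    rw [one_mul, show 1 + -(a + 1) = -a by ring, add_zero] at h2
    exact h2.congr (Eventually.of_forall fun ζ => by simp [powExp])
  · have := Complex.one_div_Gamma_eq_self_mul_one_div_Gamma_add_one ((a + 1) / 2)
    rw [show (a + 1) / 2 + 1 = (a + 1 + 2) / 2 by ring] at this
    rw [h.zero_snd, this]
    ring
  · rw [h.zero_fst, show a + 1 + 1 = a + 2 by ring]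

/-- The Laplace integral gives the functions for `Re a > 0`, and the recurrence lowers `a`. -/
theorem exists_isHermite (a : ℂ) : ∃ h₀ h₁, IsHermite a h₀ h₁ := by
  have key : ∀ (N : ℕ) (a : ℂ), 0 < a.re + N → ∃ h₀ h₁, IsHermite a h₀ h₁ := by
    intro N
    induction N with
    | zero => exact fun a ha => ⟨_, _, isHermite_laplace (by simpa using ha)⟩
    | succ N ih =>
      intro a ha
      obtain ⟨h₀, h₁, h⟩ := ih (a + 1) (by
        push_cast at ha
        simp only [Complex.add_re, Complex.one_re]
        linarith)
      exact ⟨_, _, h.pred⟩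
  obtain ⟨N, hN⟩ := exists_nat_gt (-a.re)
  exact key N a (by linarith)

end

end Laplace

/-! ### Weber functions and their connection formulas -/

variable {a : ℂ}

theorem IsWeber.of_hasDerivAt {w w' w'' : ℂ → ℂ} (h : ∀ x, HasDerivAt w (w' x) x)
    (h' : ∀ x, HasDerivAt w' (w'' x) x) (he : ∀ x, w'' x + 2 * x * w' x + 2 * a * w x = 0) :
    IsWeber a w := by
  have e : deriv w = w' := funext fun x => (h x).deriv
  exact ⟨fun x => (h x).differentiableAt, fun x => by rw [e, (h' x).deriv, he]⟩

theorem IsWeber.comb {w v : ℂ → ℂ} (hw : IsWeber a w) (hv : IsWeber a v) (c d : ℂ) :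
    IsWeber a (fun x => c * w x + d * v x) := by
  refine .of_hasDerivAt
    (fun x => ((hw.differentiable x).hasDerivAt.const_mul c).add
      ((hv.differentiable x).hasDerivAt.const_mul d))
    (fun x => ((hw.differentiable.deriv x).hasDerivAt.const_mul c).add
      ((hv.differentiable.deriv x).hasDerivAt.const_mul d)) fun x => ?_
  linear_combination c * hw.eq x + d * hv.eq x

/-- By Liouville's formula, the Wronskian of two solutions is a multiple of `exp (-x²)`. -/
theorem IsWeber.wronskian {w v : ℂ → ℂ} (hw : IsWeber a w) (hv : IsWeber a v) (x : ℂ) :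
    w x * deriv v x - deriv w x * v x =
      (w 0 * deriv v 0 - deriv w 0 * v 0) * Complex.exp (-x ^ 2) := by
  have hd : ∀ x, HasDerivAt (fun x => (w x * deriv v x - deriv w x * v x) * Complex.exp (x ^ 2))
      0 x := fun x => by
    have d1 := (hw.differentiable x).hasDerivAt
    have d2 := (hv.differentiable x).hasDerivAt
    have d3 := (hw.differentiable.deriv x).hasDerivAt
    have d4 := (hv.differentiable.deriv x).hasDerivAt
    have d5 : HasDerivAt (fun x : ℂ => Complex.exp (x ^ 2)) (Complex.exp (x ^ 2) * (2 * x)) x := by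
      simpa using (hasDerivAt_pow 2 x).cexp
    refine (((d1.mul d4).sub (d3.mul d2)).mul d5).congr_deriv ?_
    simp only [Pi.sub_apply, Pi.mul_apply]
    linear_combination Complex.exp (x ^ 2) * (w x * hv.eq x - v x * hw.eq x)
  have hc := is_const_of_deriv_eq_zero (fun x => (hd x).differentiableAt)
    (fun x => (hd x).deriv) x 0
  simp only [ne_eq, OfNat.ofNat_ne_zero, not_false_eq_true, zero_pow, Complex.exp_zero,
    mul_one] at hc
  rw [← hc, mul_assoc, ← Complex.exp_add, add_neg_cancel, Complex.exp_zero, mul_one]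

namespace IsHermite

variable {h₀ h₁ : ℂ → ℂ}

theorem hasDerivAt_comp_mul (h : IsHermite a h₀ h₁) (c x : ℂ) :
    HasDerivAt (fun x => h₀ (c * x)) (-a * h₁ (c * x) * c) x := by
  exact (HasDerivAt.comp x (h.hasDerivAt_fst (c * x)) ((hasDerivAt_id x).const_mul c)).congr_deriv
    (by rw [mul_one])

theorem hasDerivAt_comp_mul_snd (h : IsHermite a h₀ h₁) (c x : ℂ) :
    HasDerivAt (fun x => h₁ (c * x)) ((2 * (c * x) * h₁ (c * x) - 2 * h₀ (c * x)) * c) x := by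
  exact (HasDerivAt.comp x (h.hasDerivAt_snd (c * x)) ((hasDerivAt_id x).const_mul c)).congr_deriv
    (by rw [mul_one])

theorem isWeber (h : IsHermite a h₀ h₁) {c : ℂ} (hc : c ^ 2 = -1) :
    IsWeber a (fun x => h₀ (c * x)) := by
  refine .of_hasDerivAt (fun x => h.hasDerivAt_comp_mul c x)
    (fun x => ((h.hasDerivAt_comp_mul_snd c x).const_mul (-a)).mul_const c) fun x => ?_
  linear_combination -2 * a * (c * x * h₁ (c * x) - h₀ (c * x)) * hc

theorem hasDerivAt_exp_mul (h : IsHermite (1 - a) h₀ h₁) (c x : ℂ) :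
    HasDerivAt (fun x => Complex.exp (-x ^ 2) * h₀ (c * x))
      (Complex.exp (-x ^ 2) * ((a - 1) * c * h₁ (c * x) - 2 * x * h₀ (c * x))) x := by
  have d5 : HasDerivAt (fun x : ℂ => Complex.exp (-x ^ 2)) (Complex.exp (-x ^ 2) * (-(2 * x))) x :=
    by simpa using (hasDerivAt_pow 2 x).neg.cexp
  refine (d5.mul (h.hasDerivAt_comp_mul c x)).congr_deriv ?_
  ring

theorem isWeber_exp (h : IsHermite (1 - a) h₀ h₁) {c : ℂ} (hc : c ^ 2 = 1) :
    IsWeber a (fun x => Complex.exp (-x ^ 2) * h₀ (c * x)) := by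
  have d5 : ∀ x, HasDerivAt (fun x : ℂ => Complex.exp (-x ^ 2))
      (Complex.exp (-x ^ 2) * (-(2 * x))) x := fun x => by
    simpa using (hasDerivAt_pow 2 x).neg.cexp
  refine .of_hasDerivAt (fun x => h.hasDerivAt_exp_mul c x) (fun x => (d5 x).mul
    (((h.hasDerivAt_comp_mul_snd c x).const_mul ((a - 1) * c)).sub
      (((hasDerivAt_id x).const_mul 2).mul (h.hasDerivAt_comp_mul c x)))) fun x => ?_
  simp only [id]
  linear_combination Complex.exp (-x ^ 2) * (a - 1) *
    (2 * c * x * h₁ (c * x) - 2 * h₀ (c * x)) * hc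

end IsHermite

theorem inv_Gamma_mul_inv_Gamma_one_sub (z : ℂ) :
    (Complex.Gamma z)⁻¹ * (Complex.Gamma (1 - z))⁻¹ = Complex.sin (Real.pi * z) / Real.pi := by
  rw [← mul_inv, Complex.Gamma_mul_Gamma_one_sub, inv_div]

section connection

variable {h₀ h₁ k₀ k₁ : ℂ → ℂ}

theorem sqrt_pi_sq : (Real.sqrt Real.pi : ℂ) ^ 2 = Real.pi := by
  rw [← Complex.ofReal_pow, Real.sq_sqrt Real.pi_pos.le]

/-- The Wronskian of the two solutions that are recessive on the rays `arg x = ±π/2`, from the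
values at `x = 0` and the duplication formula. -/
theorem wronskian_up_down (h : IsHermite a h₀ h₁) (ha : Complex.Gamma a ≠ 0) (ha0 : a ≠ 0) (x : ℂ) :
    h₀ (-Complex.I * x) * deriv (fun x => h₀ (Complex.I * x)) x -
      deriv (fun x => h₀ (-Complex.I * x)) x * h₀ (Complex.I * x) =
      -(2 * iSqrtPi * ((2 : ℂ) ^ a / Complex.Gamma a)) * Complex.exp (-x ^ 2) := by
  have hw := (h.isWeber (c := -Complex.I) (by simp)).wronskian
    (h.isWeber (c := Complex.I) (by simp)) x
  rw [hw, (h.hasDerivAt_comp_mul _ _).deriv, (h.hasDerivAt_comp_mul _ _).deriv, mul_zero, mul_zero,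
    h.zero_fst, h.zero_snd]
  congr 1
  have hd := Complex.Gamma_mul_Gamma_add_half ((a + 1) / 2)
  rw [show (a + 1) / 2 + 1 / 2 = (a + 2) / 2 by ring,
    mul_div_cancel₀ _ (two_ne_zero' ℂ), Complex.Gamma_add_one _ ha0,
    show 1 - (a + 1) = -a by ring, Complex.cpow_neg] at hd
  have h2 : (2 : ℂ) ^ a ≠ 0 := by simp [Complex.cpow_eq_zero_iff]
  have hπ : (Real.sqrt Real.pi : ℂ) ≠ 0 := by
    exact_mod_cast (Real.sqrt_pos.2 Real.pi_pos).ne'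
  have hi : (Complex.Gamma ((a + 1) / 2))⁻¹ * (Complex.Gamma ((a + 2) / 2))⁻¹ =
      (a * Complex.Gamma a * ((2 : ℂ) ^ a)⁻¹ * Real.sqrt Real.pi)⁻¹ := by
    rw [← mul_inv, hd]
  have hi' : (Real.sqrt Real.pi : ℂ) * a *
      ((Complex.Gamma ((a + 1) / 2))⁻¹ * (Complex.Gamma ((a + 2) / 2))⁻¹) =
      (2 : ℂ) ^ a / Complex.Gamma a := by
    rw [hi]
    field_simp
  rw [iSqrtPi, ← hi']
  ring

/-- The Wronskian with the solution that is recessive on the positive real axis, from the values at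
`x = 0` and the reflection formula; `c = ±i` selects the other solution. -/
theorem wronskian_right (h : IsHermite a h₀ h₁) (k : IsHermite (1 - a) k₀ k₁) {c : ℂ}
    (hc : c ^ 2 = -1) (x : ℂ) :
    h₀ (c * x) * deriv (fun x => Complex.exp (-x ^ 2) * k₀ (1 * x)) x -
      deriv (fun x => h₀ (c * x)) x * (Complex.exp (-x ^ 2) * k₀ (1 * x)) =
      -2 * (Complex.cos (Real.pi * a / 2) - c * Complex.sin (Real.pi * a / 2)) *
        Complex.exp (-x ^ 2) := by
  have hw := (h.isWeber hc).wronskian (k.isWeber_exp (c := 1) (by simp)) x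
  rw [hw, (h.hasDerivAt_comp_mul _ _).deriv, (k.hasDerivAt_exp_mul _ _).deriv, mul_zero, mul_zero,
    h.zero_fst, h.zero_snd, k.zero_fst, k.zero_snd]
  congr 1
  have hπ : (Real.pi : ℂ) ≠ 0 := by exact_mod_cast Real.pi_ne_zero
  have r1 := inv_Gamma_mul_inv_Gamma_one_sub ((a + 1) / 2)
  have r2 := inv_Gamma_mul_inv_Gamma_one_sub (a / 2)
  have g1 := Complex.one_div_Gamma_eq_self_mul_one_div_Gamma_add_one ((1 - a) / 2)
  have g2 := Complex.one_div_Gamma_eq_self_mul_one_div_Gamma_add_one (a / 2)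
  rw [show 1 - (a + 1) / 2 = (1 - a) / 2 by ring, g1,
    show (Real.pi : ℂ) * ((a + 1) / 2) = Real.pi * a / 2 + Real.pi / 2 by ring,
    Complex.sin_add_pi_div_two, show (1 - a) / 2 + 1 = (1 - a + 2) / 2 by ring,
    eq_div_iff hπ] at r1
  rw [g2, show a / 2 + 1 = (a + 2) / 2 by ring, show 1 - a / 2 = (1 - a + 1) / 2 by ring,
    show (Real.pi : ℂ) * (a / 2) = Real.pi * a / 2 by ring, eq_div_iff hπ] at r2
  rw [← r1, ← r2, ← sqrt_pi_sq]
  simp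
  ring

/-- The factor `exp (iπa/2)` relating the branches of `x^{-a}` in neighbouring quadrants. -/
noncomputable def quarterPhase (a : ℂ) : ℂ := Complex.exp (Complex.I * Real.pi * a / 2)

theorem quarterPhase_ne_zero (a : ℂ) : quarterPhase a ≠ 0 := Complex.exp_ne_zero _

theorem quarterPhase_eq (a : ℂ) : quarterPhase a =
    Complex.cos (Real.pi * a / 2) + Complex.I * Complex.sin (Real.pi * a / 2) := by
  rw [quarterPhase, show Complex.I * Real.pi * a / 2 = Real.pi * a / 2 * Complex.I by ring,
    Complex.exp_mul_I]
  ring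

theorem inv_quarterPhase_eq (a : ℂ) : (quarterPhase a)⁻¹ =
    Complex.cos (Real.pi * a / 2) - Complex.I * Complex.sin (Real.pi * a / 2) := by
  rw [quarterPhase, ← Complex.exp_neg,
    show -(Complex.I * Real.pi * a / 2) = -(Real.pi * a / 2) * Complex.I by ring,
    Complex.exp_mul_I, Complex.cos_neg, Complex.sin_neg]
  ring

/-- The linear relation between the three solutions recessive on the rays `arg x = π/2`, `-π/2`
and `0`: its coefficients are the Wronskians of the other two. -/
theorem connection_formula (h : IsHermite a h₀ h₁) (k : IsHermite (1 - a) k₀ k₁)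
    (ha : Complex.Gamma a ≠ 0) (ha0 : a ≠ 0) (x : ℂ) :
    (quarterPhase a)⁻¹ * h₀ (-Complex.I * x) = quarterPhase a * h₀ (Complex.I * x) -
      iSqrtPi * ((2 : ℂ) ^ a / Complex.Gamma a) * (Complex.exp (-x ^ 2) * k₀ (1 * x)) := by
  have w1 := wronskian_up_down h ha ha0 x
  have w2 := wronskian_right h k (c := -Complex.I) (by simp) x
  have w3 := wronskian_right h k (c := Complex.I) (by simp) x
  rw [← inv_quarterPhase_eq] at w3
  rw [show Complex.cos (Real.pi * a / 2) - -Complex.I * Complex.sin (Real.pi * a / 2) =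
    quarterPhase a by rw [quarterPhase_eq]; ring] at w2
  simp only [neg_mul] at w1 w2 ⊢
  apply mul_right_cancel₀ (Complex.exp_ne_zero (-x ^ 2))
  linear_combination (1 / 2) * (Complex.exp (-x ^ 2) * k₀ (1 * x)) * w1 +
    (1 / 2) * h₀ (Complex.I * x) * (-w2) + (1 / 2) * h₀ (-(Complex.I * x)) * w3

end connection

/-! ### Rotation of sectors -/

theorem strip_shift {P : ℂ → Prop} {δ ψ : ℝ} (h : ∀ᶠ ζ in strip θ₁ θ₂ δ, P ζ) :
    ∀ᶠ ζ in strip (θ₁ - ψ) (θ₂ - ψ) δ, P (ζ + ψ * Complex.I) := by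
  obtain ⟨L, hL⟩ := eventually_strip.1 h
  refine eventually_strip.2 ⟨L, fun ζ h1 h2 h3 => hL _ ?_ ?_ ?_⟩ <;> simp <;> linarith

theorem sector_shift {P : ℂ → Prop} {ψ : ℝ} (h : ∀ᶠ ζ in sector θ₁ θ₂, P ζ) :
    ∀ᶠ ζ in sector (θ₁ - ψ) (θ₂ - ψ), P (ζ + ψ * Complex.I) :=
  eventually_sector.2 fun δ hδ => strip_shift (eventually_sector.1 h δ hδ)

theorem Small.shift {g : ℂ → ℂ} (hg : Small θ₁ θ₂ g) (ψ : ℝ) :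
    Small (θ₁ - ψ) (θ₂ - ψ) (fun ζ => g (ζ + ψ * Complex.I)) := by
  refine ⟨?_, fun δ hδ => ?_⟩
  · filter_upwards [sector_shift (ψ := ψ) hg.1] with ζ h
    exact AnalyticAt.fun_comp (g := g) h (by fun_prop)
  · obtain ⟨C, hC⟩ := (hg.2 δ hδ).bound
    refine IsBigO.of_bound C ?_
    filter_upwards [strip_shift (ψ := ψ) hC] with ζ h
    simpa using h

theorem IsAsymp.shift {F : ℂ → ℂ} {K q : ℂ} (hF : IsAsymp θ₁ θ₂ F K q 0) (ψ : ℝ) :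
    IsAsymp (θ₁ - ψ) (θ₂ - ψ) (fun ζ => F (ζ + ψ * Complex.I))
      (K * Complex.exp (q * (ψ * Complex.I))) q 0 := by
  obtain ⟨g, hg, h⟩ := hF
  refine ⟨_, hg.shift ψ, ?_⟩
  filter_upwards [sector_shift (ψ := ψ) h] with ζ h
  rw [h]
  simp only [powExp, zero_mul, add_zero]
  rw [show q * (ζ + ψ * Complex.I) = q * ζ + q * (ψ * Complex.I) by ring, Complex.exp_add]
  ring

theorem IsHermite.isAsymp_rotate {h₀ h₁ : ℂ → ℂ} (h : IsHermite a h₀ h₁) (ψ : ℝ) {c : ℂ}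
    (hc : Complex.exp (ψ * Complex.I) = c) :
    IsAsymp (-(3 * Real.pi / 4) - ψ) (3 * Real.pi / 4 - ψ)
      (fun ζ => h₀ (c * Complex.exp ζ)) (Complex.exp (-a * (ψ * Complex.I))) (-a) 0 := by
  have := h.isAsymp_fst.shift ψ
  rw [one_mul] at this
  refine this.congr (Eventually.of_forall fun ζ => ?_)
  rw [Complex.exp_add, hc, mul_comm]

theorem IsHermite.isAsymp_exp_rotate {h₀ h₁ : ℂ → ℂ} (h : IsHermite (1 - a) h₀ h₁) (ψ : ℝ) {c : ℂ}
    (hc : Complex.exp (ψ * Complex.I) = c) :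
    IsAsymp (-(3 * Real.pi / 4) - ψ) (3 * Real.pi / 4 - ψ)
      (fun ζ => Complex.exp (-Complex.exp ζ ^ 2) * h₀ (c * Complex.exp ζ))
      (Complex.exp (-(1 - a) * (ψ * Complex.I))) (a - 1) (-1) := by
  have := (IsAsymp.of_powExp 1 0 (-1)).mul (h.isAsymp_rotate ψ hc)
  rw [one_mul, zero_add, add_zero, neg_sub] at this
  rw [neg_sub]
  refine this.congr (Eventually.of_forall fun ζ => ?_)
  rw [powExp, ← Complex.exp_nat_mul]
  simp

/-- In the sector of opening `π/2` about a ray where `s x²` is negative, `exp (s x²)` is smaller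
than any power. -/
theorem small_powExp_of_ray (θ₀ : ℝ) {s : ℂ} (hs : s = -Complex.exp (-(2 * θ₀ : ℝ) * Complex.I))
    (K q : ℂ) : Small (θ₀ - Real.pi / 4) (θ₀ + Real.pi / 4) (powExp K q s) := by
  refine small_powExp_of_neg K q s fun δ hδ =>
    ⟨Real.sin (2 * min δ (Real.pi / 4)), ?_, fun ζ h1 h2 => ?_⟩
  · have hπ := Real.pi_pos
    have : 0 < min δ (Real.pi / 4) := lt_min hδ (by positivity)
    exact Real.sin_pos_of_pos_of_lt_pi (by linarith)
      (by linarith [min_le_right δ (Real.pi / 4)])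
  · have hδ' : δ ≤ Real.pi / 4 := by linarith
    have hπ := Real.pi_pos
    rw [min_eq_left hδ', hs, show ∀ u v : ℂ, -u * v = -(u * v) from neg_mul, ← Complex.exp_add,
      Complex.neg_re, Complex.exp_re]
    have e1 : (-((2 * θ₀ : ℝ) : ℂ) * Complex.I + 2 * ζ).re = 2 * ζ.re := by simp
    have e2 : (-((2 * θ₀ : ℝ) : ℂ) * Complex.I + 2 * ζ).im = 2 * (ζ.im - θ₀) := by
      simp
      ring
    have key : Real.sin (2 * δ) ≤ Real.cos (2 * (ζ.im - θ₀)) := by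
      rw [← Real.cos_pi_div_two_sub, ← Real.cos_abs (2 * (ζ.im - θ₀))]
      refine Real.cos_le_cos_of_nonneg_of_le_pi (abs_nonneg _) (by linarith) ?_
      rw [abs_le]
      constructor <;> linarith
    rw [e1, e2]
    linarith [mul_le_mul_of_nonneg_left key (Real.exp_pos (2 * ζ.re)).le]

/-! ### Asymptotic relations in the variable `x` -/

theorem polar_eq_exp {r : ℝ} (hr : 0 < r) (θ : ℝ) :
    polar r θ = Complex.exp ((Real.log r : ℂ) + Complex.I * θ) := by
  rw [Complex.exp_add, ← Complex.ofReal_exp, Real.exp_log hr, polar]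

theorem expTerm_eq_powExp {r : ℝ} (hr : 0 < r) (p s : ℂ) (θ : ℝ) (K : ℂ) :
    K * expTerm p s r θ = powExp K p s ((Real.log r : ℂ) + Complex.I * θ) := by
  rw [expTerm, polar_eq_exp hr, ← Complex.exp_nat_mul, ← Complex.exp_add, powExp]
  push_cast
  rfl

theorem IsAsymp.exists_bound {F : ℂ → ℂ} {K q s : ℂ} (hF : IsAsymp θ₁ θ₂ F K q s) {δ : ℝ}
    (hδ : 0 < δ) : ∃ C R : ℝ, 0 ≤ C ∧ 0 < R ∧ ∀ r θ : ℝ, R ≤ r → θ₁ + δ ≤ θ → θ ≤ θ₂ - δ →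
      ‖F ((Real.log r : ℂ) + Complex.I * θ) - powExp K q s ((Real.log r : ℂ) + Complex.I * θ)‖ ≤
        C * r⁻¹ ^ 2 * ‖powExp K q s ((Real.log r : ℂ) + Complex.I * θ)‖ := by
  obtain ⟨g, hg, h⟩ := hF
  obtain ⟨C, hC⟩ := (hg.2 δ hδ).bound
  obtain ⟨L, hL⟩ := eventually_strip.1 (hC.and (eventually_sector.1 h δ hδ))
  refine ⟨|C|, Real.exp L, abs_nonneg C, Real.exp_pos L, fun r θ hr h1 h2 => ?_⟩
  have hr0 : 0 < r := (Real.exp_pos L).trans_le hr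
  have hre : ((Real.log r : ℂ) + Complex.I * θ).re = Real.log r := by simp
  have him : ((Real.log r : ℂ) + Complex.I * θ).im = θ := by simp
  obtain ⟨h3, h4⟩ := hL ((Real.log r : ℂ) + Complex.I * θ)
    (by rw [hre]; exact (Real.le_log_iff_exp_le hr0).2 hr) (by rwa [him]) (by rwa [him])
  have he : Real.exp (-2 * Real.log r) = r⁻¹ ^ 2 := by
    rw [show -2 * Real.log r = ((2 : ℕ) : ℝ) * Real.log r⁻¹ by rw [Real.log_inv]; push_cast; ring,
      Real.exp_nat_mul, Real.exp_log (inv_pos.2 hr0)]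
  rw [hre, he, Real.norm_of_nonneg (by positivity)] at h3
  rw [h4, mul_one_add, add_sub_cancel_left, norm_mul, mul_comm]
  exact mul_le_mul_of_nonneg_right
    (h3.trans (mul_le_mul_of_nonneg_right (le_abs_self C) (by positivity))) (norm_nonneg _)

theorem IsAsymp.hasLeading {y : ℂ → ℂ} {A : ℂ}
    (h : IsAsymp θ₁ θ₂ (fun ζ => y (Complex.exp ζ)) A (-1) 0) : HasLeading y A θ₁ θ₂ := by
  intro δ hδ
  obtain ⟨C, R, -, hR, hb⟩ := h.exists_bound hδ
  refine ⟨C, R, hR, fun r θ hr h1 h2 => ?_⟩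
  have hr0 : 0 < r := hR.trans_le hr
  have e : ∀ ζ, powExp A (-1) 0 ζ = A / Complex.exp ζ := fun ζ => by
    simp [powExp, Complex.exp_neg, div_eq_mul_inv]
  have := hb r θ hr h1 h2
  rwa [e, ← polar_eq_exp hr0] at this

/-- On the Stokes ray the difference to the half-sum of the backgrounds is the half-sum of the
differences, whence the value `1/2` of the step function there. -/
theorem hasExpansion_of_isAsymp {y Bm Bp : ℂ → ℂ} {A p s μm μp : ℂ} {μ : ℝ → ℂ} {θ₀ : ℝ}
    (hy : IsAsymp (θ₀ - Real.pi / 4) (θ₀ + Real.pi / 4) (fun ζ => y (Complex.exp ζ)) A (-1) 0)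
    (hm : IsAsymp (θ₀ - Real.pi / 4) (θ₀ + Real.pi / 4)
      (fun ζ => y (Complex.exp ζ) - Bm (Complex.exp ζ)) μm p s)
    (hp : IsAsymp (θ₀ - Real.pi / 4) (θ₀ + Real.pi / 4)
      (fun ζ => y (Complex.exp ζ) - Bp (Complex.exp ζ)) μp p s)
    (hμ : ∀ θ, μ θ = μm + (μp - μm) * step (θ - θ₀)) : HasExpansion y Bm Bp A μ p s θ₀ := by
  refine ⟨hy.hasLeading, fun δ hδ => ?_⟩
  obtain ⟨C, R, hC, hR, hb⟩ := hm.exists_bound hδ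
  obtain ⟨C', R', hC', hR', hb'⟩ := hp.exists_bound hδ
  refine ⟨C + C' + C * ‖μm‖ + C' * ‖μp‖, max R R', lt_max_of_lt_left hR,
    fun r θ hr h1 h2 => ?_⟩
  have hr0 : 0 < r := hR.trans_le ((le_max_left _ _).trans hr)
  have b := hb r θ ((le_max_left _ _).trans hr) h1 h2
  have b' := hb' r θ ((le_max_right _ _).trans hr) h1 h2
  rw [← expTerm_eq_powExp hr0, ← polar_eq_exp hr0] at b b'
  have n1 := mul_nonneg hC (norm_nonneg μm)
  have n2 := mul_nonneg hC' (norm_nonneg μp)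
  refine ⟨fun hθ => ?_, fun hθ => ?_, fun hθ => ?_⟩
  · have e : μ θ = μm := by rw [hμ, step, if_pos (by linarith), mul_zero, add_zero]
    rw [e]
    refine b.trans ?_
    gcongr
    linarith
  · have e : μ θ = μp := by
      rw [hμ, step, if_neg (by linarith), if_neg (by linarith), mul_one, add_sub_cancel]
    rw [e]
    refine b'.trans ?_
    gcongr
    linarith
  · have e : μ θ = (μm + μp) / 2 := by
      rw [hμ, step, if_neg (by linarith), if_pos (by linarith)]
      ring
    rw [e]
    have e2 : y (polar r θ) - (Bm (polar r θ) + Bp (polar r θ)) / 2 -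
        (μm + μp) / 2 * expTerm p s r θ =
        (1 / 2) * (y (polar r θ) - Bm (polar r θ) - μm * expTerm p s r θ) +
        (1 / 2) * (y (polar r θ) - Bp (polar r θ) - μp * expTerm p s r θ) := by ring
    rw [e2]
    refine (norm_add_le _ _).trans ?_
    rw [norm_mul, norm_mul, show ‖(1 / 2 : ℂ)‖ = 1 / 2 by norm_num]
    rw [norm_mul] at b b'
    have n3 : 0 ≤ r⁻¹ ^ 2 * ‖expTerm p s r θ‖ := by positivity
    nlinarith [mul_nonneg hC n3, mul_nonneg hC' n3, mul_nonneg n1 n3, mul_nonneg n2 n3]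

/-! ### Solutions of the fourth Painlevé equation generated by Weber functions -/

theorem chain_const_mul (w : ℂ → ℂ) {c : ℂ} (hc : c ≠ 0) (k : ℕ) :
    chain (fun x => c * w x) k = chain w k := by
  have key : ∀ k, chain (fun x => c * w x) k = chain w k ∧
      chain (fun x => c * w x) (k + 1) = chain w (k + 1) := by
    intro k
    induction k with
    | zero => exact ⟨rfl, funext fun x => logDeriv_const_mul x c hc⟩
    | succ k ih => exact ⟨ih.2, by simp only [chain]; rw [ih.1, ih.2]⟩
  exact (key k).1

theorem chainNF_eq_of_eq_mul {w v : ℂ → ℂ} {c : ℂ} (hc : c ≠ 0) (h : ∀ x, w x = c * v x) (k : ℕ) :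
    chainNF w k = chainNF v k := by
  rw [show w = fun x => c * v x from funext h, chainNF, chain_const_mul v hc, chainNF]

theorem IsWeber.eventually_chainNF_eq {w : ℂ → ℂ} (hw : IsWeber a w) {k : ℕ} {K q s : ℂ}
    (h : IsAsymp θ₁ θ₂ (fun ζ => chain w k (Complex.exp ζ)) K q s) :
    ∀ᶠ ζ in sector θ₁ θ₂, chainNF w k (Complex.exp ζ) = chain w k (Complex.exp ζ) :=
  h.analyticAt.mono fun _ h => chainNF_eq hw (analyticAt_of_comp_exp h)

theorem isAsymp_chainNF_of_pow {w : ℂ → ℂ} {K : ℂ} (hw : IsWeber a w) (hK : K ≠ 0)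
    (h : IsAsymp θ₁ θ₂ (fun ζ => w (Complex.exp ζ)) K (-a) 0)
    (ha : ∀ m : ℕ, a + m ≠ 0) (j : ℕ) :
    IsAsymp θ₁ θ₂ (fun ζ => chainNF w (2 * j + 2) (Complex.exp ζ)) (-((j : ℂ) + 1)) (-1) 0 :=
  have h2 := (chain_leading_of_pow h hK ha j).2
  h2.congr (hw.eventually_chainNF_eq h2)

theorem isAsymp_chainNF_of_exp {w : ℂ → ℂ} {K q : ℂ} (hw : IsWeber a w) (hK : K ≠ 0)
    (h : IsAsymp θ₁ θ₂ (fun ζ => w (Complex.exp ζ)) K q (-1)) (j : ℕ) :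
    IsAsymp θ₁ θ₂ (fun ζ => chainNF w (2 * j + 2) (Complex.exp ζ)) ((j : ℂ) + 1) (-1) 0 :=
  have h2 := (chain_leading_of_exp h hK j).2
  h2.congr (hw.eventually_chainNF_eq h2)

/-! ### Pairs of Weber functions adapted to a sector -/

theorem neg_cast_add_one_ne_zero (j : ℕ) : -((j : ℂ) + 1) ≠ 0 :=
  neg_ne_zero.2 (Nat.cast_add_one_ne_zero j)

theorem chain_ne_zero_of_pow {w : ℂ → ℂ} {K : ℂ} (hw : IsWeber a w) (hK : K ≠ 0)
    (h : IsAsymp θ₁ θ₂ (fun ζ => w (Complex.exp ζ)) K (-a) 0) (ha : ∀ m : ℕ, a + m ≠ 0)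
    (hθ : θ₁ < θ₂) (k : ℕ) : ∀ᶠ x in codiscrete ℂ, chain w (k + 1) x ≠ 0 := by
  have hm := meromorphic_chain hw.meromorphic
  obtain ⟨j, rfl | rfl⟩ := Nat.even_or_odd' k
  · exact eventually_codiscrete_ne_zero (hm _) (chain_leading_of_pow h hK ha j).1
      (neg_ne_zero.2 (ha j)) hθ
  · exact eventually_codiscrete_ne_zero (hm _) (chain_leading_of_pow h hK ha j).2
      (neg_cast_add_one_ne_zero j) hθ

theorem chain_ne_zero_of_exp {w : ℂ → ℂ} {K q : ℂ} (hw : IsWeber a w) (hK : K ≠ 0)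
    (h : IsAsymp θ₁ θ₂ (fun ζ => w (Complex.exp ζ)) K q (-1)) (hθ : θ₁ < θ₂) (k : ℕ) :
    ∀ᶠ x in codiscrete ℂ, chain w (k + 1) x ≠ 0 := by
  have hm := meromorphic_chain hw.meromorphic
  obtain ⟨j, rfl | rfl⟩ := Nat.even_or_odd' k
  · exact eventually_codiscrete_ne_zero (hm _) (chain_leading_of_exp h hK j).1 (by norm_num) hθ
  · exact eventually_codiscrete_ne_zero (hm _) (chain_leading_of_exp h hK j).2
      (Nat.cast_add_one_ne_zero j) hθ

theorem solution_chainNF_even {w : ℂ → ℂ} (hw : IsWeber a w)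
    (hne : ∀ k, ∀ᶠ x in codiscrete ℂ, chain w (k + 1) x ≠ 0) (j : ℕ) :
    IsP4Solution (a - 1 / 2) (-2 * ((j + 1 : ℕ) : ℂ)) (chainNF w (2 * j + 2)) ∧
      IsClassical (a - 1 / 2) (-2 * ((j + 1 : ℕ) : ℂ)) (chainNF w (2 * j + 2)) := by
  have h1 := isP4Solution_chainNF hw hne (2 * j + 1)
  have h2 := isClassical_chainNF hw hne (2 * j + 1)
  rw [show 2 * j + 1 + 1 = 2 * (j + 1) by ring, chainParam_even,
    Odd.neg_one_pow (odd_two_mul_add_one j),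
    show (-1 : ℂ) * (1 / 2 - a) = a - 1 / 2 by ring] at h1 h2
  exact ⟨h1, h2⟩

/-- Two Weber functions `f ~ K x^{-a}` and `g ~ K' x^{a-1} exp (-x²)` in the sector of opening `π/2`
about the ray `arg x = θ₀`, with Wronskian `M exp (-x²)`. -/
structure IsSectorPair (a : ℂ) (θ₀ : ℝ) (f g : ℂ → ℂ) (K K' M : ℂ) : Prop where
  fst : IsWeber a f
  snd : IsWeber a g
  isAsymp_fst : IsAsymp (θ₀ - Real.pi / 4) (θ₀ + Real.pi / 4)
    (fun ζ => f (Complex.exp ζ)) K (-a) 0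
  isAsymp_snd : IsAsymp (θ₀ - Real.pi / 4) (θ₀ + Real.pi / 4)
    (fun ζ => g (Complex.exp ζ)) K' (a - 1) (-1)
  fst_ne_zero : K ≠ 0
  snd_ne_zero : K' ≠ 0
  wronskian : ∀ x, f x * deriv g x - deriv f x * g x = M * Complex.exp (-x ^ 2)
  wronskian_ne_zero : M ≠ 0

namespace IsSectorPair

variable {θ₀ : ℝ} {f g : ℂ → ℂ} {K K' M : ℂ}

theorem deriv_comb (h : IsSectorPair a θ₀ f g K K' M) (c d x : ℂ) :
    deriv (fun x => c * f x + d * g x) x = c * deriv f x + d * deriv g x :=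
  (((h.fst.differentiable x).hasDerivAt.const_mul c).add
    ((h.snd.differentiable x).hasDerivAt.const_mul d)).deriv

theorem isAsymp_add_mul (h : IsSectorPair a θ₀ f g K K' M)
    (hs : ∀ K q, Small (θ₀ - Real.pi / 4) (θ₀ + Real.pi / 4) (powExp K q (-1))) (t : ℂ) :
    IsAsymp (θ₀ - Real.pi / 4) (θ₀ + Real.pi / 4)
      (fun ζ => 1 * f (Complex.exp ζ) + t * g (Complex.exp ζ)) K (-a) 0 := by
  have h1 := h.isAsymp_fst.const_mul 1
  rw [one_mul] at h1
  refine h1.add_of_small (h.isAsymp_snd.const_mul t) h.fst_ne_zero ?_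
  rw [sub_zero]
  exact hs _ _

theorem isAsymp_mul_add (h : IsSectorPair a θ₀ f g K K' M)
    (hs : ∀ K q, Small (θ₀ - Real.pi / 4) (θ₀ + Real.pi / 4) (powExp K q 1)) (t : ℂ) :
    IsAsymp (θ₀ - Real.pi / 4) (θ₀ + Real.pi / 4)
      (fun ζ => t * f (Complex.exp ζ) + 1 * g (Complex.exp ζ)) K' (a - 1) (-1) := by
  have h1 := h.isAsymp_snd.const_mul 1
  rw [one_mul] at h1
  refine (h1.add_of_small (h.isAsymp_fst.const_mul t) h.snd_ne_zero ?_).congr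
    (Eventually.of_forall fun ζ => add_comm _ _)
  rw [zero_sub, neg_neg]
  exact hs _ _

/-- Where `f` dominates, the solutions generated by `f + t g` and `f + t' g` differ by a
recessive term with coefficient proportional to `t - t'`. -/
theorem isAsymp_chainNF_sub_of_pow (h : IsSectorPair a θ₀ f g K K' M) (ha : ∀ m : ℕ, a + m ≠ 0)
    (hs : ∀ K q, Small (θ₀ - Real.pi / 4) (θ₀ + Real.pi / 4) (powExp K q (-1))) (t t' : ℂ) (j : ℕ) :
    IsAsymp (θ₀ - Real.pi / 4) (θ₀ + Real.pi / 4)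
      (fun ζ => chainNF (fun x => 1 * f x + t * g x) (2 * j + 2) (Complex.exp ζ) -
        chainNF (fun x => 1 * f x + t' * g x) (2 * j + 2) (Complex.exp ζ))
      ((t - t') * M / (K * K) *
        (2 * 4 ^ j * Complex.Gamma a / (Complex.Gamma (a + (j + 1)) * (j.factorial : ℂ))))
      (2 * a + 4 * j + 2) (-1) := by
  rcases eq_or_ne t t' with rfl | htt
  · exact ⟨_, Small.zero, Eventually.of_forall fun ζ => by simp [powExp]⟩
  have a1 := h.isAsymp_add_mul hs t
  have a2 := h.isAsymp_add_mul hs t'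
  have hK := h.fst_ne_zero
  have hD := chain_one_sub (w := fun x => 1 * f x + t * g x) (v := fun x => 1 * f x + t' * g x)
    (M := (t - t') * M) a1 hK a2 hK fun x => by
      rw [h.deriv_comb, h.deriv_comb]
      linear_combination (t - t') * h.wronskian x
  rw [show -(-a + -a) = 2 * a by ring, add_zero, sub_zero] at hD
  have h2 := (chain_sub_of_pow (w := fun x => 1 * f x + t * g x)
    (v := fun x => 1 * f x + t' * g x) a1 hK a2 hK ha hD (div_ne_zero
      (mul_ne_zero (sub_ne_zero.2 htt) h.wronskian_ne_zero) (mul_ne_zero hK hK)) hs j).2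
  refine h2.congr ?_
  filter_upwards [(h.fst.comb h.snd 1 t).eventually_chainNF_eq
      (chain_leading_of_pow (w := fun x => 1 * f x + t * g x) a1 hK ha j).2,
    (h.fst.comb h.snd 1 t').eventually_chainNF_eq
      (chain_leading_of_pow (w := fun x => 1 * f x + t' * g x) a2 hK ha j).2] with ζ e1 e2
  rw [e1, e2]

/-- Where `g` dominates, the solutions generated by `t f + g` and `t' f + g` differ by a
recessive term with coefficient proportional to `t - t'`. -/
theorem isAsymp_chainNF_sub_of_exp (h : IsSectorPair a θ₀ f g K K' M)
    (hs : ∀ K q, Small (θ₀ - Real.pi / 4) (θ₀ + Real.pi / 4) (powExp K q 1)) (t t' : ℂ) (j : ℕ) :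
    IsAsymp (θ₀ - Real.pi / 4) (θ₀ + Real.pi / 4)
      (fun ζ => chainNF (fun x => t * f x + 1 * g x) (2 * j + 2) (Complex.exp ζ) -
        chainNF (fun x => t' * f x + 1 * g x) (2 * j + 2) (Complex.exp ζ))
      ((t - t') * M / (K' * K') * ((-2) ^ j / (j.factorial : ℂ)))
      (2 - 2 * a + 2 * j) 1 := by
  rcases eq_or_ne t t' with rfl | htt
  · exact ⟨_, Small.zero, Eventually.of_forall fun ζ => by simp [powExp]⟩
  have a1 := h.isAsymp_mul_add hs t
  have a2 := h.isAsymp_mul_add hs t'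
  have hK := h.snd_ne_zero
  have hD := chain_one_sub (w := fun x => t * f x + 1 * g x) (v := fun x => t' * f x + 1 * g x)
    (M := (t' - t) * M) a1 hK a2 hK fun x => by
      rw [h.deriv_comb, h.deriv_comb]
      linear_combination (t' - t) * h.wronskian x
  rw [show -(a - 1 + (a - 1)) = 2 - 2 * a by ring, show (-1 : ℂ) - (-1 + -1) = 1 by norm_num] at hD
  have h2 := (chain_sub_of_exp (w := fun x => t * f x + 1 * g x)
    (v := fun x => t' * f x + 1 * g x) a1 hK a2 hK hD (div_ne_zero
      (mul_ne_zero (sub_ne_zero.2 htt.symm) h.wronskian_ne_zero) (mul_ne_zero hK hK)) hs j).2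
  rw [show -((t' - t) * M / (K' * K') * ((-2) ^ j / (j.factorial : ℂ))) =
    (t - t') * M / (K' * K') * ((-2) ^ j / (j.factorial : ℂ)) by ring] at h2
  refine h2.congr ?_
  filter_upwards [(h.fst.comb h.snd t 1).eventually_chainNF_eq
      (chain_leading_of_exp (w := fun x => t * f x + 1 * g x) a1 hK j).2,
    (h.fst.comb h.snd t' 1).eventually_chainNF_eq
      (chain_leading_of_exp (w := fun x => t' * f x + 1 * g x) a2 hK j).2] with ζ e1 e2
  rw [e1, e2]

/-- The expansion where `f` dominates: backgrounds and solution are generated by multiples of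
`f + t g` for three values of `t`. -/
theorem hasExpansion_of_pow (h : IsSectorPair a θ₀ f g K K' M) (ha : ∀ m : ℕ, a + m ≠ 0)
    (hs : ∀ K q, Small (θ₀ - Real.pi / 4) (θ₀ + Real.pi / 4) (powExp K q (-1)))
    {w v u : ℂ → ℂ} {l lm lp t tm tp : ℂ} (hl : l ≠ 0) (hlm : lm ≠ 0) (hlp : lp ≠ 0)
    (hw : ∀ x, w x = l * (f x + t * g x)) (hv : ∀ x, v x = lm * (f x + tm * g x))
    (hu : ∀ x, u x = lp * (f x + tp * g x)) (j : ℕ) {μ : ℝ → ℂ} (hμ : ∀ θ, μ θ = M / (K * K) *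
      (2 * 4 ^ j * Complex.Gamma a / (Complex.Gamma (a + (j + 1)) * (j.factorial : ℂ))) *
        (t - tm - (tp - tm) * step (θ - θ₀))) :
    HasExpansion (chainNF w (2 * j + 2)) (chainNF v (2 * j + 2)) (chainNF u (2 * j + 2))
      (-((j : ℂ) + 1)) μ (2 * a + 4 * j + 2) (-1) θ₀ := by
  have e : ∀ t x, f x + t * g x = 1 * f x + t * g x := fun t x => by rw [one_mul]
  simp only [e] at hw hv hu
  rw [chainNF_eq_of_eq_mul hl hw, chainNF_eq_of_eq_mul hlm hv, chainNF_eq_of_eq_mul hlp hu]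
  exact hasExpansion_of_isAsymp
    (isAsymp_chainNF_of_pow (h.fst.comb h.snd 1 t) h.fst_ne_zero (h.isAsymp_add_mul hs t) ha j)
    (h.isAsymp_chainNF_sub_of_pow ha hs t tm j) (h.isAsymp_chainNF_sub_of_pow ha hs t tp j)
    fun θ => by rw [hμ]; ring

/-- The expansion where `g` dominates: backgrounds and solution are generated by multiples of
`t f + g` for three values of `t`. -/
theorem hasExpansion_of_exp (h : IsSectorPair a θ₀ f g K K' M)
    (hs : ∀ K q, Small (θ₀ - Real.pi / 4) (θ₀ + Real.pi / 4) (powExp K q 1))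
    {w v u : ℂ → ℂ} {l lm lp t tm tp : ℂ} (hl : l ≠ 0) (hlm : lm ≠ 0) (hlp : lp ≠ 0)
    (hw : ∀ x, w x = l * (t * f x + g x)) (hv : ∀ x, v x = lm * (tm * f x + g x))
    (hu : ∀ x, u x = lp * (tp * f x + g x)) (j : ℕ) {μ : ℝ → ℂ}
    (hμ : ∀ θ, μ θ = M / (K' * K') * ((-2) ^ j / (j.factorial : ℂ)) *
        (t - tm - (tp - tm) * step (θ - θ₀))) :
    HasExpansion (chainNF w (2 * j + 2)) (chainNF v (2 * j + 2)) (chainNF u (2 * j + 2))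
      ((j : ℂ) + 1) μ (2 - 2 * a + 2 * j) 1 θ₀ := by
  have e : ∀ t x, t * f x + g x = t * f x + 1 * g x := fun t x => by rw [one_mul]
  simp only [e] at hw hv hu
  rw [chainNF_eq_of_eq_mul hl hw, chainNF_eq_of_eq_mul hlm hv, chainNF_eq_of_eq_mul hlp hu]
  exact hasExpansion_of_isAsymp
    (isAsymp_chainNF_of_exp (h.fst.comb h.snd t 1) h.snd_ne_zero (h.isAsymp_mul_add hs t) j)
    (h.isAsymp_chainNF_sub_of_exp hs t tm j) (h.isAsymp_chainNF_sub_of_exp hs t tp j)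
    fun θ => by rw [hμ]; ring

end IsSectorPair

/-! ### The Weber functions recessive on the four half-axes -/

/-- The Weber function recessive in the direction of the positive imaginary axis; it is `x^{-a}`
for `-π/4 < arg x < 5π/4`. -/
noncomputable def weberUp (a : ℂ) (h : ℂ → ℂ) (x : ℂ) : ℂ :=
  (quarterPhase a)⁻¹ * h (-Complex.I * x)

/-- The Weber function recessive in the direction of the negative imaginary axis; it is `x^{-a}`
for `-5π/4 < arg x < π/4`. -/
noncomputable def weberDown (a : ℂ) (h : ℂ → ℂ) (x : ℂ) : ℂ :=
  quarterPhase a * h (Complex.I * x)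

/-- The Weber function recessive in the direction of the positive real axis. -/
noncomputable def weberRight (k : ℂ → ℂ) (x : ℂ) : ℂ := Complex.exp (-x ^ 2) * k (1 * x)

/-- The Weber function recessive in the direction of the negative real axis. -/
noncomputable def weberLeft (k : ℂ → ℂ) (x : ℂ) : ℂ := Complex.exp (-x ^ 2) * k (-1 * x)

theorem IsWeber.const_mul {w : ℂ → ℂ} (hw : IsWeber a w) (c : ℂ) : IsWeber a fun x => c * w x := by
  simpa using hw.comb hw c 0

theorem weberUp_neg (a : ℂ) (h : ℂ → ℂ) (x : ℂ) :
    weberUp a h (-x) = (quarterPhase a ^ 2)⁻¹ * weberDown a h x := by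
  have := quarterPhase_ne_zero a
  simp only [weberUp, weberDown, neg_mul_neg]
  field_simp

theorem weberDown_neg (a : ℂ) (h : ℂ → ℂ) (x : ℂ) :
    weberDown a h (-x) = quarterPhase a ^ 2 * weberUp a h x := by
  have := quarterPhase_ne_zero a
  simp only [weberUp, weberDown, mul_neg, neg_mul]
  field_simp

theorem weberRight_neg (k : ℂ → ℂ) (x : ℂ) : weberRight k (-x) = weberLeft k x := by
  simp [weberRight, weberLeft]

section

variable {h₀ h₁ k₀ k₁ : ℂ → ℂ}

theorem isWeber_up (h : IsHermite a h₀ h₁) : IsWeber a (weberUp a h₀) :=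
  (h.isWeber (by simp)).const_mul _

theorem isWeber_down (h : IsHermite a h₀ h₁) : IsWeber a (weberDown a h₀) :=
  (h.isWeber (by simp)).const_mul _

theorem isWeber_right (k : IsHermite (1 - a) k₀ k₁) : IsWeber a (weberRight k₀) :=
  k.isWeber_exp (by simp)

theorem isWeber_left (k : IsHermite (1 - a) k₀ k₁) : IsWeber a (weberLeft k₀) :=
  k.isWeber_exp (by simp)

theorem exp_neg_quarter_turns (n : ℤ) :
    Complex.exp (((-(n * (Real.pi / 2)) : ℝ) : ℂ) * Complex.I) = (-Complex.I) ^ n := by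
  rw [← Complex.exp_neg_pi_div_two_mul_I, ← Complex.exp_int_mul]
  congr 1
  push_cast
  ring

theorem quarterPhase_zpow (a : ℂ) (n : ℤ) :
    Complex.exp (-a * (((-(n * (Real.pi / 2)) : ℝ) : ℂ) * Complex.I)) = quarterPhase a ^ n := by
  rw [quarterPhase, ← Complex.exp_int_mul]
  congr 1
  push_cast
  ring

theorem quarterPhase_one_sub (a : ℂ) : quarterPhase (1 - a) = Complex.I * (quarterPhase a)⁻¹ := by
  rw [quarterPhase, quarterPhase, ← Complex.exp_neg,
    show Complex.I * Real.pi * (1 - a) / 2 = Real.pi / 2 * Complex.I +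
      -(Complex.I * Real.pi * a / 2) by ring, Complex.exp_add, Complex.exp_pi_div_two_mul_I]

theorem IsHermite.isAsymp_quarter_turns (h : IsHermite a h₀ h₁) (n : ℤ) :
    IsAsymp (n * (Real.pi / 2) - 3 * Real.pi / 4) (n * (Real.pi / 2) + 3 * Real.pi / 4)
      (fun ζ => h₀ ((-Complex.I) ^ n * Complex.exp ζ)) (quarterPhase a ^ n) (-a) 0 := by
  rw [← quarterPhase_zpow]
  exact (h.isAsymp_rotate _ (exp_neg_quarter_turns n)).mono (by linarith) (by linarith)

theorem IsHermite.isAsymp_exp_quarter_turns (h : IsHermite (1 - a) h₀ h₁) (n : ℤ) :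
    IsAsymp (n * (Real.pi / 2) - 3 * Real.pi / 4) (n * (Real.pi / 2) + 3 * Real.pi / 4)
      (fun ζ => Complex.exp (-Complex.exp ζ ^ 2) * h₀ ((-Complex.I) ^ n * Complex.exp ζ))
      (quarterPhase (1 - a) ^ n) (a - 1) (-1) := by
  rw [← quarterPhase_zpow]
  exact (h.isAsymp_exp_rotate _ (exp_neg_quarter_turns n)).mono (by linarith) (by linarith)

theorem isAsymp_up (h : IsHermite a h₀ h₁) :
    IsAsymp (-(Real.pi / 4)) (5 * Real.pi / 4)
      (fun ζ => weberUp a h₀ (Complex.exp ζ)) 1 (-a) 0 := by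
  have := ((h.isAsymp_quarter_turns 1).const_mul (quarterPhase a)⁻¹).mono
    (θ₁' := -(Real.pi / 4)) (θ₂' := 5 * Real.pi / 4)
    (by push_cast; linarith) (by push_cast; linarith)
  rwa [zpow_one, zpow_one, inv_mul_cancel₀ (quarterPhase_ne_zero a)] at this

theorem isAsymp_down (h : IsHermite a h₀ h₁) :
    IsAsymp (-(5 * Real.pi / 4)) (Real.pi / 4)
      (fun ζ => weberDown a h₀ (Complex.exp ζ)) 1 (-a) 0 := by
  have := ((h.isAsymp_quarter_turns (-1)).const_mul (quarterPhase a)).mono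
    (θ₁' := -(5 * Real.pi / 4)) (θ₂' := Real.pi / 4)
    (by push_cast; linarith) (by push_cast; linarith)
  rwa [zpow_neg_one, zpow_neg_one, mul_inv_cancel₀ (quarterPhase_ne_zero a), inv_neg,
    Complex.inv_I, neg_neg] at this

/-- In the branch of `x^{-a}` reached after going around the origin, the constant becomes
`exp (2πia)`. -/
theorem isAsymp_down_turn (h : IsHermite a h₀ h₁) :
    IsAsymp (3 * Real.pi / 4) (9 * Real.pi / 4)
      (fun ζ => weberDown a h₀ (Complex.exp ζ)) (quarterPhase a ^ 4) (-a) 0 := by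
  have := ((h.isAsymp_quarter_turns 3).const_mul (quarterPhase a)).mono
    (θ₁' := 3 * Real.pi / 4) (θ₂' := 9 * Real.pi / 4)
    (by push_cast; linarith) (by push_cast; linarith)
  have e : (-Complex.I) ^ (3 : ℤ) = Complex.I := by
    rw [show (3 : ℤ) = ((3 : ℕ) : ℤ) from rfl, zpow_natCast, pow_succ, neg_sq, Complex.I_sq]
    ring
  have e2 : quarterPhase a * quarterPhase a ^ (3 : ℤ) = quarterPhase a ^ 4 := by
    rw [show (3 : ℤ) = ((3 : ℕ) : ℤ) from rfl, zpow_natCast]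
    ring
  rwa [e, e2] at this

theorem isAsymp_right (k : IsHermite (1 - a) k₀ k₁) :
    IsAsymp (-(3 * Real.pi / 4)) (3 * Real.pi / 4)
      (fun ζ => weberRight k₀ (Complex.exp ζ)) 1 (a - 1) (-1) := by
  have := (k.isAsymp_exp_quarter_turns 0).mono
    (θ₁' := -(3 * Real.pi / 4)) (θ₂' := 3 * Real.pi / 4)
    (by push_cast; linarith) (by push_cast; linarith)
  rwa [zpow_zero, zpow_zero] at this

theorem isAsymp_left (k : IsHermite (1 - a) k₀ k₁) :
    IsAsymp (Real.pi / 4) (7 * Real.pi / 4)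
      (fun ζ => weberLeft k₀ (Complex.exp ζ)) (-(quarterPhase a ^ 2)⁻¹) (a - 1) (-1) := by
  have := (k.isAsymp_exp_quarter_turns 2).mono
    (θ₁' := Real.pi / 4) (θ₂' := 7 * Real.pi / 4)
    (by push_cast; linarith) (by push_cast; linarith)
  have e : (-Complex.I) ^ (2 : ℤ) = -1 := by
    rw [show (2 : ℤ) = ((2 : ℕ) : ℤ) from rfl, zpow_natCast, neg_sq, Complex.I_sq]
  have e2 : quarterPhase (1 - a) ^ (2 : ℤ) = -(quarterPhase a ^ 2)⁻¹ := by
    rw [show (2 : ℤ) = ((2 : ℕ) : ℤ) from rfl, zpow_natCast, quarterPhase_one_sub, mul_pow,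
      Complex.I_sq, inv_pow, neg_one_mul]
  rwa [e, e2] at this

theorem isAsymp_right_turn (k : IsHermite (1 - a) k₀ k₁) :
    IsAsymp (5 * Real.pi / 4) (11 * Real.pi / 4)
      (fun ζ => weberRight k₀ (Complex.exp ζ)) (quarterPhase a ^ 4)⁻¹ (a - 1) (-1) := by
  have := (k.isAsymp_exp_quarter_turns 4).mono
    (θ₁' := 5 * Real.pi / 4) (θ₂' := 11 * Real.pi / 4)
    (by push_cast; linarith) (by push_cast; linarith)
  have e : (-Complex.I) ^ (4 : ℤ) = 1 := by
    rw [show (4 : ℤ) = ((4 : ℕ) : ℤ) from rfl, zpow_natCast, neg_pow, Complex.I_pow_four]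
    norm_num
  have e2 : quarterPhase (1 - a) ^ (4 : ℤ) = (quarterPhase a ^ 4)⁻¹ := by
    rw [show (4 : ℤ) = ((4 : ℕ) : ℤ) from rfl, zpow_natCast, quarterPhase_one_sub, mul_pow,
      Complex.I_pow_four, inv_pow, one_mul]
  rwa [e, e2] at this

theorem wronskian_weberDown_right (h : IsHermite a h₀ h₁) (k : IsHermite (1 - a) k₀ k₁) (x : ℂ) :
    weberDown a h₀ x * deriv (weberRight k₀) x - deriv (weberDown a h₀) x * weberRight k₀ x =
      -2 * Complex.exp (-x ^ 2) := by
  have w := wronskian_right h k (c := Complex.I) (by simp) x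
  rw [← inv_quarterPhase_eq] at w
  have d : deriv (weberDown a h₀) x = quarterPhase a * deriv (fun x => h₀ (Complex.I * x)) x :=
    deriv_const_mul_field _
  rw [d]
  have hE := mul_inv_cancel₀ (quarterPhase_ne_zero a)
  change quarterPhase a * h₀ (Complex.I * x) * deriv (fun x => Complex.exp (-x ^ 2) * k₀ (1 * x)) x
    - quarterPhase a * deriv (fun x => h₀ (Complex.I * x)) x *
      (Complex.exp (-x ^ 2) * k₀ (1 * x)) = _
  linear_combination quarterPhase a * w - 2 * Complex.exp (-x ^ 2) * hE

theorem wronskian_weberUp_right (h : IsHermite a h₀ h₁) (k : IsHermite (1 - a) k₀ k₁) (x : ℂ) :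
    weberUp a h₀ x * deriv (weberRight k₀) x - deriv (weberUp a h₀) x * weberRight k₀ x =
      -2 * Complex.exp (-x ^ 2) := by
  have w := wronskian_right h k (c := -Complex.I) (by simp) x
  rw [show Complex.cos (Real.pi * a / 2) - -Complex.I * Complex.sin (Real.pi * a / 2) =
    quarterPhase a by rw [quarterPhase_eq]; ring] at w
  have d : deriv (weberUp a h₀) x =
      (quarterPhase a)⁻¹ * deriv (fun x => h₀ (-Complex.I * x)) x := deriv_const_mul_field _
  rw [d]
  have hE := mul_inv_cancel₀ (quarterPhase_ne_zero a)
  change (quarterPhase a)⁻¹ * h₀ (-Complex.I * x) *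
      deriv (fun x => Complex.exp (-x ^ 2) * k₀ (1 * x)) x -
    (quarterPhase a)⁻¹ * deriv (fun x => h₀ (-Complex.I * x)) x *
      (Complex.exp (-x ^ 2) * k₀ (1 * x)) = _
  linear_combination (quarterPhase a)⁻¹ * w - 2 * Complex.exp (-x ^ 2) * hE

theorem wronskian_weberUp_left (h : IsHermite a h₀ h₁) (k : IsHermite (1 - a) k₀ k₁) (x : ℂ) :
    weberUp a h₀ x * deriv (weberLeft k₀) x - deriv (weberUp a h₀) x * weberLeft k₀ x =
      2 * (quarterPhase a ^ 2)⁻¹ * Complex.exp (-x ^ 2) := by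
  have w := wronskian_weberDown_right h k (-x)
  have e1 : weberUp a h₀ = fun x => (quarterPhase a ^ 2)⁻¹ * weberDown a h₀ (-x) := by
    funext x
    rw [weberDown_neg, inv_mul_cancel_left₀ (pow_ne_zero 2 (quarterPhase_ne_zero a))]
  have e2 : weberLeft k₀ = fun x => weberRight k₀ (-x) := funext fun x => (weberRight_neg k₀ x).symm
  rw [neg_sq] at w
  rw [e1, e2, deriv_const_mul_field, deriv_comp_neg, deriv_comp_neg]
  linear_combination -(quarterPhase a ^ 2)⁻¹ * w

/-- The Stokes multiplier of Weber's equation. -/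
noncomputable def stokesMul (a : ℂ) : ℂ := iSqrtPi * ((2 : ℂ) ^ a / Complex.Gamma a)

theorem weberUp_eq (h : IsHermite a h₀ h₁) (k : IsHermite (1 - a) k₀ k₁)
    (ha : Complex.Gamma a ≠ 0) (ha0 : a ≠ 0) (x : ℂ) :
    weberUp a h₀ x = weberDown a h₀ x - stokesMul a * weberRight k₀ x :=
  connection_formula h k ha ha0 x

/-- The relation `weberUp_eq` at `-x`. -/
theorem stokesMul_mul_weberLeft (h : IsHermite a h₀ h₁) (k : IsHermite (1 - a) k₀ k₁)
    (ha : Complex.Gamma a ≠ 0) (ha0 : a ≠ 0) (x : ℂ) : stokesMul a * weberLeft k₀ x =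
      quarterPhase a ^ 2 * weberUp a h₀ x - (quarterPhase a ^ 2)⁻¹ * weberDown a h₀ x := by
  have := weberUp_eq h k ha ha0 (-x)
  rw [weberUp_neg, weberDown_neg, weberRight_neg] at this
  linear_combination this

theorem isSectorPair_right (h : IsHermite a h₀ h₁) (k : IsHermite (1 - a) k₀ k₁) :
    IsSectorPair a 0 (weberDown a h₀) (weberRight k₀) 1 1 (-2) where
  fst := isWeber_down h
  snd := isWeber_right k
  isAsymp_fst := (isAsymp_down h).mono (by linarith [Real.pi_pos]) (by linarith [Real.pi_pos])
  isAsymp_snd := (isAsymp_right k).mono (by linarith [Real.pi_pos]) (by linarith [Real.pi_pos])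
  fst_ne_zero := one_ne_zero
  snd_ne_zero := one_ne_zero
  wronskian := wronskian_weberDown_right h k
  wronskian_ne_zero := by norm_num

theorem isSectorPair_up (h : IsHermite a h₀ h₁) (k : IsHermite (1 - a) k₀ k₁) :
    IsSectorPair a (Real.pi / 2) (weberUp a h₀) (weberRight k₀) 1 1 (-2) where
  fst := isWeber_up h
  snd := isWeber_right k
  isAsymp_fst := (isAsymp_up h).mono (by linarith [Real.pi_pos]) (by linarith [Real.pi_pos])
  isAsymp_snd := (isAsymp_right k).mono (by linarith [Real.pi_pos]) (by linarith [Real.pi_pos])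
  fst_ne_zero := one_ne_zero
  snd_ne_zero := one_ne_zero
  wronskian := wronskian_weberUp_right h k
  wronskian_ne_zero := by norm_num

theorem isSectorPair_left (h : IsHermite a h₀ h₁) (k : IsHermite (1 - a) k₀ k₁) :
    IsSectorPair a Real.pi (weberUp a h₀) (weberLeft k₀) 1 (-(quarterPhase a ^ 2)⁻¹)
      (2 * (quarterPhase a ^ 2)⁻¹) where
  fst := isWeber_up h
  snd := isWeber_left k
  isAsymp_fst := (isAsymp_up h).mono (by linarith [Real.pi_pos]) (by linarith [Real.pi_pos])
  isAsymp_snd := (isAsymp_left k).mono (by linarith [Real.pi_pos]) (by linarith [Real.pi_pos])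
  fst_ne_zero := one_ne_zero
  snd_ne_zero := by simp [quarterPhase_ne_zero]
  wronskian := wronskian_weberUp_left h k
  wronskian_ne_zero := by simp [quarterPhase_ne_zero]

theorem isSectorPair_down (h : IsHermite a h₀ h₁) (k : IsHermite (1 - a) k₀ k₁) :
    IsSectorPair a (3 * Real.pi / 2) (weberDown a h₀) (weberRight k₀) (quarterPhase a ^ 4)
      (quarterPhase a ^ 4)⁻¹ (-2) where
  fst := isWeber_down h
  snd := isWeber_right k
  isAsymp_fst := (isAsymp_down_turn h).mono (by linarith [Real.pi_pos]) (by linarith [Real.pi_pos])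
  isAsymp_snd := (isAsymp_right_turn k).mono (by linarith [Real.pi_pos]) (by linarith [Real.pi_pos])
  fst_ne_zero := by simp [quarterPhase_ne_zero]
  snd_ne_zero := by simp [quarterPhase_ne_zero]
  wronskian := wronskian_weberDown_right h k
  wronskian_ne_zero := by norm_num

end

/-! ### Identities between the constants -/

theorem iSqrtPi_sq : iSqrtPi ^ 2 = -Real.pi := by
  rw [iSqrtPi, mul_pow, sqrt_pi_sq, Complex.I_sq, neg_one_mul]

theorem iSqrtPi_ne_zero : iSqrtPi ≠ 0 := by
  intro h
  have := iSqrtPi_sq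
  rw [h] at this
  have hπ : (Real.pi : ℂ) ≠ 0 := by exact_mod_cast Real.pi_ne_zero
  simp at this

theorem quarterPhase_sq (a : ℂ) : quarterPhase a ^ 2 = Complex.exp (Complex.I * Real.pi * a) := by
  rw [quarterPhase, ← Complex.exp_nat_mul]
  congr 1
  push_cast
  ring

theorem quarterPhase_add_half_sq (α : ℂ) :
    quarterPhase (α + 1 / 2) ^ 2 = Complex.I * Complex.exp (Complex.I * Real.pi * α) := by
  rw [quarterPhase_sq, show Complex.I * Real.pi * (α + 1 / 2) = Real.pi / 2 * Complex.I +
    Complex.I * Real.pi * α by ring, Complex.exp_add, Complex.exp_pi_div_two_mul_I]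

theorem Gamma_mul_Gamma_mul_quarterPhase (ha : ∀ m : ℤ, a ≠ m) :
    Complex.Gamma a * Complex.Gamma (1 - a) * (quarterPhase a ^ 4 - 1) =
      2 * Real.pi * Complex.I * quarterPhase a ^ 2 := by
  have hπ : (Real.pi : ℂ) ≠ 0 := by exact_mod_cast Real.pi_ne_zero
  have hs : Complex.sin (Real.pi * a) ≠ 0 := by
    rw [Complex.sin_ne_zero_iff]
    intro m hm
    exact ha m (mul_left_cancel₀ hπ (by rw [hm]; ring))
  have e1 : quarterPhase a ^ 2 =
      Complex.cos (Real.pi * a) + Complex.sin (Real.pi * a) * Complex.I := by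
    rw [quarterPhase_sq, ← Complex.exp_mul_I]
    congr 1
    ring
  have e : quarterPhase a ^ 4 - 1 =
      2 * Complex.I * quarterPhase a ^ 2 * Complex.sin (Real.pi * a) := by
    rw [show quarterPhase a ^ 4 = (quarterPhase a ^ 2) ^ 2 by ring, e1]
    linear_combination Complex.sin_sq_add_cos_sq (Real.pi * a) -
      Complex.sin (Real.pi * a) ^ 2 * Complex.I_sq
  rw [Complex.Gamma_mul_Gamma_one_sub, e]
  field_simp

section constants

theorem Gamma_ne_zero_of_forall_int {a : ℂ} (ha : ∀ m : ℤ, a ≠ m) : Complex.Gamma a ≠ 0 :=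
  Complex.Gamma_ne_zero fun m h => ha (-m) (by simpa using h)

variable {α : ℂ}

theorem exp_I_pi_mul (α : ℂ) : Complex.exp (Complex.I * Real.pi * α) =
    -Complex.I * quarterPhase (α + 1 / 2) ^ 2 := by
  rw [quarterPhase_add_half_sq, ← mul_assoc, neg_mul, Complex.I_mul_I, neg_neg, one_mul]

theorem exp_two_I_pi_mul (α : ℂ) : Complex.exp (2 * Complex.I * Real.pi * α) =
    -quarterPhase (α + 1 / 2) ^ 4 := by
  rw [show 2 * Complex.I * Real.pi * α = ((2 : ℕ) : ℂ) * (Complex.I * Real.pi * α) by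
    push_cast; ring, Complex.exp_nat_mul, exp_I_pi_mul, mul_pow, neg_sq, Complex.I_sq]
  ring

theorem exp_neg_two_I_pi_mul (α : ℂ) : Complex.exp (-2 * Complex.I * Real.pi * α) =
    -(quarterPhase (α + 1 / 2) ^ 4)⁻¹ := by
  rw [← inv_neg, ← exp_two_I_pi_mul, ← Complex.exp_neg]
  congr 1
  ring

theorem exp_three_pi_I_mul (α : ℂ) : Complex.exp (3 * Real.pi * Complex.I * α) =
    Complex.I * quarterPhase (α + 1 / 2) ^ 6 := by
  rw [show 3 * Real.pi * Complex.I * α = ((3 : ℕ) : ℂ) * (Complex.I * Real.pi * α) by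
    push_cast; ring, Complex.exp_nat_mul, exp_I_pi_mul, mul_pow, neg_pow, Complex.I_pow_three]
  ring

theorem quarterPhase_pow_four_ne_one (ha : ∀ m : ℤ, a ≠ m) : 1 - quarterPhase a ^ 4 ≠ 0 := by
  intro h
  have h2 := Gamma_mul_Gamma_mul_quarterPhase ha
  have hπ : (Real.pi : ℂ) ≠ 0 := by exact_mod_cast Real.pi_ne_zero
  rw [show quarterPhase a ^ 4 - 1 = 0 by linear_combination -h, mul_zero] at h2
  simp [hπ, quarterPhase_ne_zero] at h2

theorem one_sub_div_stokesMul (ha : ∀ m : ℤ, a ≠ m) : (1 - quarterPhase a ^ 4) / stokesMul a =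
    2 * Complex.I * iSqrtPi * quarterPhase a ^ 2 / ((2 : ℂ) ^ a * Complex.Gamma (1 - a)) := by
  have h2 : (2 : ℂ) ^ a ≠ 0 := by simp [Complex.cpow_eq_zero_iff]
  have g1 := Gamma_ne_zero_of_forall_int ha
  have g2 : Complex.Gamma (1 - a) ≠ 0 := Complex.Gamma_ne_zero fun m h => ha (m + 1) (by
    push_cast
    linear_combination -h)
  have hσ := iSqrtPi_ne_zero
  have h := Gamma_mul_Gamma_mul_quarterPhase ha
  have hs := iSqrtPi_sq
  rw [stokesMul]
  field_simp
  linear_combination -h - 2 * Complex.I * quarterPhase a ^ 2 * hs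

theorem two_cpow_eq (α : ℂ) (j : ℕ) : (2 : ℂ) ^ (-1 / 2 + 2 * ((j + 1 : ℕ) : ℂ) + α) =
    (2 : ℂ) ^ (α + 1 / 2) * (2 * 4 ^ j) := by
  rw [show -1 / 2 + 2 * ((j + 1 : ℕ) : ℂ) + α = α + 1 / 2 + ((2 * j + 1 : ℕ) : ℂ) by
    push_cast; ring, Complex.cpow_add _ _ two_ne_zero, Complex.cpow_natCast, pow_succ, pow_mul]
  norm_num [mul_comm]

theorem two_cpow_sub_eq (α : ℂ) (j : ℕ) : (2 : ℂ) ^ (((j + 1 : ℕ) : ℂ) - 1 / 2 - α) =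
    2 ^ (j + 1) / (2 : ℂ) ^ (α + 1 / 2) := by
  rw [show ((j + 1 : ℕ) : ℂ) - 1 / 2 - α = ((j + 1 : ℕ) : ℂ) - (α + 1 / 2) by ring,
    Complex.cpow_sub _ _ two_ne_zero, Complex.cpow_natCast]

end constants

/-! ### The one-parameter family and its coefficients -/

/-- The Weber functions `weberDown + c m weberRight` with `m = 2^a / Γ(a)`, completed by
`weberRight` for `c = ∞`. -/
noncomputable def weberFamily (a : ℂ) (h₀ k₀ : ℂ → ℂ) (c : OnePoint ℂ) : ℂ → ℂ :=
  c.elim (weberRight k₀) fun c x =>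
    weberDown a h₀ x + c * ((2 : ℂ) ^ a / Complex.Gamma a) * weberRight k₀ x

section coefficients

variable {α : ℂ}

/-- The coefficient of the sector about `arg x = 0`: the parameters are `c m` for the solution, `0`
and `-i√π m` for the backgrounds, with `m = 2^a / Γ(a)`. -/
theorem mu₁_eq (hα : ∀ m : ℤ, α + 1 / 2 ≠ m) (j : ℕ) (c : ℂ) (θ : ℝ) :
    mu₁ α (j + 1) c θ = -2 / (1 * 1) * (2 * 4 ^ j * Complex.Gamma (α + 1 / 2) /
        (Complex.Gamma (α + 1 / 2 + (j + 1)) * (j.factorial : ℂ))) *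
      (c * ((2 : ℂ) ^ (α + 1 / 2) / Complex.Gamma (α + 1 / 2)) - 0 -
        (-iSqrtPi * ((2 : ℂ) ^ (α + 1 / 2) / Complex.Gamma (α + 1 / 2)) - 0) * step (θ - 0)) := by
  have hG := Gamma_ne_zero_of_forall_int hα
  rw [mu₁, two_cpow_eq, Nat.add_sub_cancel, sub_zero θ,
    show α + ((j + 1 : ℕ) : ℂ) + 1 / 2 = α + 1 / 2 + (j + 1) by push_cast; ring]
  generalize Complex.Gamma (α + 1 / 2) = G at *
  generalize (2 : ℂ) ^ (α + 1 / 2) = P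
  field_simp
  ring

/-- The coefficient of the sector about `arg x = π/2`: the parameters are `ρ τ`, `0` and `τ`. -/
theorem mu₂_eq (hα : ∀ m : ℤ, α + 1 / 2 ≠ m) (j : ℕ) (ρ : ℂ) (θ : ℝ) :
    mu₂ α (j + 1) ρ θ = -2 / (1 * 1) * ((-2) ^ j / (j.factorial : ℂ)) *
      (ρ * ((1 - quarterPhase (α + 1 / 2) ^ 4) / stokesMul (α + 1 / 2)) - 0 -
        ((1 - quarterPhase (α + 1 / 2) ^ 4) / stokesMul (α + 1 / 2) - 0) *
          step (θ - Real.pi / 2)) := by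
  rw [one_sub_div_stokesMul hα, mu₂, two_cpow_sub_eq, exp_I_pi_mul,
    show -α + 1 / 2 = 1 - (α + 1 / 2) by ring, Nat.add_sub_cancel,
    show (-2 : ℂ) = -1 * 2 by norm_num, mul_pow]
  ring

/-- The coefficient of the sector about `arg x = π`: the parameters are `ρ τ`, `0` and `τ`. -/
theorem mu₃_eq (hα : ∀ m : ℤ, α + 1 / 2 ≠ m) (j : ℕ) (ρ : ℂ) (θ : ℝ) :
    mu₃ α (j + 1) ρ θ = 2 * (quarterPhase (α + 1 / 2) ^ 2)⁻¹ / (1 * 1) *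
      (2 * 4 ^ j * Complex.Gamma (α + 1 / 2) /
        (Complex.Gamma (α + 1 / 2 + (j + 1)) * (j.factorial : ℂ))) *
      (ρ * -((quarterPhase (α + 1 / 2) ^ 2)⁻¹ * stokesMul (α + 1 / 2)) - 0 -
        (-((quarterPhase (α + 1 / 2) ^ 2)⁻¹ * stokesMul (α + 1 / 2)) - 0) *
          step (θ - Real.pi)) := by
  have hG := Gamma_ne_zero_of_forall_int hα
  have hE := quarterPhase_ne_zero (α + 1 / 2)
  rw [mu₃, show 2 * ((j + 1 : ℕ) : ℂ) - 1 / 2 + α = -1 / 2 + 2 * ((j + 1 : ℕ) : ℂ) + α by ring,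
    two_cpow_eq, Nat.add_sub_cancel, exp_neg_two_I_pi_mul, stokesMul,
    show α + ((j + 1 : ℕ) : ℂ) + 1 / 2 = α + 1 / 2 + (j + 1) by push_cast; ring]
  generalize Complex.Gamma (α + 1 / 2) = G at *
  generalize quarterPhase (α + 1 / 2) = E at *
  generalize (2 : ℂ) ^ (α + 1 / 2) = P
  field_simp
  ring

/-- The coefficient of the sector about `arg x = 3π/2`: the parameters are `ρ τ`, `-τ` and `0`. -/
theorem mu₄_eq (hα : ∀ m : ℤ, α + 1 / 2 ≠ m) (j : ℕ) (ρ : ℂ) (θ : ℝ) :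
    mu₄ α (j + 1) ρ θ = -2 / ((quarterPhase (α + 1 / 2) ^ 4)⁻¹ * (quarterPhase (α + 1 / 2) ^ 4)⁻¹) *
      ((-2) ^ j / (j.factorial : ℂ)) *
      (ρ * ((1 - (quarterPhase (α + 1 / 2) ^ 4)⁻¹) / stokesMul (α + 1 / 2)) -
        -((1 - (quarterPhase (α + 1 / 2) ^ 4)⁻¹) / stokesMul (α + 1 / 2)) -
        (0 - -((1 - (quarterPhase (α + 1 / 2) ^ 4)⁻¹) / stokesMul (α + 1 / 2))) *
          step (θ - 3 * Real.pi / 2)) := by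
  have hE := quarterPhase_ne_zero (α + 1 / 2)
  have e : (1 - (quarterPhase (α + 1 / 2) ^ 4)⁻¹) / stokesMul (α + 1 / 2) =
      -(quarterPhase (α + 1 / 2) ^ 4)⁻¹ *
        ((1 - quarterPhase (α + 1 / 2) ^ 4) / stokesMul (α + 1 / 2)) := by
    rw [← mul_div_assoc, mul_one_sub, neg_mul, inv_mul_cancel₀ (pow_ne_zero 4 hE)]
    ring
  rw [e, one_sub_div_stokesMul hα, mu₄, two_cpow_sub_eq, exp_three_pi_I_mul,
    show -α + 1 / 2 = 1 - (α + 1 / 2) by ring, Nat.add_sub_cancel,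
    show (-2 : ℂ) = -1 * 2 by norm_num, mul_pow]
  generalize quarterPhase (α + 1 / 2) = E at *
  field_simp
  ring

end coefficients

section representation

variable {h₀ h₁ k₀ k₁ : ℂ → ℂ}

theorem stokesMul_ne_zero (ha : Complex.Gamma a ≠ 0) : stokesMul a ≠ 0 :=
  mul_ne_zero iSqrtPi_ne_zero (div_ne_zero (by simp [Complex.cpow_eq_zero_iff]) ha)

/-- The family in terms of the functions recessive on the two rays that bound the first quadrant. -/
theorem weberFamily_upper (h : IsHermite a h₀ h₁) (k : IsHermite (1 - a) k₀ k₁)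
    (ha : Complex.Gamma a ≠ 0) (ha0 : a ≠ 0) (c x : ℂ) :
    weberFamily a h₀ k₀ c x = weberUp a h₀ x +
      (c + iSqrtPi) * ((2 : ℂ) ^ a / Complex.Gamma a) * weberRight k₀ x := by
  have := weberUp_eq h k ha ha0 x
  rw [stokesMul] at this
  rw [this, weberFamily, OnePoint.elim_some]
  ring

/-- Composition of two connection formulas: `weberRight` in terms of the functions recessive on the
two rays that bound the second quadrant. -/
theorem weberRight_eq (h : IsHermite a h₀ h₁) (k : IsHermite (1 - a) k₀ k₁)
    (ha : Complex.Gamma a ≠ 0) (ha0 : a ≠ 0) (x : ℂ) :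
    stokesMul a * weberRight k₀ x = (quarterPhase a ^ 4 - 1) * weberUp a h₀ x -
      quarterPhase a ^ 2 * stokesMul a * weberLeft k₀ x := by
  have h1 := weberUp_eq h k ha ha0 x
  have h2 := stokesMul_mul_weberLeft h k ha ha0 x
  have hE := mul_inv_cancel₀ (pow_ne_zero 2 (quarterPhase_ne_zero a))
  linear_combination h1 + quarterPhase a ^ 2 * h2 - weberDown a h₀ x * hE

end representation

/-! ### The four sectors -/

theorem small_sector_right (K q : ℂ) :
    Small (0 - Real.pi / 4) (0 + Real.pi / 4) (powExp K q (-1)) :=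
  small_powExp_of_ray 0 (by simp) K q

theorem small_sector_up (K q : ℂ) :
    Small (Real.pi / 2 - Real.pi / 4) (Real.pi / 2 + Real.pi / 4) (powExp K q 1) :=
  small_powExp_of_ray _ (by
    rw [mul_div_cancel₀ _ two_ne_zero, neg_mul, Complex.exp_neg, Complex.exp_pi_mul_I]
    norm_num) K q

theorem small_sector_left (K q : ℂ) :
    Small (Real.pi - Real.pi / 4) (Real.pi + Real.pi / 4) (powExp K q (-1)) :=
  small_powExp_of_ray _ (by
    rw [neg_mul, Complex.exp_neg, Complex.ofReal_mul, Complex.ofReal_ofNat,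
      Complex.exp_two_pi_mul_I]
    norm_num) K q

theorem small_sector_down (K q : ℂ) :
    Small (3 * Real.pi / 2 - Real.pi / 4) (3 * Real.pi / 2 + Real.pi / 4) (powExp K q 1) :=
  small_powExp_of_ray _ (by
    rw [show -((2 * (3 * Real.pi / 2) : ℝ) : ℂ) * Complex.I =
      -(2 * Real.pi * Complex.I + Real.pi * Complex.I) by push_cast; ring, Complex.exp_neg,
      Complex.exp_add, Complex.exp_two_pi_mul_I, Complex.exp_pi_mul_I]
    norm_num) K q

section sectors

variable {α : ℂ} {h₀ h₁ k₀ k₁ : ℂ → ℂ}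

theorem add_natCast_ne_zero {a : ℂ} (ha : ∀ m : ℤ, a ≠ m) (m : ℕ) : a + m ≠ 0 :=
  fun h => ha (-m) (by push_cast; linear_combination h)

/-- In the sector about the positive real axis the backgrounds are generated by `weberDown` and
`weberUp`. -/
theorem hasExpansion_sector_right
    (hα : ∀ m : ℤ, α + 1 / 2 ≠ m) (h : IsHermite (α + 1 / 2) h₀ h₁)
    (k : IsHermite (1 - (α + 1 / 2)) k₀ k₁) (j : ℕ) (c : ℂ) :
    HasExpansion (chainNF (weberFamily (α + 1 / 2) h₀ k₀ c) (2 * j + 2))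
      (chainNF (weberDown (α + 1 / 2) h₀) (2 * j + 2))
      (chainNF (weberUp (α + 1 / 2) h₀) (2 * j + 2)) (-((j : ℂ) + 1)) (mu₁ α (j + 1) c)
      (2 * (α + 1 / 2) + 4 * j + 2) (-1) 0 := by
  refine (isSectorPair_right h k).hasExpansion_of_pow (add_natCast_ne_zero hα) small_sector_right
    one_ne_zero one_ne_zero one_ne_zero (fun x => ?_) (fun x => ?_) (fun x => ?_) j (mu₁_eq hα j c)
  · rw [one_mul]
    rfl
  · ring
  · rw [weberUp_eq h k (Gamma_ne_zero_of_forall_int hα) (by simpa using hα 0), stokesMul]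
    ring

/-- In the sector about the positive imaginary axis the backgrounds are generated by `weberRight`
and `weberLeft`. -/
theorem hasExpansion_sector_up
    (hα : ∀ m : ℤ, α + 1 / 2 ≠ m) (h : IsHermite (α + 1 / 2) h₀ h₁)
    (k : IsHermite (1 - (α + 1 / 2)) k₀ k₁) (j : ℕ)
    {w : ℂ → ℂ} {ρ l : ℂ} (hl : l ≠ 0) (hw : ∀ x, w x =
      l * (ρ * ((1 - quarterPhase (α + 1 / 2) ^ 4) / stokesMul (α + 1 / 2)) *
        weberUp (α + 1 / 2) h₀ x + weberRight k₀ x)) :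
    HasExpansion (chainNF w (2 * j + 2)) (chainNF (weberRight k₀) (2 * j + 2))
      (chainNF (weberLeft k₀) (2 * j + 2)) ((j : ℂ) + 1) (mu₂ α (j + 1) ρ)
      (2 - 2 * (α + 1 / 2) + 2 * j) 1 (Real.pi / 2) := by
  have hG := Gamma_ne_zero_of_forall_int hα
  have hs := stokesMul_ne_zero hG
  have hE := quarterPhase_ne_zero (α + 1 / 2)
  refine (isSectorPair_up h k).hasExpansion_of_exp small_sector_up hl one_ne_zero
    (neg_ne_zero.2 (inv_ne_zero (pow_ne_zero 2 hE))) hw (fun x => ?_) (fun x => ?_) j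
    (mu₂_eq hα j ρ)
  · ring
  · have h2 := weberRight_eq h k hG (by simpa using hα 0) x
    generalize stokesMul (α + 1 / 2) = S at *
    generalize quarterPhase (α + 1 / 2) = E at *
    generalize weberUp (α + 1 / 2) h₀ x = u at *
    field_simp
    linear_combination h2

/-- In the sector about the negative real axis the backgrounds are generated by `weberUp` and
`weberDown`. -/
theorem hasExpansion_sector_left
    (hα : ∀ m : ℤ, α + 1 / 2 ≠ m) (h : IsHermite (α + 1 / 2) h₀ h₁)
    (k : IsHermite (1 - (α + 1 / 2)) k₀ k₁) (j : ℕ)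
    {w : ℂ → ℂ} {ρ l : ℂ} (hl : l ≠ 0) (hw : ∀ x, w x = l * (weberUp (α + 1 / 2) h₀ x +
      ρ * -((quarterPhase (α + 1 / 2) ^ 2)⁻¹ * stokesMul (α + 1 / 2)) * weberLeft k₀ x)) :
    HasExpansion (chainNF w (2 * j + 2)) (chainNF (weberUp (α + 1 / 2) h₀) (2 * j + 2))
      (chainNF (weberDown (α + 1 / 2) h₀) (2 * j + 2)) (-((j : ℂ) + 1)) (mu₃ α (j + 1) ρ)
      (2 * (α + 1 / 2) + 4 * j + 2) (-1) Real.pi := by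
  have hG := Gamma_ne_zero_of_forall_int hα
  have hE := quarterPhase_ne_zero (α + 1 / 2)
  refine (isSectorPair_left h k).hasExpansion_of_pow (add_natCast_ne_zero hα) small_sector_left hl
    one_ne_zero (pow_ne_zero 4 hE) hw (fun x => ?_) (fun x => ?_) j (mu₃_eq hα j ρ)
  · ring
  · have h2 := stokesMul_mul_weberLeft h k hG (by simpa using hα 0) x
    generalize stokesMul (α + 1 / 2) = S at *
    generalize quarterPhase (α + 1 / 2) = E at *
    field_simp at h2 ⊢
    linear_combination h2

/-- In the sector about the negative imaginary axis the backgrounds are generated by `weberLeft` and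
`weberRight`. -/
theorem hasExpansion_sector_down
    (hα : ∀ m : ℤ, α + 1 / 2 ≠ m) (h : IsHermite (α + 1 / 2) h₀ h₁)
    (k : IsHermite (1 - (α + 1 / 2)) k₀ k₁) (j : ℕ)
    {w : ℂ → ℂ} {ρ l : ℂ} (hl : l ≠ 0) (hw : ∀ x, w x =
      l * (ρ * ((1 - (quarterPhase (α + 1 / 2) ^ 4)⁻¹) / stokesMul (α + 1 / 2)) *
        weberDown (α + 1 / 2) h₀ x + weberRight k₀ x)) :
    HasExpansion (chainNF w (2 * j + 2)) (chainNF (weberLeft k₀) (2 * j + 2))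
      (chainNF (weberRight k₀) (2 * j + 2)) ((j : ℂ) + 1) (mu₄ α (j + 1) ρ)
      (2 - 2 * (α + 1 / 2) + 2 * j) 1 (3 * Real.pi / 2) := by
  have hG := Gamma_ne_zero_of_forall_int hα
  have hs := stokesMul_ne_zero hG
  have hE := quarterPhase_ne_zero (α + 1 / 2)
  refine (isSectorPair_down h k).hasExpansion_of_exp small_sector_down hl
    (neg_ne_zero.2 (pow_ne_zero 2 hE)) one_ne_zero hw (fun x => ?_) (fun x => ?_) j
    (mu₄_eq hα j ρ)
  · have h2 := stokesMul_mul_weberLeft h k hG (by simpa using hα 0) x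
    rw [weberUp_eq h k hG (by simpa using hα 0) x] at h2
    generalize stokesMul (α + 1 / 2) = S at *
    generalize quarterPhase (α + 1 / 2) = E at *
    field_simp at h2 ⊢
    linear_combination h2
  · ring

end sectors

/-! ### The solutions and their backgrounds -/

section solutions

variable {h₀ h₁ k₀ k₁ : ℂ → ℂ}

theorem solution_of_pow {w : ℂ → ℂ} {K : ℂ} (hw : IsWeber a w) (hK : K ≠ 0)
    (h : IsAsymp θ₁ θ₂ (fun ζ => w (Complex.exp ζ)) K (-a) 0) (ha : ∀ m : ℕ, a + m ≠ 0)
    (hθ : θ₁ < θ₂) (j : ℕ) :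
    IsP4Solution (a - 1 / 2) (-2 * ((j + 1 : ℕ) : ℂ)) (chainNF w (2 * j + 2)) ∧
      IsClassical (a - 1 / 2) (-2 * ((j + 1 : ℕ) : ℂ)) (chainNF w (2 * j + 2)) :=
  solution_chainNF_even hw (chain_ne_zero_of_pow hw hK h ha hθ) j

theorem solution_of_exp {w : ℂ → ℂ} {K q : ℂ} (hw : IsWeber a w) (hK : K ≠ 0)
    (h : IsAsymp θ₁ θ₂ (fun ζ => w (Complex.exp ζ)) K q (-1)) (hθ : θ₁ < θ₂) (j : ℕ) :
    IsP4Solution (a - 1 / 2) (-2 * ((j + 1 : ℕ) : ℂ)) (chainNF w (2 * j + 2)) ∧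
      IsClassical (a - 1 / 2) (-2 * ((j + 1 : ℕ) : ℂ)) (chainNF w (2 * j + 2)) :=
  solution_chainNF_even hw (chain_ne_zero_of_exp hw hK h hθ) j

theorem isWeber_weberFamily (h : IsHermite a h₀ h₁) (k : IsHermite (1 - a) k₀ k₁) (c : ℂ) :
    IsWeber a (weberFamily a h₀ k₀ c) := by
  simpa [weberFamily] using
    (isWeber_down h).comb (isWeber_right k) 1 (c * ((2 : ℂ) ^ a / Complex.Gamma a))

theorem isAsymp_weberFamily (h : IsHermite a h₀ h₁) (k : IsHermite (1 - a) k₀ k₁) (c : ℂ) :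
    IsAsymp (0 - Real.pi / 4) (0 + Real.pi / 4)
      (fun ζ => weberFamily a h₀ k₀ c (Complex.exp ζ)) 1 (-a) 0 := by
  simpa [weberFamily] using (isSectorPair_right h k).isAsymp_add_mul small_sector_right
    (c * ((2 : ℂ) ^ a / Complex.Gamma a))

theorem solution_weberFamily (ha : ∀ m : ℤ, a ≠ m) (h : IsHermite a h₀ h₁)
    (k : IsHermite (1 - a) k₀ k₁) (j : ℕ) (c : OnePoint ℂ) :
    IsP4Solution (a - 1 / 2) (-2 * ((j + 1 : ℕ) : ℂ))
        (chainNF (weberFamily a h₀ k₀ c) (2 * j + 2)) ∧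
      IsClassical (a - 1 / 2) (-2 * ((j + 1 : ℕ) : ℂ))
        (chainNF (weberFamily a h₀ k₀ c) (2 * j + 2)) := by
  have hπ := Real.pi_pos
  induction c with
  | infty => exact solution_of_exp (isWeber_right k) one_ne_zero (isAsymp_right k) (by linarith) j
  | coe c =>
    exact solution_of_pow (isWeber_weberFamily h k c) one_ne_zero (isAsymp_weberFamily h k c)
      (add_natCast_ne_zero ha) (by linarith) j

/-- Different parameters are told apart in the sector about the positive real axis, by the
recessive term or by the leading term. -/
theorem injective_chainNF_weberFamily (ha : ∀ m : ℤ, a ≠ m) (h : IsHermite a h₀ h₁)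
    (k : IsHermite (1 - a) k₀ k₁) (j : ℕ) :
    Function.Injective fun c : OnePoint ℂ => chainNF (weberFamily a h₀ k₀ c) (2 * j + 2) := by
  have hπ := Real.pi_pos
  have hb := sector_neBot (show 0 - Real.pi / 4 < 0 + Real.pi / 4 by linarith)
  have hG := Gamma_ne_zero_of_forall_int ha
  have hp := isSectorPair_right h k
  have hinf : ∀ c : ℂ, chainNF (weberFamily a h₀ k₀ c) (2 * j + 2) ≠
      chainNF (weberRight k₀) (2 * j + 2) := by
    intro c hc
    have h1 := isAsymp_chainNF_of_pow (isWeber_weberFamily h k c) one_ne_zero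
      (isAsymp_weberFamily h k c) (add_natCast_ne_zero ha) j
    have h2 := isAsymp_chainNF_of_exp hp.snd one_ne_zero hp.isAsymp_snd j
    have hne : (j : ℂ) + 1 ≠ 0 := Nat.cast_add_one_ne_zero j
    have h3 := h2.add (h1.const_mul (-1)) (by
      rw [neg_one_mul, neg_neg, ← two_mul]
      exact mul_ne_zero two_ne_zero hne)
    obtain ⟨ζ, hζ⟩ := (h3.ne_zero (by
      rw [neg_one_mul, neg_neg, ← two_mul]
      exact mul_ne_zero two_ne_zero hne)).exists
    rw [hc] at hζ
    exact hζ (by ring)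
  intro c c' hcc
  dsimp only at hcc
  induction c with
  | infty =>
    induction c' with
    | infty => rfl
    | coe c' => exact absurd hcc.symm (hinf c')
  | coe c =>
    induction c' with
    | infty => exact absurd hcc (hinf c)
    | coe c' =>
      by_contra hne
      have hne : c ≠ c' := fun e => hne (by rw [e])
      have h2 : (2 : ℂ) ^ a ≠ 0 := by simp [Complex.cpow_eq_zero_iff]
      have hm := div_ne_zero h2 hG
      have hG' : Complex.Gamma (a + (j + 1)) ≠ 0 := by
        refine Complex.Gamma_ne_zero fun m hm => ha (-m - j - 1) ?_
        push_cast
        linear_combination hm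
      have hfac : (j.factorial : ℂ) ≠ 0 := by exact_mod_cast j.factorial_ne_zero
      have h3 := hp.isAsymp_chainNF_sub_of_pow (add_natCast_ne_zero ha) small_sector_right
        (c * ((2 : ℂ) ^ a / Complex.Gamma a)) (c' * ((2 : ℂ) ^ a / Complex.Gamma a)) j
      obtain ⟨ζ, hζ⟩ := (h3.ne_zero (mul_ne_zero (div_ne_zero (mul_ne_zero
        (sub_ne_zero.2 fun e => hne (mul_right_cancel₀ hm e)) hp.wronskian_ne_zero)
        (by norm_num)) (div_ne_zero (by simp [hG]) (mul_ne_zero hG' hfac)))).exists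
      refine hζ (sub_eq_zero.2 (congrFun ?_ _))
      simpa [weberFamily] using hcc

theorem isBackground_of_isAsymp {α β A : ℂ} {B : ℂ → ℂ} (hB : IsP4Solution α β B)
    (h : IsAsymp θ₁ θ₂ (fun ζ => B (Complex.exp ζ)) A (-1) 0) {i : ℤ}
    (h₁ : θ₁ ≤ i * (Real.pi / 2)) (h₂ : ((i : ℝ) + 1) * (Real.pi / 2) ≤ θ₂) :
    IsBackground α β A i B :=
  ⟨hB, (h.mono h₁ h₂).hasLeading⟩

end solutions

end PIV

theorem theorem3 (n : ℕ) (hn : 1 ≤ n) (α β : ℂ) (hβ : β = -2 * (n : ℂ))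
    (hα : ∀ m : ℤ, α + 1 / 2 ≠ (m : ℂ)) :
    ∃ (y : OnePoint ℂ → ℂ → ℂ) (P Q : ℤ → ℂ → ℂ),
      Function.Injective y ∧
      (∀ c : OnePoint ℂ, PIV.IsP4Solution α β (y c) ∧ PIV.IsClassical α β (y c)) ∧
      -- the algebraic backgrounds with leading terms `β/(2x)` and `-β/(2x)`, quadrant by quadrant
      (∀ k : ℤ, -1 ≤ k → k ≤ 2 → PIV.IsBackground α β (β / 2) k (P k)) ∧
      (∀ k : ℤ, 0 ≤ k → k ≤ 3 → PIV.IsBackground α β (-β / 2) k (Q k)) ∧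
      -- sector `-π/4 < arg x < π/4`
      ((∀ c : ℂ, PIV.HasExpansion (y (c : OnePoint ℂ)) (P (-1)) (P 0) (β / 2) (PIV.mu₁ α n c)
          (-1 + 4 * (n : ℂ) + 2 * α) (-1) 0) ∧
        PIV.HasLeading (y OnePoint.infty) (-β / 2) (-(Real.pi / 4)) (Real.pi / 4)) ∧
      -- sector `π/4 < arg x < 3π/4`
      ((∀ c : ℂ, c + PIV.iSqrtPi ≠ 0 →
          PIV.HasExpansion (y (c : OnePoint ℂ)) (Q 0) (Q 1) (-β / 2)
            (PIV.mu₂ α n (PIV.iSqrtPi /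
              ((c + PIV.iSqrtPi) * (Complex.exp (2 * Complex.I * Real.pi * α) + 1))))
            (2 * (n : ℂ) - 1 - 2 * α) 1 (Real.pi / 2)) ∧
        PIV.HasExpansion (y OnePoint.infty) (Q 0) (Q 1) (-β / 2) (PIV.mu₂ α n 0)
          (2 * (n : ℂ) - 1 - 2 * α) 1 (Real.pi / 2) ∧
        (∀ c : ℂ, c + PIV.iSqrtPi = 0 →
          PIV.HasLeading (y (c : OnePoint ℂ)) (β / 2) (Real.pi / 4) (3 * Real.pi / 4))) ∧
      -- sector `3π/4 < arg x < 5π/4`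
      ((∀ c : ℂ, c * (Complex.exp (-2 * Complex.I * Real.pi * α) + 1) + PIV.iSqrtPi ≠ 0 →
          PIV.HasExpansion (y (c : OnePoint ℂ)) (P 1) (P 2) (β / 2)
            (PIV.mu₃ α n ((c + PIV.iSqrtPi) /
              (c * (Complex.exp (-2 * Complex.I * Real.pi * α) + 1) + PIV.iSqrtPi)))
            (4 * (n : ℂ) - 1 + 2 * α) (-1) Real.pi) ∧
        PIV.HasExpansion (y OnePoint.infty) (P 1) (P 2) (β / 2)
          (PIV.mu₃ α n (1 / (Complex.exp (-2 * Complex.I * Real.pi * α) + 1)))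
          (4 * (n : ℂ) - 1 + 2 * α) (-1) Real.pi ∧
        (∀ c : ℂ, c * (Complex.exp (-2 * Complex.I * Real.pi * α) + 1) + PIV.iSqrtPi = 0 →
          PIV.HasLeading (y (c : OnePoint ℂ)) (-β / 2) (3 * Real.pi / 4) (5 * Real.pi / 4))) ∧
      -- sector `5π/4 < arg x < 7π/4`
      ((∀ c : ℂ, c ≠ 0 →
          PIV.HasExpansion (y (c : OnePoint ℂ)) (Q 2) (Q 3) (-β / 2)
            (PIV.mu₄ α n (PIV.iSqrtPi /
              (c * (Complex.exp (-2 * Complex.I * Real.pi * α) + 1))))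
            (2 * (n : ℂ) - 1 - 2 * α) 1 (3 * Real.pi / 2)) ∧
        PIV.HasExpansion (y OnePoint.infty) (Q 2) (Q 3) (-β / 2) (PIV.mu₄ α n 0)
          (2 * (n : ℂ) - 1 - 2 * α) 1 (3 * Real.pi / 2) ∧
        PIV.HasLeading (y ((0 : ℂ) : OnePoint ℂ)) (β / 2) (5 * Real.pi / 4) (7 * Real.pi / 4)) := by
  obtain ⟨j, rfl⟩ : ∃ j, n = j + 1 := ⟨n - 1, by omega⟩
  subst hβ
  obtain ⟨h₀, h₁, h⟩ := PIV.exists_isHermite (α + 1 / 2)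
  obtain ⟨k₀, k₁, k⟩ := PIV.exists_isHermite (1 - (α + 1 / 2))
  have hπ := Real.pi_pos
  have hG := PIV.Gamma_ne_zero_of_forall_int hα
  have hα0 : α + 1 / 2 ≠ 0 := by simpa using hα 0
  have ha := PIV.add_natCast_ne_zero hα
  have hE := PIV.quarterPhase_ne_zero (α + 1 / 2)
  have hE4 := PIV.quarterPhase_pow_four_ne_one hα
  have hS := PIV.stokesMul_ne_zero hG
  have hσ := PIV.iSqrtPi_ne_zero
  have hm : (2 : ℂ) ^ (α + 1 / 2) / Complex.Gamma (α + 1 / 2) ≠ 0 :=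
    div_ne_zero (by simp [Complex.cpow_eq_zero_iff]) hG
  have hE4' : 1 - (PIV.quarterPhase (α + 1 / 2) ^ 4)⁻¹ ≠ 0 := fun e => hE4 (by
    rw [inv_eq_one.1 (sub_eq_zero.1 e).symm, sub_self])
  -- leading terms and parameters in the normalization `n = j + 1`, `a = α + 1/2`
  have eP : -2 * ((j + 1 : ℕ) : ℂ) / 2 = -((j : ℂ) + 1) := by push_cast; ring
  have eQ : -(-2 * ((j + 1 : ℕ) : ℂ)) / 2 = (j : ℂ) + 1 := by push_cast; ring
  have p₁ : -1 + 4 * ((j + 1 : ℕ) : ℂ) + 2 * α = 2 * (α + 1 / 2) + 4 * j + 2 := by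
    push_cast; ring
  have p₃ : 4 * ((j + 1 : ℕ) : ℂ) - 1 + 2 * α = 2 * (α + 1 / 2) + 4 * j + 2 := by
    push_cast; ring
  have p₂ : 2 * ((j + 1 : ℕ) : ℂ) - 1 - 2 * α = 2 - 2 * (α + 1 / 2) + 2 * j := by
    push_cast; ring
  rw [eP, eQ, p₁, p₂, p₃, PIV.exp_two_I_pi_mul, PIV.exp_neg_two_I_pi_mul]
  simp only [neg_add_eq_sub]
  have sol := PIV.solution_weberFamily hα h k j
  have solU := (PIV.solution_of_pow (PIV.isWeber_up h) one_ne_zero (PIV.isAsymp_up h) ha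
    (by linarith) j).1
  have solD := (PIV.solution_of_pow (PIV.isWeber_down h) one_ne_zero (PIV.isAsymp_down h) ha
    (by linarith) j).1
  have hL : -(PIV.quarterPhase (α + 1 / 2) ^ 2)⁻¹ ≠ 0 :=
    neg_ne_zero.2 (inv_ne_zero (pow_ne_zero 2 hE))
  have solL := (PIV.solution_of_exp (PIV.isWeber_left k) hL (PIV.isAsymp_left k)
    (by linarith) j).1
  have solR := (PIV.solution_of_exp (PIV.isWeber_right k) one_ne_zero (PIV.isAsymp_right k)
    (by linarith) j).1
  have leadU := PIV.isAsymp_chainNF_of_pow (PIV.isWeber_up h) one_ne_zero (PIV.isAsymp_up h) ha j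
  have leadD := PIV.isAsymp_chainNF_of_pow (PIV.isWeber_down h) one_ne_zero
    (PIV.isAsymp_down h) ha j
  have leadD' := PIV.isAsymp_chainNF_of_pow (PIV.isWeber_down h) (pow_ne_zero 4 hE)
    (PIV.isAsymp_down_turn h) ha j
  have leadL := PIV.isAsymp_chainNF_of_exp (PIV.isWeber_left k) hL (PIV.isAsymp_left k) j
  have leadR := PIV.isAsymp_chainNF_of_exp (PIV.isWeber_right k) one_ne_zero
    (PIV.isAsymp_right k) j
  have leadR' := PIV.isAsymp_chainNF_of_exp (PIV.isWeber_right k)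
    (inv_ne_zero (pow_ne_zero 4 hE)) (PIV.isAsymp_right_turn k) j
  rw [add_sub_cancel_right] at solU solD solL solR
  simp only [add_sub_cancel_right] at sol
  have hup := PIV.weberFamily_upper h k hG hα0
  have hright := PIV.weberRight_eq h k hG hα0
  -- the backgrounds are generated by the Weber functions with the required behaviour in the whole
  -- quadrant: each of the four functions serves two adjacent quadrants
  refine ⟨fun c => PIV.chainNF (PIV.weberFamily (α + 1 / 2) h₀ k₀ c) (2 * j + 2),
    fun i => if i = -1 ∨ i = 2 then PIV.chainNF (PIV.weberDown (α + 1 / 2) h₀) (2 * j + 2)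
      else PIV.chainNF (PIV.weberUp (α + 1 / 2) h₀) (2 * j + 2),
    fun i => if i = 0 ∨ i = 3 then PIV.chainNF (PIV.weberRight k₀) (2 * j + 2)
      else PIV.chainNF (PIV.weberLeft k₀) (2 * j + 2),
    PIV.injective_chainNF_weberFamily hα h k j, sol, ?_, ?_, ⟨fun c => ?_, ?_⟩,
    ⟨fun c hc => ?_, ?_, fun c hc => ?_⟩, ⟨fun c hc => ?_, ?_, fun c hc => ?_⟩,
    ⟨fun c hc => ?_, ?_, ?_⟩⟩
  · intro i h1 h2
    interval_cases i <;> beta_reduce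
    · rw [if_pos (by norm_num)]
      exact PIV.isBackground_of_isAsymp solD leadD (by push_cast; linarith)
        (by push_cast; linarith)
    · rw [if_neg (by norm_num)]
      exact PIV.isBackground_of_isAsymp solU leadU (by push_cast; linarith)
        (by push_cast; linarith)
    · rw [if_neg (by norm_num)]
      exact PIV.isBackground_of_isAsymp solU leadU (by push_cast; linarith)
        (by push_cast; linarith)
    · rw [if_pos (by norm_num)]
      exact PIV.isBackground_of_isAsymp solD leadD' (by push_cast; linarith)
        (by push_cast; linarith)
  · intro i h1 h2
    interval_cases i <;> beta_reduce
    · rw [if_pos (by norm_num)]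
      exact PIV.isBackground_of_isAsymp solR leadR (by push_cast; linarith)
        (by push_cast; linarith)
    · rw [if_neg (by norm_num)]
      exact PIV.isBackground_of_isAsymp solL leadL (by push_cast; linarith)
        (by push_cast; linarith)
    · rw [if_neg (by norm_num)]
      exact PIV.isBackground_of_isAsymp solL leadL (by push_cast; linarith)
        (by push_cast; linarith)
    · rw [if_pos (by norm_num)]
      exact PIV.isBackground_of_isAsymp solR leadR' (by push_cast; linarith)
        (by push_cast; linarith)
  · exact PIV.hasExpansion_sector_right hα h k j c
  · exact (leadR.mono (by linarith) (by linarith)).hasLeading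
  · refine PIV.hasExpansion_sector_up hα h k j (mul_ne_zero hc hm) fun x => ?_
    rw [hup, PIV.stokesMul]
    generalize (2 : ℂ) ^ (α + 1 / 2) / Complex.Gamma (α + 1 / 2) = m at *
    generalize PIV.weberUp (α + 1 / 2) h₀ x = u
    generalize PIV.quarterPhase (α + 1 / 2) = E at *
    field_simp
  · exact PIV.hasExpansion_sector_up hα h k j one_ne_zero fun x => by
      rw [PIV.weberFamily, OnePoint.elim_infty]
      ring
  · beta_reduce
    rw [PIV.chainNF_eq_of_eq_mul (v := PIV.weberUp (α + 1 / 2) h₀) one_ne_zero fun x => by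
      rw [hup, hc]; ring]
    exact (leadU.mono (by linarith) (by linarith)).hasLeading
  · refine PIV.hasExpansion_sector_left hα h k j
      (mul_ne_zero (div_ne_zero (pow_ne_zero 4 hE) hσ) hc) fun x => ?_
    have hr := hright x
    rw [hup]
    rw [PIV.stokesMul] at hr ⊢
    generalize (2 : ℂ) ^ (α + 1 / 2) / Complex.Gamma (α + 1 / 2) = m at *
    generalize PIV.weberUp (α + 1 / 2) h₀ x = u at *
    generalize PIV.quarterPhase (α + 1 / 2) = E at *
    generalize hD : c * (1 - (E ^ 4)⁻¹) + PIV.iSqrtPi = D at *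
    have hD' : c * (E ^ 4 - 1) + E ^ 4 * PIV.iSqrtPi = E ^ 4 * D := by
      rw [← hD]
      field_simp
    field_simp
    linear_combination (c + PIV.iSqrtPi) * hr + u * hD'
  · have hE5 : PIV.quarterPhase (α + 1 / 2) ^ 4 - 1 ≠ 0 := fun e => hE4 (by linear_combination -e)
    refine PIV.hasExpansion_sector_left hα h k j (div_ne_zero hE5 hS) fun x => ?_
    have hr := hright x
    rw [PIV.weberFamily, OnePoint.elim_infty]
    generalize PIV.weberUp (α + 1 / 2) h₀ x = u at *
    generalize PIV.stokesMul (α + 1 / 2) = S at *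
    generalize PIV.quarterPhase (α + 1 / 2) = E at *
    field_simp
    linear_combination hr
  · -- the coefficient of `weberUp` vanishes, so the solution is the one recessive on `arg x = π`
    have hc' : c + PIV.iSqrtPi ≠ 0 := by
      intro e
      rw [eq_neg_of_add_eq_zero_left e] at hc
      exact mul_ne_zero hσ (inv_ne_zero (pow_ne_zero 4 hE)) (by linear_combination hc)
    beta_reduce
    rw [PIV.chainNF_eq_of_eq_mul (v := PIV.weberLeft k₀)
      (neg_ne_zero.2 (mul_ne_zero (mul_ne_zero hc' hm) (pow_ne_zero 2 hE))) fun x => ?_]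
    · exact (leadL.mono (by linarith) (by linarith)).hasLeading
    have hr := hright x
    rw [hup]
    rw [PIV.stokesMul] at hr
    generalize (2 : ℂ) ^ (α + 1 / 2) / Complex.Gamma (α + 1 / 2) = m at *
    generalize PIV.weberUp (α + 1 / 2) h₀ x = u at *
    generalize PIV.quarterPhase (α + 1 / 2) = E at *
    have hD' : c * (E ^ 4 - 1) + E ^ 4 * PIV.iSqrtPi = 0 := by
      field_simp at hc
      linear_combination hc
    refine mul_left_cancel₀ hσ ?_
    linear_combination (c + PIV.iSqrtPi) * hr + u * hD'
  · refine PIV.hasExpansion_sector_down hα h k j (mul_ne_zero hc hm) fun x => ?_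
    rw [PIV.weberFamily, OnePoint.elim_some, PIV.stokesMul]
    generalize (2 : ℂ) ^ (α + 1 / 2) / Complex.Gamma (α + 1 / 2) = m at *
    generalize PIV.weberDown (α + 1 / 2) h₀ x = u
    generalize 1 - (PIV.quarterPhase (α + 1 / 2) ^ 4)⁻¹ = E at *
    field_simp
  · exact PIV.hasExpansion_sector_down hα h k j one_ne_zero fun x => by
      rw [PIV.weberFamily, OnePoint.elim_infty]
      ring
  · beta_reduce
    rw [PIV.chainNF_eq_of_eq_mul (v := PIV.weberDown (α + 1 / 2) h₀) one_ne_zero fun x => by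
      rw [PIV.weberFamily, OnePoint.elim_some]; ring]
    exact (leadD'.mono (by linarith) (by linarith)).hasLeading
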